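/- Let $M>0$ and let $g_{ab}$ be the Schwarzschild metric of mass $M$ on the exterior $\{r>2M\}$, with signature $(+,-,-,-)$, $$ds^2=\tfrac{\Delta}{r^2}dt^2-\tfrac{r^2}{\Delta}dr^2-r^2(d\theta^2+\sin^2\theta\,d\phi^2),\qquad \Delta=r(r-2M).$$ Use the Carter frame $l=\tfrac{1}{\sqrt2 r}\big(\tfrac{r^2}{\sqrt\Delta}\partial_t+\sqrt\Delta\,\partial_r\big)$, $n=\tfrac{1}{\sqrt2 r}\big(\tfrac{r^2}{\sqrt\Delta}\partial_t-\sqrt\Delta\,\partial_r\big)$, $m=\tfrac{1}{\sqrt2 r}\big(\partial_\theta+\tfrac{i}{\sin\theta}\partial_\phi\big)$, with $D=l^a\nabla_a$, $D'=n^a\nabla_a$, $\delta=m^a\nabla_a$, $\delta'=\bar m^a\nabla_a$, $D_t=D+D'$, $D_r=D-D'$, and put $\rho=-\tfrac{\sqrt\Delta}{\sqrt2r^2}$, $\beta=\tfrac{\cot\theta}{2\sqrt2 r}$, $\epsilon=\tfrac{M}{2\sqrt{2\Delta}\,r}$. On scalars $\xi$ of weight $(p,q)$ the GHP derivatives are $\text{\th}\,\xi=(D-(p+q)\epsilon)\xi$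 of weight $(p+1,q+1)$, $\eth\xi=(\delta-(p-q)\beta)\xi$ of weight $(p+1,q-1)$, and $\eth'\xi=(\delta'+(p-q)\beta)\xi$ of weight $(p-1,q+1)$. Let $\Sigma=\{t=0\}$, with its volume element, induced negative definite metric $h_{ab}$, derivative $D_a$, and lapse $N=\sqrt\Delta/r$; let $\mathscr D_a$ be the covariant derivative on the spheres of constant $t,r$. Let $\hat\gamma_{ab}$ be a smooth real symmetric tensor field on the exterior (also smooth on the axis) that satisfies the linearized vacuum Einstein equation, let $\hat\psi_4$ be the perturbation of $\Psi_4=-C_{abcd}n^a\bar m^bn^c\bar m^d$ due to $\hat\gamma_{ab}$, and put $\psi=r^4\hat\psi_4$, of weight $(-4,0)$, and $\eta=(\text{\th}+3\rho)\psi$, of weight $(-3,1)$. Assume that, for some $0<\varepsilon<1$ and every $n\ge0$, all $n$-fold products of $D_r,\eth,\eth'$ applied to $\psi$, respectively $\eta$, are on $\Sigma$ bounded by a constant times $r^{1/2+\varepsilon-n}$, respectively $r^{-1/2-\varepsilon-n}$, uniformly for $r>2M$ and on the spheres (so the data are regular up to the bifurcation sphere $r=2M$). Let $\gamma=\mathcal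 S^\dagger[\psi]$ be the complex metric perturbation generated by $\psi$ as a Hertz potential, $$\gamma_{ab}=-l_al_bU+l_{(a}m_{b)}V-m_am_bW,\quad U=\eth^2\psi,\quad V=[\text{\th}\,\eth+\eth(\text{\th}+3\rho)]\psi,\quad W=(\text{\th}-\rho)(\text{\th}+3\rho)\psi,$$ and let $$\mathscr E[\gamma]=\frac1{16\pi}\int_\Sigma\big(\bar p^{ab}\,\pounds_tq_{ab}-\bar q_{ab}\,\pounds_tp^{ab}\big)$$ be its canonical energy, where $q_{ab}=h_a{}^ch_b{}^d\gamma_{cd}$ and where $p_{ab}$ is the perturbed canonical momentum, given by $\pounds_tq_{ab}=2N(p_{ab}-\tfrac12p\,h_{ab})+2D_{(a}(h_{b)}{}^ct^d\gamma_{cd})$ with $t^a=\partial_t$. Let $\mathcal V=\tfrac4{r^2}-\tfrac{6M}{r^3}$ and let $$\underline\Psi_{ab}=-\tfrac{r^3}{4\sqrt\Delta}D\Big[\tfrac{r^3}{\sqrt\Delta}D\Big\{\tfrac{\Delta}{r}\big(m_am_b\hat\psi_4+\bar m_a\bar m_b\overline{\hat\psi_4}\big)\Big\}\Big],$$ $$\mathscr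 E_{\rm DHR}[\hat\gamma]=\int_\Sigma Nr^{-2}\Big[\tfrac12(D_t\underline\Psi_{ab})^2+\tfrac12(D_r\underline\Psi_{ab})^2-(\mathscr D_c\underline\Psi_{ab})^2+\mathcal V(\underline\Psi_{ab})^2\Big]$$ be the Regge--Wheeler variable and energy of Dafermos, Holzegel and Rodnianski, where squares denote contraction with the background metric. Then, with $\Psi_{\rm DHR}=(\text{\th}+\rho)(\text{\th}+3\rho)\psi$, of weight $(-2,2)$, one has $\underline\Psi_{ab}=-\tfrac r4\big(m_am_b\Psi_{\rm DHR}+\bar m_a\bar m_b\overline{\Psi_{\rm DHR}}\big)$, the integrals for $\mathscr E_{\rm DHR}[\hat\gamma]$ and $\mathscr E[\gamma]$ converge absolutely, and $$\mathscr E_{\rm DHR}[\hat\gamma]=\tfrac18\int_\Sigma N\Big[\tfrac12|D_t\Psi_{\rm DHR}|^2+\tfrac12|(D_r-2\rho)\Psi_{\rm DHR}|^2+|\eth\Psi_{\rm DHR}|^2+|\eth'\Psi_{\rm DHR}|^2+\mathcal V|\Psi_{\rm DHR}|^2\Big]=4\pi\,\mathscr E[\gamma].$$ -/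

import Mathlib

open scoped ContDiff

noncomputable section

namespace SchwarzschildHertz

/-! Spherical coordinates `x = (t, r, θ, φ)` on the exterior of a Schwarzschild black hole of
mass `M`, signature `(+,-,-,-)`. A tensor field is given by its (complex) coordinate components,
`T a b x` being the component with lower indices `a, b` at `x`. -/

abbrev Pt := Fin 4 → ℝ

/-- Partial derivative in the coordinate direction `a`. -/
def pd (a : Fin 4) (f : Pt → ℂ) (x : Pt) : ℂ := fderiv ℝ f x (Pi.single a 1)

/-- The coordinate domain of the exterior (the axis is not covered). -/
def exterior (M : ℝ) : Set Pt := {x | 2 * M < x 1 ∧ 0 < x 2 ∧ x 2 < Real.pi}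

/-- `Δ = r (r - 2M)`. -/
def Del (M : ℝ) (x : Pt) : ℝ := x 1 * (x 1 - 2 * M)

def sqrtDel (M : ℝ) (x : Pt) : ℝ := Real.sqrt (Del M x)

/-! ### The Schwarzschild metric and its Levi-Civita connection -/

def gDiag (M : ℝ) (x : Pt) : Fin 4 → ℝ :=
  ![Del M x / x 1 ^ 2, -(x 1 ^ 2 / Del M x), -(x 1 ^ 2), -(x 1 ^ 2 * Real.sin (x 2) ^ 2)]

/-- The metric `g_ab`. -/
def g (M : ℝ) (a b : Fin 4) (x : Pt) : ℂ := if a = b then (gDiag M x a : ℂ) else 0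

/-- The inverse metric `g^ab`. -/
def gInv (M : ℝ) (a b : Fin 4) (x : Pt) : ℂ := if a = b then ((gDiag M x a)⁻¹ : ℂ) else 0

/-- Christoffel symbols `Γ^c_ab`. -/
def chr (M : ℝ) (c a b : Fin 4) (x : Pt) : ℂ :=
  1 / 2 * ∑ d, gInv M c d x * (pd a (g M b d) x + pd b (g M a d) x - pd d (g M a b) x)

/-- `cov1 w a b = ∇_a w_b`. -/
def cov1 (M : ℝ) (w : Fin 4 → Pt → ℂ) (a b : Fin 4) (x : Pt) : ℂ :=
  pd a (w b) x - ∑ d, chr M d a b x * w d x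

/-- `cov2 T c a b = ∇_c T_ab`. -/
def cov2 (M : ℝ) (T : Fin 4 → Fin 4 → Pt → ℂ) (c a b : Fin 4) (x : Pt) : ℂ :=
  pd c (T a b) x - ∑ d, (chr M d c a x * T d b x + chr M d c b x * T a d x)

/-- `cov3 T e a b c = ∇_e T_abc`. -/
def cov3 (M : ℝ) (T : Fin 4 → Fin 4 → Fin 4 → Pt → ℂ) (e a b c : Fin 4) (x : Pt) : ℂ :=
  pd e (T a b c) x -
    ∑ d, (chr M d e a x * T d b c x + chr M d e b x * T a d c x + chr M d e c x * T a b d x)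

/-- `R_abc^d`, with `∇_a ∇_b ω_c - ∇_b ∇_a ω_c = R_abc^d ω_d`. -/
def riem (M : ℝ) (a b c d : Fin 4) (x : Pt) : ℂ :=
  pd b (chr M d a c) x - pd a (chr M d b c) x +
    ∑ e, (chr M e a c x * chr M d e b x - chr M e b c x * chr M d e a x)

/-! ### Linearised gravity -/

/-- The trace `γ = g^ab γ_ab`. -/
def tr (M : ℝ) (γ : Fin 4 → Fin 4 → Pt → ℂ) (x : Pt) : ℂ :=
  ∑ a, ∑ b, gInv M a b x * γ a b x

/-- The linearised Einstein operator
`- ∇²γ_ab - ∇_a∇_b γ + 2 ∇^c ∇_(a γ_b)c + g_ab (∇²γ - ∇^c ∇^d γ_cd)`. -/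
def linEinstein (M : ℝ) (γ : Fin 4 → Fin 4 → Pt → ℂ) (a b : Fin 4) (x : Pt) : ℂ :=
  -(∑ c, ∑ d, gInv M c d x * cov3 M (cov2 M γ) c d a b x)
  - cov1 M (fun e => pd e (tr M γ)) a b x
  + (∑ c, ∑ d, gInv M c d x *
      (cov3 M (cov2 M γ) d a b c x + cov3 M (cov2 M γ) d b a c x))
  + g M a b x *
      ((∑ c, ∑ d, gInv M c d x * cov1 M (fun e => pd e (tr M γ)) c d x)
        - ∑ c, ∑ d, ∑ e, ∑ f,
            gInv M c e x * gInv M d f x * cov3 M (cov2 M γ) e f c d x)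

/-- The perturbed Christoffel symbols with the upper index lowered,
`(δΓ)_dbc = (∇_b γ_dc + ∇_c γ_bd - ∇_d γ_bc) / 2`. -/
def linChr (M : ℝ) (γ : Fin 4 → Fin 4 → Pt → ℂ) (d b c : Fin 4) (x : Pt) : ℂ :=
  1 / 2 * (cov2 M γ b d c x + cov2 M γ c b d x - cov2 M γ d b c x)

/-- The perturbation of `R_abcd = R_abc^e g_ed`. -/
def linRiem (M : ℝ) (γ : Fin 4 → Fin 4 → Pt → ℂ) (a b c d : Fin 4) (x : Pt) : ℂ :=
  cov3 M (linChr M γ) b d a c x - cov3 M (linChr M γ) a d b c x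
    + ∑ e, riem M a b c e x * γ e d x

/-! ### The Carter frame -/

/-- `l^a`. -/
def lUp (M : ℝ) (x : Pt) : Fin 4 → ℂ :=
  ![((x 1 / (Real.sqrt 2 * sqrtDel M x) : ℝ) : ℂ),
    ((sqrtDel M x / (Real.sqrt 2 * x 1) : ℝ) : ℂ), 0, 0]

/-- `n^a`. -/
def nUp (M : ℝ) (x : Pt) : Fin 4 → ℂ :=
  ![((x 1 / (Real.sqrt 2 * sqrtDel M x) : ℝ) : ℂ),
    -((sqrtDel M x / (Real.sqrt 2 * x 1) : ℝ) : ℂ), 0, 0]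

/-- `m^a`. -/
def mUp (x : Pt) : Fin 4 → ℂ :=
  ![0, 0, ((1 / (Real.sqrt 2 * x 1) : ℝ) : ℂ),
    Complex.I * ((1 / (Real.sqrt 2 * x 1 * Real.sin (x 2)) : ℝ) : ℂ)]

/-- The complex conjugate of `m^a`. -/
def mbUp (x : Pt) : Fin 4 → ℂ := fun a => starRingEnd ℂ (mUp x a)

/-- Lowering the index of a vector field. -/
def lower (M : ℝ) (v : Pt → Fin 4 → ℂ) (a : Fin 4) (x : Pt) : ℂ := ∑ b, g M a b x * v x b

/-- Derivative of a scalar along a vector field. -/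
def dir (v : Pt → Fin 4 → ℂ) (f : Pt → ℂ) (x : Pt) : ℂ := ∑ a, v x a * pd a f x

/-! The non-vanishing spin coefficients are `ρ = -ρ'`, `β = β'`, `ε = -ε'`. -/

def rho (M : ℝ) (x : Pt) : ℝ := -(sqrtDel M x / (Real.sqrt 2 * x 1 ^ 2))

def eps (M : ℝ) (x : Pt) : ℝ := M / (2 * Real.sqrt 2 * sqrtDel M x * x 1)

def beta (x : Pt) : ℝ := Real.cot (x 2) / (2 * Real.sqrt 2 * x 1)

/-! The GHP derivatives on scalars of weight `(p, q)`:
`þ = D - pε - qε̄`, `ð = δ - pβ + q β̄'`, `ð' = δ' + pβ' - q β̄`. -/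

def thorn (M : ℝ) (p q : ℤ) (f : Pt → ℂ) (x : Pt) : ℂ :=
  dir (lUp M) f x - p * eps M x * f x - q * eps M x * f x

def eth (p q : ℤ) (f : Pt → ℂ) (x : Pt) : ℂ :=
  dir mUp f x - p * beta x * f x + q * beta x * f x

def eth' (p q : ℤ) (f : Pt → ℂ) (x : Pt) : ℂ :=
  dir mbUp f x + p * beta x * f x - q * beta x * f x

/-- `D_t = D + D'`. -/
def Dt (M : ℝ) (f : Pt → ℂ) (x : Pt) : ℂ := dir (lUp M) f x + dir (nUp M) f x

/-- `D_r = D - D'`. -/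
def Dr (M : ℝ) (f : Pt → ℂ) (x : Pt) : ℂ := dir (lUp M) f x - dir (nUp M) f x

/-! ### The perturbation `γ̂` and its Teukolsky variable -/

/-- The exterior in Cartesian-like coordinates `(t, x, y, z)`, a global chart (axis included). -/
def cartExterior (M : ℝ) : Set Pt := {X | 2 * M < Real.sqrt (X 1 ^ 2 + X 2 ^ 2 + X 3 ^ 2)}

/-- `(t, r, θ, φ) ↦ (t, r sin θ cos φ, r sin θ sin φ, r cos θ)`. -/
def toCart (x : Pt) : Pt :=
  ![x 0, x 1 * Real.sin (x 2) * Real.cos (x 3), x 1 * Real.sin (x 2) * Real.sin (x 3),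
    x 1 * Real.cos (x 2)]

/-- The spherical components of the tensor with Cartesian components `H`. -/
def toSpherical (H : Pt → Fin 4 → Fin 4 → ℝ) (a b : Fin 4) (x : Pt) : ℂ :=
  ∑ i, ∑ j, pd a (fun y => (toCart y i : ℂ)) x * pd b (fun y => (toCart y j : ℂ)) x *
    (H (toCart x) i j : ℂ)

/-- The perturbation of the Weyl scalar `Ψ₄ = - C_abcd n^a m̄^b n^c m̄^d`. The Ricci part of the
Riemann tensor drops out of this contraction, and the perturbation of the frame does not contribute
because the other Weyl scalars of the background, apart from `Ψ₂`, vanish. -/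
def psi4 (M : ℝ) (γ : Fin 4 → Fin 4 → Pt → ℂ) (x : Pt) : ℂ :=
  -∑ a, ∑ b, ∑ c, ∑ d, linRiem M γ a b c d x * nUp M x a * mbUp x b * nUp M x c * mbUp x d

/-- `ψ = r⁴ ψ̂₄`, of weight `(-4, 0)`. -/
def teukolskyVar (M : ℝ) (γ : Fin 4 → Fin 4 → Pt → ℂ) (x : Pt) : ℂ := (x 1 : ℂ) ^ 4 * psi4 M γ x

/-! ### The metric perturbation generated by a Hertz potential -/

/-- `η = (þ + 3ρ) ψ`, of weight `(-3, 1)`. -/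
def etaOf (M : ℝ) (ψ : Pt → ℂ) (x : Pt) : ℂ := thorn M (-4) 0 ψ x + 3 * rho M x * ψ x

/-- `U = ð² ψ`. -/
def hertzU (ψ : Pt → ℂ) : Pt → ℂ := eth (-3) (-1) (eth (-4) 0 ψ)

/-- `V = [þ ð + ð (þ + 3ρ)] ψ`. -/
def hertzV (M : ℝ) (ψ : Pt → ℂ) (x : Pt) : ℂ :=
  thorn M (-3) (-1) (eth (-4) 0 ψ) x + eth (-3) 1 (etaOf M ψ) x

/-- `W = (þ - ρ) (þ + 3ρ) ψ`. -/
def hertzW (M : ℝ) (ψ : Pt → ℂ) (x : Pt) : ℂ :=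
  thorn M (-3) 1 (etaOf M ψ) x - rho M x * etaOf M ψ x

/-- `γ_ab = (𝒮†[ψ])_ab = - l_a l_b U + l_(a m_b) V - m_a m_b W`. -/
def hertzMetric (M : ℝ) (ψ : Pt → ℂ) (a b : Fin 4) (x : Pt) : ℂ :=
  -(lower M (lUp M) a x * lower M (lUp M) b x * hertzU ψ x)
  + 1 / 2 * (lower M (lUp M) a x * lower M mUp b x + lower M mUp a x * lower M (lUp M) b x)
      * hertzV M ψ x
  - lower M mUp a x * lower M mUp b x * hertzW M ψ x

/-! ### Initial data on `Σ = {t = 0}` and the canonical energy -/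

/-- The lapse `N = √Δ / r`. -/
def lapse (M : ℝ) (x : Pt) : ℝ := sqrtDel M x / x 1

/-- The projector `h_a^b` onto the surfaces of constant `t`. -/
def hProj (a b : Fin 4) : ℂ := if a = b ∧ a ≠ 0 then 1 else 0

/-- The (negative definite) induced metric `h_ab`. -/
def hMet (M : ℝ) (a b : Fin 4) (x : Pt) : ℂ := ∑ c, ∑ d, hProj a c * hProj b d * g M c d x

/-- The perturbed spatial metric `q_ab = h_a^c h_b^d γ_cd`. -/
def qData (γ : Fin 4 → Fin 4 → Pt → ℂ) (a b : Fin 4) (x : Pt) : ℂ :=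
  ∑ c, ∑ d, hProj a c * hProj b d * γ c d x

/-- The perturbed shift covector `h_b^c t^d γ_cd`. -/
def shift (γ : Fin 4 → Fin 4 → Pt → ℂ) (b : Fin 4) (x : Pt) : ℂ := ∑ c, hProj b c * γ c 0 x

/-- The spatial covariant derivative `D_a w_b = h_a^c h_b^d ∇_c w_d` of a spatial covector. -/
def spatialCov1 (M : ℝ) (w : Fin 4 → Pt → ℂ) (a b : Fin 4) (x : Pt) : ℂ :=
  ∑ c, ∑ d, hProj a c * hProj b d * cov1 M w c d x

/-- `k_ab = p_ab - (1/2) p h_ab`, as given by the linearised evolution equation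
`∂_t q_ab = 2N (p_ab - (1/2) p h_ab) + 2 D_(a (h_b)^c t^d γ_cd)`. -/
def kData (M : ℝ) (γ : Fin 4 → Fin 4 → Pt → ℂ) (a b : Fin 4) (x : Pt) : ℂ :=
  (pd 0 (qData γ a b) x - spatialCov1 M (shift γ) a b x - spatialCov1 M (shift γ) b a x)
    / (2 * lapse M x)

/-- The perturbed canonical momentum `p_ab = k_ab - (h^cd k_cd) h_ab`, the solution of
`p_ab - (1/2) p h_ab = k_ab`. -/
def pData (M : ℝ) (γ : Fin 4 → Fin 4 → Pt → ℂ) (a b : Fin 4) (x : Pt) : ℂ :=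
  kData M γ a b x - tr M (kData M γ) x * hMet M a b x

/-- `S^ab T_ab`, indices raised with the background metric. -/
def contract2 (M : ℝ) (S T : Fin 4 → Fin 4 → Pt → ℂ) (x : Pt) : ℂ :=
  ∑ a, ∑ b, ∑ c, ∑ d, gInv M a c x * gInv M b d x * S a b x * T c d x

/-- Componentwise complex conjugate. -/
def conjT (T : Fin 4 → Fin 4 → Pt → ℂ) (a b : Fin 4) (x : Pt) : ℂ := starRingEnd ℂ (T a b x)

/-- The Lie derivative along the Killing field `∂_t`. -/
def lieT (T : Fin 4 → Fin 4 → Pt → ℂ) (a b : Fin 4) (x : Pt) : ℂ := pd 0 (T a b) x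

/-- The range of the coordinates `(r, θ, φ)` on `Σ`. -/
def sigmaDom (M : ℝ) : Set (ℝ × ℝ × ℝ) :=
  Set.Ioi (2 * M) ×ˢ (Set.Ioo 0 Real.pi ×ˢ Set.Ioo 0 (2 * Real.pi))

/-- The point of `Σ` with coordinates `(r, θ, φ)`. -/
def sigmaPt (y : ℝ × ℝ × ℝ) : Pt := ![0, y.1, y.2.1, y.2.2]

/-- The density of the volume element of `Σ`, `(r / √Δ) r² sin θ`. -/
def sigmaVol (M : ℝ) (x : Pt) : ℝ := x 1 / sqrtDel M x * (x 1 ^ 2 * Real.sin (x 2))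

/-- `∫_Σ F`. -/
def sigmaInt (M : ℝ) (F : Pt → ℂ) : ℂ :=
  ∫ y in sigmaDom M, F (sigmaPt y) * (sigmaVol M (sigmaPt y) : ℂ)

def SigmaIntegrable (M : ℝ) (F : Pt → ℂ) : Prop :=
  MeasureTheory.IntegrableOn (fun y => F (sigmaPt y) * (sigmaVol M (sigmaPt y) : ℂ)) (sigmaDom M)

/-- The integrand `p₁^ab q₂_ab - q₁_ab p₂^ab` of the symplectic product. -/
def symplecticDensity (M : ℝ) (γ₁ γ₂ : Fin 4 → Fin 4 → Pt → ℂ) (x : Pt) : ℂ :=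
  contract2 M (pData M γ₁) (qData γ₂) x - contract2 M (qData γ₁) (pData M γ₂) x

/-- The integrand of the canonical energy of a complex perturbation (antilinear in the first
argument of the symplectic product). -/
def canonicalDensity (M : ℝ) (γ : Fin 4 → Fin 4 → Pt → ℂ) : Pt → ℂ :=
  symplecticDensity M (conjT γ) (lieT γ)

/-- The canonical energy `𝓔[γ] = Ω(γ̄, £_t γ)`, where the symplectic product carries the usual
normalisation factor `1 / 16π`. -/
def canonicalEnergy (M : ℝ) (γ : Fin 4 → Fin 4 → Pt → ℂ) : ℂ :=
  1 / (16 * Real.pi) * sigmaInt M (canonicalDensity M γ)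

/-! ### The Dafermos-Holzegel-Rodnianski energy -/

/-- The derivative `v^c ∇_c T_ab`. -/
def dirCov (M : ℝ) (v : Pt → Fin 4 → ℂ) (T : Fin 4 → Fin 4 → Pt → ℂ) (a b : Fin 4) (x : Pt) : ℂ :=
  ∑ c, v x c * cov2 M T c a b x

/-- `m_a m_b f + m̄_a m̄_b f̄`. -/
def mmTensor (M : ℝ) (f : Pt → ℂ) (a b : Fin 4) (x : Pt) : ℂ :=
  lower M mUp a x * lower M mUp b x * f x
    + starRingEnd ℂ (lower M mUp a x * lower M mUp b x * f x)

/-- The tensorial variable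
`Ψ_ab = -(r³ / 4√Δ) D [ (r³ / √Δ) D { (Δ / r) (m_a m_b ψ̂₄ + c.c.) } ]`. -/
def dhrTensor (M : ℝ) (γ : Fin 4 → Fin 4 → Pt → ℂ) (a b : Fin 4) (x : Pt) : ℂ :=
  -((x 1 ^ 3 / (4 * sqrtDel M x) : ℝ) : ℂ) *
    dirCov M (lUp M) (fun a b y => ((y 1 ^ 3 / sqrtDel M y : ℝ) : ℂ) *
      dirCov M (lUp M) (fun a b z => ((Del M z / z 1 : ℝ) : ℂ) * mmTensor M (psi4 M γ) a b z)
        a b y) a b x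

/-- The projector `s_a^b = -(m_a m̄^b + m̄_a m^b)` onto the spheres of constant `t, r`. -/
def sProj (M : ℝ) (a b : Fin 4) (x : Pt) : ℂ :=
  -(lower M mUp a x * mbUp x b + lower M mbUp a x * mUp x b)

/-- The covariant derivative `𝒟_c T_ab` on the spheres, the projection of `∇_c T_ab`. -/
def sphereCov2 (M : ℝ) (T : Fin 4 → Fin 4 → Pt → ℂ) (c a b : Fin 4) (x : Pt) : ℂ :=
  ∑ f, ∑ d, ∑ e, sProj M c f x * sProj M a d x * sProj M b e x * cov2 M T f d e x

/-- `(T_cab)² = T_cab T^cab`. -/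
def sq3 (M : ℝ) (T : Fin 4 → Fin 4 → Fin 4 → Pt → ℂ) (x : Pt) : ℂ :=
  ∑ c, ∑ a, ∑ b, ∑ f, ∑ d, ∑ e,
    gInv M c f x * gInv M a d x * gInv M b e x * T c a b x * T f d e x

/-- `(T_ab)² = T_ab T^ab`. -/
def sq2 (M : ℝ) (T : Fin 4 → Fin 4 → Pt → ℂ) (x : Pt) : ℂ := contract2 M T T x

/-- `𝒱 = 4/r² - 6M/r³`. -/
def dhrPotential (M : ℝ) (x : Pt) : ℝ := 4 / x 1 ^ 2 - 6 * M / x 1 ^ 3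

/-- `N r⁻² [ ½ (D_t Ψ_ab)² + ½ (D_r Ψ_ab)² - (𝒟_c Ψ_ab)² + 𝒱 (Ψ_ab)² ]`. -/
def dhrDensity (M : ℝ) (Ψ : Fin 4 → Fin 4 → Pt → ℂ) (x : Pt) : ℂ :=
  ((lapse M x / x 1 ^ 2 : ℝ) : ℂ) *
    (1 / 2 * sq2 M (fun a b y => dirCov M (lUp M) Ψ a b y + dirCov M (nUp M) Ψ a b y) x
      + 1 / 2 * sq2 M (fun a b y => dirCov M (lUp M) Ψ a b y - dirCov M (nUp M) Ψ a b y) x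
      - sq3 M (sphereCov2 M Ψ) x
      + dhrPotential M x * sq2 M Ψ x)

/-- The Regge-Wheeler energy `𝓔_DHR[γ̂]`. -/
def dhrEnergy (M : ℝ) (γ : Fin 4 → Fin 4 → Pt → ℂ) : ℂ := sigmaInt M (dhrDensity M (dhrTensor M γ))

/-- The scalar variable `Ψ_DHR = (þ + ρ) (þ + 3ρ) ψ`, of weight `(-2, 2)`. -/
def dhrScalar (M : ℝ) (ψ : Pt → ℂ) (x : Pt) : ℂ :=
  thorn M (-3) 1 (etaOf M ψ) x + rho M x * etaOf M ψ x

/-- `N [ ½ |D_t Ψ|² + ½ |(D_r - 2ρ) Ψ|² + |ð Ψ|² + |ð' Ψ|² + 𝒱 |Ψ|² ]` for `Ψ` of weight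
`(-2, 2)`. -/
def dhrScalarDensity (M : ℝ) (Ψ : Pt → ℂ) (x : Pt) : ℂ :=
  ((lapse M x * (1 / 2 * ‖Dt M Ψ x‖ ^ 2 + 1 / 2 * ‖Dr M Ψ x - 2 * rho M x * Ψ x‖ ^ 2
    + ‖eth (-2) 2 Ψ x‖ ^ 2 + ‖eth' (-2) 2 Ψ x‖ ^ 2 + dhrPotential M x * ‖Ψ x‖ ^ 2) : ℝ) : ℂ)

/-! ### Regularity of the initial data of a Hertz potential -/

inductive SpatialDer
  | rad
  | eth
  | eth'

/-- A product of derivatives `D_r`, `ð`, `ð'` applied to a scalar of weight `(p, q)`; the head of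
the list acts first. -/
def spatialDers (M : ℝ) : ℤ → ℤ → List SpatialDer → (Pt → ℂ) → Pt → ℂ
  | _, _, [], f => f
  | p, q, SpatialDer.rad :: w, f => spatialDers M p q w (Dr M f)
  | p, q, SpatialDer.eth :: w, f => spatialDers M (p + 1) (q - 1) w (eth p q f)
  | p, q, SpatialDer.eth' :: w, f => spatialDers M (p - 1) (q + 1) w (eth' p q f)

/-- On `Σ`, all spatial derivatives (in the Carter frame) of order `n ≥ 0` of the scalar `f` of
weight `(p, q)` are `O(r^(k - n))`, uniformly on the spheres. They are bounded up to the
bifurcation sphere `r = 2M`. -/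
def SpatialBound (M : ℝ) (p q : ℤ) (k : ℝ) (f : Pt → ℂ) : Prop :=
  ∀ w : List SpatialDer, ∃ C : ℝ, ∀ x ∈ exterior M, x 0 = 0 →
    ‖spatialDers M p q w f x‖ ≤ C * x 1 ^ (k - w.length)

/-- The initial data `(ψ, η)` on `Σ` are regular up to the bifurcation sphere, and satisfy
`ψ = O(r^(1/2 + ε))`, `η = O(r^-(1/2 + ε))` at infinity with the corresponding decay of the
derivatives. -/
def HertzData (M : ℝ) (ψ : Pt → ℂ) : Prop :=
  ∃ ε : ℝ, 0 < ε ∧ ε < 1 ∧ SpatialBound M (-4) 0 (1 / 2 + ε) ψ ∧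
    SpatialBound M (-3) 1 (-(1 / 2 + ε)) (etaOf M ψ)

end SchwarzschildHertz

end

open SchwarzschildHertz

noncomputable section

namespace SchwarzschildHertz

set_option linter.unusedSectionVars false

/-! ### The ring of smooth functions on the exterior, periodic in `φ` -/

/-! All fields are treated as elements of one commutative ring `Sm M` of smooth, `φ`-periodic
functions with commuting derivations `D i`; `Rep F a` ties a coordinate expression `F` to the ring
element `a`. Since `M = r (1 - N²) / 2`, the background is rational in `r`, `N`, `sin θ`, `cos θ`,
and tensor identities become polynomial identities in the unknowns and their derivatives.

The field equations enter once. The components of the linearised Einstein operator along `nn`, `n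
m̄`, `m̄ m̄`, computed in a null frame, combine into the Teukolsky equation for `ψ`
(`teukolsky_identity`, `exists_teukolsky`). With `G = √2 r (þ + 3ρ) ψ`, that equation and the
definition of `G` form a first-order system in time for the pair `(ψ, G)` (`dT_psi`, `dT_G`). On `Σ`
every time derivative can therefore be traded for spatial derivatives of `ψ` and `G`.

In these variables both energy densities are `r⁻⁶` times sesquilinear expressions in `ψ` and `G`,
built from `N`, the radial derivative `th = r N ∂_r` and spherical operators (`canQ_eq`, `dhrQ_eq`).
No negative power of `N` survives, which is regularity at the bifurcation sphere. The operator `an =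
-ð' ð` on spin weight `-2` is symmetric on the spheres and commutes with `N` and `th`. Integration
by parts moves every angular operator onto the unconjugated factor, where only powers of `an` remain
(`nul_ed_ed`, `nul_ed'_ed'`, `nul_an`). What is left is an algebraic identity: the two densities
differ by a radial total derivative with the explicit flux `bC` (`energy_identity`).

The boundary terms vanish. The flux carries a factor `N`, which is zero at `r = 2M`. All derivatives
of `ψ` and `G` are `O(r^k)` with `k = 1/2 + ε < 3/2`, so the densities are `O(r^(2k - 6))` with `2k
- 6 < -3`, integrable against the volume element, and the flux decays at infinity. On the spheres
the boundary terms vanish through the factor `sin θ` at the poles and periodicity in `φ`. Hence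
`nul_canQ_sub_dhrQ`: the difference of the densities `niC * canQ` and `dhrQ` is integrable with
integral zero. The tensorial energy reduces to `dhrQ` because `m_a` is parallel along `∂_t` and
`∂_r` (`rep_dhrTensor`, `rep_dhrDensity`). -/

lemma isOpen_exterior (M : ℝ) : IsOpen (exterior M) := by
  unfold exterior
  refine IsOpen.and ?_ (IsOpen.and ?_ ?_)
  · exact isOpen_lt continuous_const (continuous_apply 1)
  · exact isOpen_lt continuous_const (continuous_apply 2)
  · exact isOpen_lt (continuous_apply 2) continuous_const

/-- A full turn around the axis. -/
def turn (x : Pt) : Pt := x + Pi.single 3 (2 * Real.pi)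

lemma turn_mem {M : ℝ} {x : Pt} : turn x ∈ exterior M ↔ x ∈ exterior M := by
  simp [exterior, turn]

/-- Extension by zero. -/
def ext0 {M : ℝ} (f : exterior M → ℂ) (x : Pt) : ℂ :=
  open Classical in if h : x ∈ exterior M then f ⟨x, h⟩ else 0

lemma ext0_mem {M : ℝ} (f : exterior M → ℂ) {x : Pt} (h : x ∈ exterior M) :
    ext0 f x = f ⟨x, h⟩ := by simp [ext0, h]

/-- Periodicity is part of the ring so that azimuthal boundary terms cancel. Nothing is recorded
about the axis: control there comes from the uniform bounds in `HertzData`. -/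
def smoothFun (M : ℝ) : Subalgebra ℂ (exterior M → ℂ) where
  carrier := {f | ContDiffOn ℝ ∞ (ext0 f) (exterior M) ∧
    ∀ x ∈ exterior M, ext0 f (turn x) = ext0 f x}
  mul_mem' := by
    rintro a b ⟨ha, ha'⟩ ⟨hb, hb'⟩
    have h : ext0 (a * b) = fun x => ext0 a x * ext0 b x := by
      ext x; by_cases hx : x ∈ exterior M <;> simp [ext0, hx]
    refine ⟨h ▸ ha.mul hb, fun x hx => ?_⟩
    simp only [h, ha' x hx, hb' x hx]
  add_mem' := by
    rintro a b ⟨ha, ha'⟩ ⟨hb, hb'⟩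
    have h : ext0 (a + b) = fun x => ext0 a x + ext0 b x := by
      ext x; by_cases hx : x ∈ exterior M <;> simp [ext0, hx]
    refine ⟨h ▸ ha.add hb, fun x hx => ?_⟩
    simp only [h, ha' x hx, hb' x hx]
  algebraMap_mem' := by
    intro c
    refine ⟨(contDiffOn_const (c := c)).congr fun x hx => ?_, fun x hx => ?_⟩
    · simp [ext0_mem _ hx]
    · rw [ext0_mem _ hx, ext0_mem _ (turn_mem.2 hx)]; rfl

/-- The ring of smooth complex functions on the exterior that are periodic in `φ`. -/
def Sm (M : ℝ) : Type := smoothFun M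

instance (M : ℝ) : CommRing (Sm M) := inferInstanceAs (CommRing (smoothFun M))
instance (M : ℝ) : Algebra ℂ (Sm M) := inferInstanceAs (Algebra ℂ (smoothFun M))

variable {M : ℝ}

/-- Evaluation at a point. -/
def ev (x : exterior M) : Sm M →ₐ[ℂ] ℂ :=
  (Pi.evalAlgHom ℂ (fun _ : exterior M => ℂ) x).comp (smoothFun M).val

attribute [simp] map_ofNat

/-- `Sm M` is not a field, but after evaluation `r`, `N` and `sin θ` are nonzero complex numbers, so
identities with denominators can be cleared by `field_simp`. -/
lemma Sm.ext_ev {a b : Sm M} (h : ∀ x : exterior M, ev x a = ev x b) : a = b :=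
  Subtype.ext (funext h)

/-- The extension of an element of `Sm M` by zero. -/
def Sm.fn (a : Sm M) : Pt → ℂ := ext0 (a : smoothFun M).1

lemma Sm.fn_eq (a : Sm M) (x : exterior M) : a.fn x = ev x a := ext0_mem _ x.2

lemma Sm.smooth (a : Sm M) : ContDiffOn ℝ ∞ a.fn (exterior M) := (a : smoothFun M).2.1

lemma Sm.periodic (a : Sm M) {x : Pt} (hx : x ∈ exterior M) : a.fn (turn x) = a.fn x :=
  (a : smoothFun M).2.2 x hx

lemma Sm.differentiableAt (a : Sm M) {x : Pt} (hx : x ∈ exterior M) :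
    DifferentiableAt ℝ a.fn x :=
  (a.smooth.differentiableOn (by simp)).differentiableAt ((isOpen_exterior M).mem_nhds hx)

/-- The element of `Sm M` given by a function on the exterior. -/
def Sm.mk (F : Pt → ℂ) (hs : ContDiffOn ℝ ∞ F (exterior M))
    (hp : ∀ x ∈ exterior M, F (turn x) = F x) : Sm M :=
  (⟨fun x => F x, hs.congr fun x hx => ext0_mem _ hx, fun x hx => by
    rw [ext0_mem _ hx, ext0_mem _ (turn_mem.2 hx)]; exact hp x hx⟩ : smoothFun M)

/-- `F` is represented by `a` on the exterior. -/
def Rep (F : Pt → ℂ) (a : Sm M) : Prop := ∀ x : exterior M, F x = ev x a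

lemma rep_mk (F : Pt → ℂ) (hs : ContDiffOn ℝ ∞ F (exterior M)) (hp) :
    Rep F (Sm.mk F hs hp) := fun _ => rfl

lemma rep_fn (a : Sm M) : Rep a.fn a := a.fn_eq

lemma Rep.eventuallyEq {F : Pt → ℂ} {a : Sm M} (h : Rep F a) {x : Pt} (hx : x ∈ exterior M) :
    F =ᶠ[nhds x] a.fn := by
  filter_upwards [(isOpen_exterior M).mem_nhds hx] with y hy
  rw [h ⟨y, hy⟩, ← a.fn_eq]

lemma pd_congr {F G : Pt → ℂ} {x : Pt} (h : F =ᶠ[nhds x] G) (a : Fin 4) : pd a F x = pd a G x := by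
  unfold pd; rw [h.fderiv_eq]

lemma pd_smooth (a : Sm M) (i : Fin 4) : ContDiffOn ℝ ∞ (pd i a.fn) (exterior M) := by
  have h := a.smooth.fderiv_of_isOpen (m := ∞) (isOpen_exterior M) (by simp)
  exact h.clm_apply contDiffOn_const

lemma pd_periodic (a : Sm M) (i : Fin 4) {x : Pt} (hx : x ∈ exterior M) :
    pd i a.fn (turn x) = pd i a.fn x := by
  have h : (fun y => a.fn (y + Pi.single 3 (2 * Real.pi))) =ᶠ[nhds x] a.fn := by
    filter_upwards [(isOpen_exterior M).mem_nhds hx] with y hy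
    exact a.periodic hy
  unfold pd turn
  rw [← h.fderiv_eq, fderiv_comp_add_right]

lemma pd_add {F G : Pt → ℂ} {x : Pt} (hF : DifferentiableAt ℝ F x) (hG : DifferentiableAt ℝ G x)
    (i : Fin 4) : pd i (fun y => F y + G y) x = pd i F x + pd i G x := by
  unfold pd; rw [fderiv_fun_add hF hG]; rfl

lemma pd_mul {F G : Pt → ℂ} {x : Pt} (hF : DifferentiableAt ℝ F x) (hG : DifferentiableAt ℝ G x)
    (i : Fin 4) : pd i (fun y => F y * G y) x = F x * pd i G x + G x * pd i F x := by
  unfold pd; rw [fderiv_fun_mul hF hG]; rfl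

/-- The underlying function of the coordinate derivative. -/
def dFun (i : Fin 4) (a : Sm M) : Sm M :=
  Sm.mk (pd i a.fn) (pd_smooth a i) fun _ hx => pd_periodic a i hx

lemma ev_dFun (i : Fin 4) (a : Sm M) (x : exterior M) : ev x (dFun i a) = pd i a.fn x := rfl

/-- Coordinate derivatives as derivations. -/
def D (i : Fin 4) : Derivation ℂ (Sm M) (Sm M) :=
  Derivation.mk'
    { toFun := dFun i
      map_add' := fun a b => Sm.ext_ev fun x => by
        have h : Rep (fun y => a.fn y + b.fn y) (a + b) := fun y => by
          simp [a.fn_eq, b.fn_eq]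
        rw [map_add, ev_dFun, ev_dFun, ev_dFun, ← pd_congr (h.eventuallyEq x.2),
          pd_add (a.differentiableAt x.2) (b.differentiableAt x.2)]
      map_smul' := fun c a => Sm.ext_ev fun x => by
        have h : Rep (fun y => c * a.fn y) (c • a) := fun y => by
          simp [a.fn_eq]
        rw [RingHom.id_apply, map_smul, ev_dFun, ev_dFun, ← pd_congr (h.eventuallyEq x.2)]
        rw [pd_mul (differentiableAt_const c) (a.differentiableAt x.2)]
        simp [pd] }
    fun a b => Sm.ext_ev fun x => by
        have h : Rep (fun y => a.fn y * b.fn y) (a * b) := fun y => by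
          simp [a.fn_eq, b.fn_eq]
        simp only [LinearMap.coe_mk, AddHom.coe_mk, map_add, smul_eq_mul, map_mul]
        rw [ev_dFun, ev_dFun, ev_dFun, ← pd_congr (h.eventuallyEq x.2),
          pd_mul (a.differentiableAt x.2) (b.differentiableAt x.2), a.fn_eq, b.fn_eq]

lemma ev_D (i : Fin 4) (a : Sm M) (x : exterior M) : ev x (D i a) = pd i a.fn x := rfl

lemma D_comm (i j : Fin 4) (a : Sm M) : D i (D j a) = D j (D i a) := by
  have key : ∀ (i j : Fin 4) (x : exterior M), ev x (D i (D j a)) =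
      fderiv ℝ (fderiv ℝ a.fn) x (Pi.single i 1) (Pi.single j 1) := by
    intro i j x
    have h : Rep (pd j a.fn) (D j a) := fun y => rfl
    rw [ev_D, ← pd_congr (h.eventuallyEq x.2)]
    unfold pd
    have hd : DifferentiableAt ℝ (fderiv ℝ a.fn) x :=
      ((a.smooth.fderiv_of_isOpen (m := ∞) (isOpen_exterior M) (by simp)).differentiableOn
        (by simp)).differentiableAt ((isOpen_exterior M).mem_nhds x.2)
    rw [fderiv_clm_apply hd (differentiableAt_const _)]
    simp
  refine Sm.ext_ev fun x => ?_
  rw [key, key]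
  have := (a.smooth.contDiffAt ((isOpen_exterior M).mem_nhds x.2)).isSymmSndFDerivAt
    (by simp only [minSmoothness_of_isRCLikeNormedField]; exact WithTop.coe_le_coe.2 (le_top : (2 : ℕ∞) ≤ ⊤))
  exact this _ _

/-! ### Closure of `Rep` under the operations that build coordinate expressions. -/

section Rep

variable {F G : Pt → ℂ} {a b : Sm M}

lemma Rep.pd (h : Rep F a) (i : Fin 4) : Rep (pd i F) (D i a) := fun x => by
  rw [pd_congr (h.eventuallyEq x.2), ev_D]

lemma Rep.add (h : Rep F a) (h' : Rep G b) : Rep (fun x => F x + G x) (a + b) := fun x => by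
  simp only [map_add, h x, h' x]

lemma Rep.sub (h : Rep F a) (h' : Rep G b) : Rep (fun x => F x - G x) (a - b) := fun x => by
  simp only [map_sub, h x, h' x]

lemma Rep.mul (h : Rep F a) (h' : Rep G b) : Rep (fun x => F x * G x) (a * b) := fun x => by
  simp only [map_mul, h x, h' x]

lemma Rep.neg (h : Rep F a) : Rep (fun x => -F x) (-a) := fun x => by
  simp only [map_neg, h x]

lemma Rep.smul (h : Rep F a) (c : ℂ) : Rep (fun x => c * F x) (c • a) := fun x => by
  simp only [map_smul, h x, smul_eq_mul]

lemma Rep.pow (h : Rep F a) (n : ℕ) : Rep (fun x => F x ^ n) (a ^ n) := fun x => by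
  simp only [map_pow, h x]

lemma Rep.sum {ι : Type*} {s : Finset ι} {F : ι → Pt → ℂ} {a : ι → Sm M}
    (h : ∀ i, Rep (F i) (a i)) : Rep (fun x => ∑ i ∈ s, F i x) (∑ i ∈ s, a i) := fun x => by
  rw [map_sum]; exact Finset.sum_congr rfl fun i _ => h i x

lemma Rep.of_eq (h : Rep F a) (e : a = b) : Rep F b := e ▸ h

end Rep

/-- Complex conjugation. -/
def conjFun (a : Sm M) : Sm M :=
  Sm.mk (fun x => starRingEnd ℂ (a.fn x))
    (Complex.conjCLE.contDiff.comp_contDiffOn a.smooth) fun x hx => by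
      rw [a.periodic hx]

lemma ev_conjFun (a : Sm M) (x : exterior M) : ev x (conjFun a) = starRingEnd ℂ (ev x a) := by
  rw [← a.fn_eq]; rfl

def cj : Sm M →+* Sm M where
  toFun := conjFun
  map_one' := Sm.ext_ev fun x => by simp [ev_conjFun]
  map_mul' a b := Sm.ext_ev fun x => by simp [ev_conjFun]
  map_zero' := Sm.ext_ev fun x => by simp [ev_conjFun]
  map_add' a b := Sm.ext_ev fun x => by simp [ev_conjFun]

@[simp] lemma ev_cj (a : Sm M) (x : exterior M) : ev x (cj a) = starRingEnd ℂ (ev x a) :=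
  ev_conjFun a x

@[simp] lemma cj_smul (c : ℂ) (a : Sm M) : cj (c • a) = starRingEnd ℂ c • cj a :=
  Sm.ext_ev fun x => by simp

@[simp] lemma cj_cj (a : Sm M) : cj (cj a) = a := Sm.ext_ev fun x => by simp

lemma Rep.conj {F : Pt → ℂ} {a : Sm M} (h : Rep F a) :
    Rep (fun x => starRingEnd ℂ (F x)) (cj a) := fun x => by simp only [ev_cj, h x]

@[simp] lemma D_cj (i : Fin 4) (a : Sm M) : D i (cj a) = cj (D i a) := by
  refine Sm.ext_ev fun x => ?_
  have h : Rep (fun y => starRingEnd ℂ (a.fn y)) (cj a) := (rep_fn a).conj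
  rw [ev_D, ← pd_congr (h.eventuallyEq x.2), ev_cj, ev_D]
  unfold SchwarzschildHertz.pd
  have hd := (a.differentiableAt x.2).hasFDerivAt
  have := (Complex.conjCLE.toContinuousLinearMap.hasFDerivAt.comp (x : Pt) hd).fderiv
  have h2 : (fun y => starRingEnd ℂ (a.fn y)) = Complex.conjCLE.toContinuousLinearMap ∘ a.fn := rfl
  rw [h2, this]; rfl

/-! ### Coordinate functions -/

lemma pd_coord {u : ℝ → ℝ} {u' : ℝ} {x : Pt} {j : Fin 4} (h : HasDerivAt u u' (x j)) (i : Fin 4) :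
    pd i (fun y => (u (y j) : ℂ)) x = if i = j then (u' : ℂ) else 0 := by
  have h1 : HasFDerivAt (fun y : Pt => y j) (ContinuousLinearMap.proj (R := ℝ) (φ := fun _ => ℝ) j)
      x := hasFDerivAt_apply j x
  have h2 := h.ofReal_comp.hasFDerivAt.comp x h1
  unfold pd
  have h3 : (fun y : Pt => (u (y j) : ℂ)) = (fun y => ((u y : ℝ) : ℂ)) ∘ fun y : Pt => y j := rfl
  rw [h3, h2.fderiv]
  by_cases hij : i = j
  · subst hij; simp
  · simp [hij, Ne.symm hij]

lemma coord_smooth {u : ℝ → ℝ} {j : Fin 4} (h : ∀ x ∈ exterior M, ContDiffAt ℝ ∞ u (x j)) :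
    ContDiffOn ℝ ∞ (fun y : Pt => (u (y j) : ℂ)) (exterior M) := fun x hx => by
  have h1 : ContDiffAt ℝ ∞ (fun y : Pt => y j) x := (contDiff_apply ℝ ℝ j).contDiffAt
  have h2 : ContDiffAt ℝ ∞ (fun y : Pt => u (y j)) x := ContDiffAt.comp x (h x hx) h1
  exact (Complex.ofRealCLM.contDiff.contDiffAt.comp x h2).contDiffWithinAt

/-- A function of one coordinate other than `φ`. -/
def coordFun (u : ℝ → ℝ) (j : Fin 4) (hj : j ≠ 3)
    (h : ∀ x ∈ exterior M, ContDiffAt ℝ ∞ u (x j)) : Sm M :=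
  Sm.mk (fun y => (u (y j) : ℂ)) (coord_smooth h) fun x _ => by
    simp [turn, hj]

lemma ev_coordFun (u : ℝ → ℝ) (j : Fin 4) (hj : j ≠ 3)
    (h : ∀ x ∈ exterior M, ContDiffAt ℝ ∞ u (x j)) (x : exterior M) :
    ev x (coordFun u j hj h) = u (x.1 j) := rfl

lemma ev_D_coordFun (u : ℝ → ℝ) (j : Fin 4) (hj : j ≠ 3)
    (h : ∀ x ∈ exterior M, ContDiffAt ℝ ∞ u (x j)) (i : Fin 4) (x : exterior M) {u' : ℝ}
    (hu : HasDerivAt u u' (x.1 j)) :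
    ev x (D i (coordFun u j hj h)) = if i = j then (u' : ℂ) else 0 := by
  have hr : Rep (fun y => (u (y j) : ℂ)) (coordFun u j hj h) := rep_mk _ _ _
  rw [ev_D, ← pd_congr (hr.eventuallyEq x.2), pd_coord hu]

lemma D_coordFun_of_ne (u : ℝ → ℝ) (j : Fin 4) (hj : j ≠ 3)
    (h : ∀ x ∈ exterior M, ContDiffAt ℝ ∞ u (x j)) (i : Fin 4) (hij : i ≠ j) :
    D i (coordFun u j hj h) = 0 := Sm.ext_ev fun x => by
  rw [ev_D_coordFun u j hj h i x ((h x x.2).differentiableAt (by simp)).hasDerivAt]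
  simp [hij]

variable [hM : Fact (0 < M)]

lemma r_pos {x : Pt} (hx : x ∈ exterior M) : 0 < x 1 := by
  have h1 := hM.out; have h2 := hx.1; linarith

lemma one_sub_pos {x : Pt} (hx : x ∈ exterior M) : 0 < 1 - 2 * M / x 1 := by
  have h1 := r_pos hx
  have h2 := hx.1
  rw [sub_pos, div_lt_one h1]; exact h2

lemma sin_pos {x : Pt} (hx : x ∈ exterior M) : 0 < Real.sin (x 2) :=
  Real.sin_pos_of_pos_of_lt_pi hx.2.1 hx.2.2

def rC : Sm M := coordFun (fun r => r) 1 (by decide) fun _ _ => contDiffAt_id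

def riC : Sm M := coordFun (fun r => r⁻¹) 1 (by decide) fun _ hx =>
  contDiffAt_inv ℝ (r_pos hx).ne'

lemma contDiffAt_N {x : Pt} (hx : x ∈ exterior M) :
    ContDiffAt ℝ ∞ (fun r : ℝ => Real.sqrt (1 - 2 * M / r)) (x 1) :=
  ContDiffAt.sqrt (contDiffAt_const.sub (contDiffAt_const.div contDiffAt_id (r_pos hx).ne'))
    (one_sub_pos hx).ne'

lemma sqrt_pos {x : Pt} (hx : x ∈ exterior M) : 0 < Real.sqrt (1 - 2 * M / x 1) :=
  Real.sqrt_pos.2 (one_sub_pos hx)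

/-- The lapse. -/
def nC : Sm M := coordFun (fun r => Real.sqrt (1 - 2 * M / r)) 1 (by decide)
  fun _ hx => contDiffAt_N hx

def niC : Sm M := coordFun (fun r => (Real.sqrt (1 - 2 * M / r))⁻¹) 1 (by decide)
  fun _ hx => (contDiffAt_N hx).inv (sqrt_pos hx).ne'

lemma contDiffAt_invSin {x : Pt} (hx : x ∈ exterior M) :
    ContDiffAt ℝ ∞ (fun t : ℝ => (Real.sin t)⁻¹) (x 2) :=
  Real.contDiff_sin.contDiffAt.inv (sin_pos hx).ne'

def snC : Sm M := coordFun Real.sin 2 (by decide) fun _ _ => Real.contDiff_sin.contDiffAt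

def siC : Sm M := coordFun (fun t => (Real.sin t)⁻¹) 2 (by decide) fun _ hx =>
  contDiffAt_invSin hx

def ctC : Sm M := coordFun (fun t => Real.cos t * (Real.sin t)⁻¹) 2 (by decide) fun _ hx =>
  Real.contDiff_cos.contDiffAt.mul (contDiffAt_invSin hx)

/-- The square root in the lapse, as a complex number. -/
def nv (x : exterior M) : ℂ := (Real.sqrt (1 - 2 * M / x.1 1) : ℝ)

def rv (x : exterior M) : ℂ := (x.1 1 : ℝ)
def sv (x : exterior M) : ℂ := (Real.sin (x.1 2) : ℝ)
def cv (x : exterior M) : ℂ := (Real.cos (x.1 2) : ℝ)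

@[simp] lemma conj_nv (x : exterior M) : starRingEnd ℂ (nv x) = nv x := Complex.conj_ofReal _
@[simp] lemma conj_rv (x : exterior M) : starRingEnd ℂ (rv x) = rv x := Complex.conj_ofReal _
@[simp] lemma conj_sv (x : exterior M) : starRingEnd ℂ (sv x) = sv x := Complex.conj_ofReal _
@[simp] lemma conj_cv (x : exterior M) : starRingEnd ℂ (cv x) = cv x := Complex.conj_ofReal _

@[simp] lemma ev_rC (x : exterior M) : ev x (rC : Sm M) = rv x := rfl
@[simp] lemma ev_riC (x : exterior M) : ev x (riC : Sm M) = (rv x)⁻¹ :=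
  (ev_coordFun _ _ _ _ _).trans (by simp [rv])
@[simp] lemma ev_nC (x : exterior M) : ev x (nC : Sm M) = nv x := rfl
@[simp] lemma ev_niC (x : exterior M) : ev x (niC : Sm M) = (nv x)⁻¹ :=
  (ev_coordFun _ _ _ _ _).trans (by simp [nv])
@[simp] lemma ev_snC (x : exterior M) : ev x (snC : Sm M) = sv x := rfl
@[simp] lemma ev_siC (x : exterior M) : ev x (siC : Sm M) = (sv x)⁻¹ :=
  (ev_coordFun _ _ _ _ _).trans (by simp [sv])
@[simp] lemma ev_ctC (x : exterior M) :
    ev x (ctC : Sm M) = cv x * (sv x)⁻¹ :=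
  (ev_coordFun _ _ _ _ _).trans (by simp [sv, cv])

lemma rv_ne (x : exterior M) : rv x ≠ 0 := by unfold rv; exact_mod_cast (r_pos x.2).ne'
lemma nv_ne (x : exterior M) : nv x ≠ 0 := by
  unfold nv; exact_mod_cast (sqrt_pos x.2).ne'
lemma sv_ne (x : exterior M) : sv x ≠ 0 := by
  unfold sv; exact_mod_cast (sin_pos x.2).ne'
lemma nv_sq (x : exterior M) : nv x ^ 2 = 1 - 2 * M / rv x := by
  unfold nv rv; rw [← Complex.ofReal_pow, Real.sq_sqrt (one_sub_pos x.2).le]; push_cast; rfl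
-- Eliminating the mass in favour of `r` and `N` leaves no relation between the remaining radial
-- quantities, so `ring` can decide the identities.
lemma M_eq (x : exterior M) : (M : ℂ) = rv x * (1 - nv x ^ 2) / 2 := by
  rw [nv_sq]; have := rv_ne x; field_simp; ring

lemma cv_sq (x : exterior M) : cv x ^ 2 = 1 - sv x ^ 2 := by
  unfold cv sv; rw [← Complex.ofReal_pow, Real.cos_sq']; push_cast; rfl

lemma rC_mul_riC : (rC * riC : Sm M) = 1 := Sm.ext_ev fun x => by
  simp [mul_inv_cancel₀ (rv_ne x)]
lemma nC_mul_niC : (nC * niC : Sm M) = 1 := Sm.ext_ev fun x => by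
  simp [mul_inv_cancel₀ (nv_ne x)]

@[simp] lemma D1_rC : D 1 (rC : Sm M) = 1 := Sm.ext_ev fun x => by
  rw [rC, ev_D_coordFun _ _ _ _ _ _ (hasDerivAt_id' _)]; simp
@[simp] lemma D1_riC : D 1 (riC : Sm M) = -riC ^ 2 := Sm.ext_ev fun x => by
  have h := hasDerivAt_inv (r_pos x.2).ne'
  rw [riC, ev_D_coordFun _ _ _ _ _ _ h, ← riC]; simp [rv]
lemma hasDerivAt_N (x : exterior M) : HasDerivAt (fun r : ℝ => Real.sqrt (1 - 2 * M / r))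
    ((1 - (Real.sqrt (1 - 2 * M / x.1 1)) ^ 2) / (2 * x.1 1 * Real.sqrt (1 - 2 * M / x.1 1)))
    (x.1 1) := by
  have hr := (r_pos x.2).ne'
  have h1 : HasDerivAt (fun r : ℝ => 1 - 2 * M / r) (2 * M / (x.1 1) ^ 2) (x.1 1) := by
    have := ((hasDerivAt_inv hr).const_mul (2 * M)).const_sub 1
    refine this.congr_deriv ?_
    field_simp
  refine (h1.sqrt (one_sub_pos x.2).ne').congr_deriv ?_
  rw [Real.sq_sqrt (one_sub_pos x.2).le]
  have := (sqrt_pos x.2).ne'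
  field_simp; ring
@[simp] lemma D1_nC : D 1 (nC : Sm M) = (1 / 2 : ℂ) • ((1 - nC ^ 2) * riC * niC) :=
  Sm.ext_ev fun x => by
    have h := hasDerivAt_N x
    rw [nC, ev_D_coordFun _ _ _ _ _ _ h, ← nC]
    have h1 := nv_ne x; have h2 := rv_ne x
    simp only [if_true, map_smul, map_mul, map_sub, map_one, map_pow, ev_nC, ev_riC, ev_niC]
    unfold nv at h1 ⊢
    unfold rv at h2 ⊢
    push_cast
    simp only [smul_eq_mul]
    field_simp
@[simp] lemma D1_niC : D 1 (niC : Sm M) = -(1 / 2 : ℂ) • ((1 - nC ^ 2) * riC * niC ^ 3) := by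
  have h := congrArg (D 1) (nC_mul_niC (M := M))
  simp only [Derivation.leibniz, D1_nC, Derivation.map_one_eq_zero, smul_eq_mul] at h
  have h2 := congrArg (niC * ·) h
  simp only [mul_add, mul_zero, ← mul_assoc, mul_comm niC nC, nC_mul_niC, one_mul] at h2
  rw [eq_neg_of_add_eq_zero_left h2, neg_smul]
  refine Sm.ext_ev fun x => ?_
  simp; ring
lemma hasDerivAt_invSin (x : exterior M) : HasDerivAt (fun t : ℝ => (Real.sin t)⁻¹)
    (-Real.cos (x.1 2) / Real.sin (x.1 2) ^ 2) (x.1 2) :=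
  (Real.hasDerivAt_sin _).inv (sin_pos x.2).ne'
@[simp] lemma D2_snC : D 2 (snC : Sm M) = ctC * snC := Sm.ext_ev fun x => by
  have := sv_ne x
  rw [snC, ev_D_coordFun _ _ _ _ _ _ (Real.hasDerivAt_sin _), ← snC]; simp [sv, cv] at this ⊢; field_simp
@[simp] lemma D2_siC : D 2 (siC : Sm M) = -ctC * siC := Sm.ext_ev fun x => by
  have := sv_ne x
  rw [siC, ev_D_coordFun _ _ _ _ _ _ (hasDerivAt_invSin x), ← siC]; simp [sv, cv] at this ⊢; field_simp
@[simp] lemma D2_ctC : D 2 (ctC : Sm M) = -1 - ctC ^ 2 := Sm.ext_ev fun x => by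
  have := sv_ne x
  rw [ctC, ev_D_coordFun _ _ _ _ _ _ ((Real.hasDerivAt_cos _).fun_mul (hasDerivAt_invSin x)), ← ctC]
  simp [sv, cv] at this ⊢; field_simp; ring

@[simp] lemma D0_rC : D 0 (rC : Sm M) = 0 := D_coordFun_of_ne _ _ _ _ _ (by decide)
@[simp] lemma D2_rC : D 2 (rC : Sm M) = 0 := D_coordFun_of_ne _ _ _ _ _ (by decide)
@[simp] lemma D3_rC : D 3 (rC : Sm M) = 0 := D_coordFun_of_ne _ _ _ _ _ (by decide)
@[simp] lemma D0_riC : D 0 (riC : Sm M) = 0 := D_coordFun_of_ne _ _ _ _ _ (by decide)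
@[simp] lemma D2_riC : D 2 (riC : Sm M) = 0 := D_coordFun_of_ne _ _ _ _ _ (by decide)
@[simp] lemma D3_riC : D 3 (riC : Sm M) = 0 := D_coordFun_of_ne _ _ _ _ _ (by decide)
@[simp] lemma D0_nC : D 0 (nC : Sm M) = 0 := D_coordFun_of_ne _ _ _ _ _ (by decide)
@[simp] lemma D2_nC : D 2 (nC : Sm M) = 0 := D_coordFun_of_ne _ _ _ _ _ (by decide)
@[simp] lemma D3_nC : D 3 (nC : Sm M) = 0 := D_coordFun_of_ne _ _ _ _ _ (by decide)
@[simp] lemma D0_niC : D 0 (niC : Sm M) = 0 := D_coordFun_of_ne _ _ _ _ _ (by decide)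
@[simp] lemma D2_niC : D 2 (niC : Sm M) = 0 := D_coordFun_of_ne _ _ _ _ _ (by decide)
@[simp] lemma D3_niC : D 3 (niC : Sm M) = 0 := D_coordFun_of_ne _ _ _ _ _ (by decide)
@[simp] lemma D0_snC : D 0 (snC : Sm M) = 0 := D_coordFun_of_ne _ _ _ _ _ (by decide)
@[simp] lemma D1_snC : D 1 (snC : Sm M) = 0 := D_coordFun_of_ne _ _ _ _ _ (by decide)
@[simp] lemma D3_snC : D 3 (snC : Sm M) = 0 := D_coordFun_of_ne _ _ _ _ _ (by decide)
@[simp] lemma D0_siC : D 0 (siC : Sm M) = 0 := D_coordFun_of_ne _ _ _ _ _ (by decide)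
@[simp] lemma D1_siC : D 1 (siC : Sm M) = 0 := D_coordFun_of_ne _ _ _ _ _ (by decide)
@[simp] lemma D3_siC : D 3 (siC : Sm M) = 0 := D_coordFun_of_ne _ _ _ _ _ (by decide)
@[simp] lemma D0_ctC : D 0 (ctC : Sm M) = 0 := D_coordFun_of_ne _ _ _ _ _ (by decide)
@[simp] lemma D1_ctC : D 1 (ctC : Sm M) = 0 := D_coordFun_of_ne _ _ _ _ _ (by decide)
@[simp] lemma D3_ctC : D 3 (ctC : Sm M) = 0 := D_coordFun_of_ne _ _ _ _ _ (by decide)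

/-! ### Covariant derivatives in a frame -/

section Frame

variable {A : Type*} [CommRing A] [Algebra ℂ A]

def Cov1 (d : Fin 4 → Derivation ℂ A A) (w : Fin 4 → Fin 4 → Fin 4 → A) (T : Fin 4 → A)
    (a b : Fin 4) : A := d a (T b) - ∑ e, w e a b * T e

def Cov2 (d : Fin 4 → Derivation ℂ A A) (w : Fin 4 → Fin 4 → Fin 4 → A)
    (T : Fin 4 → Fin 4 → A) (c a b : Fin 4) : A :=
  d c (T a b) - ∑ e, (w e c a * T e b + w e c b * T a e)

def Cov3 (d : Fin 4 → Derivation ℂ A A) (w : Fin 4 → Fin 4 → Fin 4 → A)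
    (T : Fin 4 → Fin 4 → Fin 4 → A) (f a b c : Fin 4) : A :=
  d f (T a b c) - ∑ e, (w e f a * T e b c + w e f b * T a e c + w e f c * T a b e)

variable (E : Fin 4 → Fin 4 → A)

/-- Frame components. -/
def Fr1 (T : Fin 4 → A) (i : Fin 4) : A := ∑ a, E i a * T a
def Fr2 (T : Fin 4 → Fin 4 → A) (i j : Fin 4) : A := ∑ a, E i a * Fr1 E (T a) j
def Fr3 (T : Fin 4 → Fin 4 → Fin 4 → A) (i j k : Fin 4) : A := ∑ a, E i a * Fr2 E (T a) j k
def Fr4 (T : Fin 4 → Fin 4 → Fin 4 → Fin 4 → A) (i j k l : Fin 4) : A :=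
  ∑ a, E i a * Fr3 E (T a) j k l

lemma sum_mul_swap (u v : Fin 4 → A) (x : Fin 4 → Fin 4 → A) :
    ∑ a, u a * ∑ b, v b * x a b = ∑ b, v b * ∑ a, u a * x a b := by
  simp only [Finset.mul_sum]
  rw [Finset.sum_comm]
  exact Finset.sum_congr rfl fun _ _ => Finset.sum_congr rfl fun _ _ => by ring

lemma sum_mul_assoc (u y : Fin 4 → A) (x : Fin 4 → Fin 4 → A) :
    ∑ e, (∑ f, u f * x e f) * y e = ∑ c, u c * ∑ e, x e c * y e := by
  simp only [Finset.sum_mul, mul_assoc]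
  rw [Finset.sum_comm]; simp only [Finset.mul_sum]

lemma Fr1_sum (u : Fin 4 → A) (T : Fin 4 → Fin 4 → A) (i : Fin 4) :
    Fr1 E (fun a => ∑ c, u c * T c a) i = ∑ c, u c * Fr1 E (T c) i :=
  (sum_mul_swap u (E i) T).symm

lemma Fr2_sum (u : Fin 4 → A) (T : Fin 4 → Fin 4 → Fin 4 → A) (i j : Fin 4) :
    Fr2 E (fun a b => ∑ c, u c * T c a b) i j = ∑ c, u c * Fr2 E (T c) i j := by
  unfold Fr2
  rw [sum_mul_swap]
  exact Finset.sum_congr rfl fun a _ => by rw [Fr1_sum]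

lemma Fr1_add (S T : Fin 4 → A) (i : Fin 4) :
    Fr1 E (fun a => S a + T a) i = Fr1 E S i + Fr1 E T i := by
  simp only [Fr1, mul_add, Finset.sum_add_distrib]
lemma Fr1_sub (S T : Fin 4 → A) (i : Fin 4) :
    Fr1 E (fun a => S a - T a) i = Fr1 E S i - Fr1 E T i := by
  simp only [Fr1, mul_sub, Finset.sum_sub_distrib]
lemma Fr1_neg (T : Fin 4 → A) (i : Fin 4) : Fr1 E (fun a => -T a) i = -Fr1 E T i := by
  simp only [Fr1, mul_neg, Finset.sum_neg_distrib]
lemma Fr1_mul (c : A) (T : Fin 4 → A) (i : Fin 4) : Fr1 E (fun a => c * T a) i = c * Fr1 E T i := by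
  simp only [Fr1, Finset.mul_sum]; exact Finset.sum_congr rfl fun _ _ => by ring
lemma Fr2_add (S T : Fin 4 → Fin 4 → A) (i j : Fin 4) :
    Fr2 E (fun a b => S a b + T a b) i j = Fr2 E S i j + Fr2 E T i j := by
  simp only [Fr2, Fr1_add, mul_add, Finset.sum_add_distrib]
lemma Fr2_sub (S T : Fin 4 → Fin 4 → A) (i j : Fin 4) :
    Fr2 E (fun a b => S a b - T a b) i j = Fr2 E S i j - Fr2 E T i j := by
  simp only [Fr2, Fr1_sub, mul_sub, Finset.sum_sub_distrib]
lemma Fr2_neg (T : Fin 4 → Fin 4 → A) (i j : Fin 4) :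
    Fr2 E (fun a b => -T a b) i j = -Fr2 E T i j := by
  simp only [Fr2, Fr1_neg, mul_neg, Finset.sum_neg_distrib]
lemma Fr2_mul (c : A) (T : Fin 4 → Fin 4 → A) (i j : Fin 4) :
    Fr2 E (fun a b => c * T a b) i j = c * Fr2 E T i j := by
  simp only [Fr2, Fr1_mul, Finset.mul_sum]; exact Finset.sum_congr rfl fun _ _ => by ring
lemma Fr3_add (S T : Fin 4 → Fin 4 → Fin 4 → A) (i j k : Fin 4) :
    Fr3 E (fun a b c => S a b c + T a b c) i j k = Fr3 E S i j k + Fr3 E T i j k := by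
  simp only [Fr3, Fr2_add, mul_add, Finset.sum_add_distrib]
lemma Fr3_sub (S T : Fin 4 → Fin 4 → Fin 4 → A) (i j k : Fin 4) :
    Fr3 E (fun a b c => S a b c - T a b c) i j k = Fr3 E S i j k - Fr3 E T i j k := by
  simp only [Fr3, Fr2_sub, mul_sub, Finset.sum_sub_distrib]
lemma Fr3_mul (c : A) (T : Fin 4 → Fin 4 → Fin 4 → A) (i j k : Fin 4) :
    Fr3 E (fun a b e => c * T a b e) i j k = c * Fr3 E T i j k := by
  simp only [Fr3, Fr2_mul, Finset.mul_sum]; exact Finset.sum_congr rfl fun _ _ => by ring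

lemma Fr2_symm {T : Fin 4 → Fin 4 → A} (h : ∀ a b, T a b = T b a) (i j : Fin 4) :
    Fr2 E T i j = Fr2 E T j i := by
  unfold Fr2 Fr1
  rw [sum_mul_swap]
  simp only [h]

/-- `w` are the connection coefficients of the frame `E`, with derivations `d'`, of a connection
with coefficients `G` in the frame with derivations `d`. -/
structure IsFrame (d d' : Fin 4 → Derivation ℂ A A) (G w : Fin 4 → Fin 4 → Fin 4 → A) : Prop where
  der : ∀ k x, d' k x = ∑ c, E k c * d c x
  conn : ∀ k i a, d' k (E i a) + ∑ b, E i b * ∑ c, E k c * G a c b = ∑ l, w l k i * E l a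

variable {E} {d d' : Fin 4 → Derivation ℂ A A} {G w : Fin 4 → Fin 4 → Fin 4 → A}

/-- Covariance for a single index: the Leibniz rule on `E_i^a u_a` produces a derivative of the
frame, which `conn` trades for connection coefficients. Tensors of higher rank follow by treating
one index at a time. -/
lemma IsFrame.slot (h : IsFrame E d d' G w) (u : Fin 4 → A) (k i : Fin 4) :
    d' k (Fr1 E u i) - ∑ l, w l k i * Fr1 E u l =
      Fr1 E (fun a => d' k (u a) - ∑ e, (∑ c, E k c * G e c a) * u e) i := by
  have h1 : ∑ l, w l k i * Fr1 E u l =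
      ∑ a, u a * (d' k (E i a) + ∑ b, E i b * ∑ c, E k c * G a c b) := by
    simp only [h.conn]
    unfold Fr1
    rw [show (∑ l, w l k i * ∑ a, E l a * u a) = ∑ l, w l k i * ∑ a, u a * E l a by
      simp only [mul_comm]]
    rw [sum_mul_swap]
  have h2 : d' k (Fr1 E u i) = ∑ a, E i a * d' k (u a) + ∑ a, u a * d' k (E i a) := by
    simp only [Fr1, map_sum, Derivation.leibniz, smul_eq_mul, Finset.sum_add_distrib]
  have h3 := sum_mul_swap u (E i) (fun a b => ∑ c, E k c * G a c b)
  rw [h1, h2, Fr1_sub]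
  simp only [mul_add, Finset.sum_add_distrib]
  rw [h3]
  have h4 : Fr1 E (fun a => ∑ e, (∑ c, E k c * G e c a) * u e) i =
      ∑ b, E i b * ∑ a, u a * ∑ c, E k c * G a c b := by
    simp only [Fr1, mul_comm]
  rw [h4]; unfold Fr1; ring

lemma IsFrame.cov1 (h : IsFrame E d d' G w) (T : Fin 4 → A) (k i : Fin 4) :
    Cov1 d' w (Fr1 E T) k i = Fr2 E (Cov1 d G T) k i := by
  unfold Cov1
  rw [h.slot]
  unfold Fr2
  rw [← Fr1_sum]
  congr 1; funext a
  rw [h.der]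
  simp only [mul_sub, Finset.sum_sub_distrib]
  simp only [sum_mul_assoc]

lemma IsFrame.slot2 (h : IsFrame E d d' G w) (T : Fin 4 → Fin 4 → A) (k i j : Fin 4) :
    d' k (Fr2 E T i j) - ∑ l, (w l k i * Fr2 E T l j + w l k j * Fr2 E T i l) =
      Fr2 E (fun a b => d' k (T a b) - ∑ e, ((∑ c, E k c * G e c a) * T e b
        + (∑ c, E k c * G e c b) * T a e)) i j := by
  have h1 := h.slot (fun a => Fr1 E (T a) j) k i
  have h2 : ∀ a, d' k (Fr1 E (T a) j) = Fr1 E (fun b => d' k (T a b) -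
      ∑ e, (∑ c, E k c * G e c b) * T a e) j + ∑ l, w l k j * Fr1 E (T a) l := fun a => by
    rw [← h.slot]; ring
  have h3 : Fr2 E T = fun i j => Fr1 E (fun a => Fr1 E (T a) j) i := rfl
  rw [Finset.sum_add_distrib, ← sub_sub, h3]
  simp only
  rw [h1]
  simp only [h2]
  have h4 : ∑ l, w l k j * Fr1 E (fun a => Fr1 E (T a) l) i =
    Fr1 E (fun a => ∑ l, w l k j * Fr1 E (T a) l) i := by rw [Fr1_sum]
  rw [h4, ← Fr1_sub]
  unfold Fr2
  change _ = Fr1 E _ i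
  congr 1; funext a
  rw [← Fr1_sum]
  rw [show ∀ x y z : A, x + y - z - y = x - z by intros; ring, ← Fr1_sub]
  congr 1; funext b
  beta_reduce
  rw [Finset.sum_add_distrib]; ring

lemma IsFrame.slot3 (h : IsFrame E d d' G w) (T : Fin 4 → Fin 4 → Fin 4 → A) (k i j m : Fin 4) :
    d' k (Fr3 E T i j m) - ∑ l, (w l k i * Fr3 E T l j m + w l k j * Fr3 E T i l m
        + w l k m * Fr3 E T i j l) =
      Fr3 E (fun a b c => d' k (T a b c) - ∑ e, ((∑ f, E k f * G e f a) * T e b c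
        + (∑ f, E k f * G e f b) * T a e c + (∑ f, E k f * G e f c) * T a b e)) i j m := by
  have h1 := h.slot (fun a => Fr2 E (T a) j m) k i
  have h2 : ∀ a, d' k (Fr2 E (T a) j m) = Fr2 E (fun b c => d' k (T a b c) -
      ∑ e, ((∑ f, E k f * G e f b) * T a e c + (∑ f, E k f * G e f c) * T a b e)) j m
      + ∑ l, (w l k j * Fr2 E (T a) l m + w l k m * Fr2 E (T a) j l) := fun a => by
    rw [← h.slot2]; ring
  have h3 : Fr3 E T = fun i j m => Fr1 E (fun a => Fr2 E (T a) j m) i := rfl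
  have h5 : ∀ x y z : Fin 4 → A, ∑ l, (x l + y l + z l) = ∑ l, x l + ∑ l, (y l + z l) := by
    intro x y z; simp only [Finset.sum_add_distrib, add_assoc]
  rw [h5, ← sub_sub, h3]
  simp only
  rw [h1]
  simp only [h2]
  have h4 : ∑ l, (w l k j * Fr1 E (fun a => Fr2 E (T a) l m) i
      + w l k m * Fr1 E (fun a => Fr2 E (T a) j l) i) =
    Fr1 E (fun a => ∑ l, (w l k j * Fr2 E (T a) l m + w l k m * Fr2 E (T a) j l)) i := by
    simp only [Finset.sum_add_distrib, Fr1_add, Fr1_sum]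
  rw [h4, ← Fr1_sub]
  change _ = Fr1 E _ i
  congr 1; funext a
  rw [← Fr2_sum]
  rw [show ∀ x y z : A, x + y - z - y = x - z by intros; ring, ← Fr2_sub]
  congr 1; funext b c
  beta_reduce
  rw [h5]; ring

lemma IsFrame.cov2 (h : IsFrame E d d' G w) (T : Fin 4 → Fin 4 → A) (k i j : Fin 4) :
    Cov2 d' w (Fr2 E T) k i j = Fr3 E (Cov2 d G T) k i j := by
  unfold Cov2
  rw [h.slot2]
  unfold Fr3
  rw [← Fr2_sum]
  congr 1; funext a b
  rw [h.der]
  simp only [mul_sub, Finset.sum_sub_distrib, Finset.sum_add_distrib, mul_add]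
  simp only [sum_mul_assoc]

lemma IsFrame.cov3 (h : IsFrame E d d' G w) (T : Fin 4 → Fin 4 → Fin 4 → A) (k i j m : Fin 4) :
    Cov3 d' w (Fr3 E T) k i j m = Fr4 E (Cov3 d G T) k i j m := by
  unfold Cov3
  rw [h.slot3]
  unfold Fr4
  have Fr3_sum : ∀ (u : Fin 4 → A) (S : Fin 4 → Fin 4 → Fin 4 → Fin 4 → A),
      Fr3 E (fun a b e => ∑ c, u c * S c a b e) i j m = ∑ c, u c * Fr3 E (S c) i j m := by
    intro u S
    unfold Fr3
    rw [sum_mul_swap]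
    exact Finset.sum_congr rfl fun a _ => by rw [Fr2_sum]
  rw [← Fr3_sum]
  congr 1; funext a b c
  rw [h.der]
  simp only [mul_sub, Finset.sum_sub_distrib, Finset.sum_add_distrib, mul_add]
  simp only [sum_mul_assoc]

/-- Contraction of two slots. -/
lemma contract_frame {H gi : Fin 4 → Fin 4 → A}
    (hg : ∀ a b, gi a b = ∑ k, ∑ l, H k l * (E k a * E l b)) (T : Fin 4 → Fin 4 → A) :
    ∑ k, ∑ l, H k l * Fr2 E T k l = ∑ a, ∑ b, gi a b * T a b := by
  simp only [hg, Fr2, Fr1, Finset.mul_sum, Finset.sum_mul]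
  rw [Finset.sum_congr rfl fun k _ => Finset.sum_comm]
  rw [Finset.sum_comm]
  refine Finset.sum_congr rfl fun a _ => ?_
  rw [Finset.sum_congr rfl fun k _ => Finset.sum_comm]
  rw [Finset.sum_comm]
  refine Finset.sum_congr rfl fun b _ => Finset.sum_congr rfl fun k _ =>
    Finset.sum_congr rfl fun l _ => by ring

/-- The linearised Einstein operator without the term proportional to the metric. -/
def LinRic (d : Fin 4 → Derivation ℂ A A) (w : Fin 4 → Fin 4 → Fin 4 → A) (gi T : Fin 4 → Fin 4 → A)
    (a b : Fin 4) : A :=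
  -(∑ c, ∑ e, gi c e * Cov3 d w (Cov2 d w T) c e a b)
  - Cov1 d w (fun f => d f (∑ c, ∑ e, gi c e * T c e)) a b
  + ∑ c, ∑ e, gi c e * (Cov3 d w (Cov2 d w T) e a b c + Cov3 d w (Cov2 d w T) e b a c)

lemma Fr2_contract {X : Fin 4 → Fin 4 → Fin 4 → Fin 4 → A} {gi : Fin 4 → Fin 4 → A} (i j : Fin 4) :
    Fr2 E (fun a b => ∑ c, ∑ e, gi c e * X c e a b) i j =
      ∑ c, ∑ e, gi c e * Fr2 E (X c e) i j := by
  have h : ∀ S : Fin 4 → Fin 4 → Fin 4 → A,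
      Fr2 E (fun a b => ∑ c, S c a b) i j = ∑ c, Fr2 E (S c) i j := fun S => by
    have := Fr2_sum E (fun _ => 1) S i j
    simpa using this
  rw [h]
  refine Finset.sum_congr rfl fun c _ => ?_
  rw [h]
  exact Finset.sum_congr rfl fun e _ => Fr2_mul E _ _ i j

/-- The operator is built only from covariant derivatives and contractions, so its frame components
are given by the same formula with frame derivations, frame coefficients and the frame metric. This
permits computing in the null frame, where the coefficients are simple. -/
lemma IsFrame.linRic (h : IsFrame E d d' G w) {H gi : Fin 4 → Fin 4 → A}
    (hg : ∀ a b, gi a b = ∑ k, ∑ l, H k l * (E k a * E l b)) (T : Fin 4 → Fin 4 → A)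
    (i j : Fin 4) :
    LinRic d' w H (Fr2 E T) i j = Fr2 E (LinRic d G gi T) i j := by
  have hc2 : Cov2 d' w (Fr2 E T) = Fr3 E (Cov2 d G T) := by funext k i j; exact h.cov2 T k i j
  have hc3 : Cov3 d' w (Cov2 d' w (Fr2 E T)) = Fr4 E (Cov3 d G (Cov2 d G T)) := by
    rw [hc2]; funext k i j m; exact h.cov3 _ k i j m
  have ht : (fun f => d' f (∑ c, ∑ e, H c e * Fr2 E T c e)) =
      Fr1 E (fun f => d f (∑ c, ∑ e, gi c e * T c e)) := by
    rw [contract_frame hg]; funext f; exact h.der f _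
  unfold LinRic
  rw [hc3, ht, h.cov1]
  generalize Cov3 d G (Cov2 d G T) = X
  rw [Fr2_add, Fr2_sub, Fr2_neg]
  have e1 : ∑ c, ∑ e, H c e * Fr4 E X c e i j =
      Fr2 E (fun a b => ∑ c, ∑ e, gi c e * X c e a b) i j := by
    rw [Fr2_contract, ← contract_frame hg]
    refine Finset.sum_congr rfl fun k _ => Finset.sum_congr rfl fun l _ => ?_
    rfl
  have e2 : ∀ i j, ∑ c, ∑ e, H c e * Fr4 E X e i j c =
      Fr2 E (fun a b => ∑ c, ∑ e, gi c e * X e a b c) i j := by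
    intro i j
    rw [Fr2_contract (X := fun c e a b => X e a b c), ← contract_frame hg]
    refine Finset.sum_congr rfl fun k _ => Finset.sum_congr rfl fun l _ => ?_
    congr 1
    unfold Fr4 Fr3 Fr2 Fr1
    rw [sum_mul_swap (E k) (E l)]
    refine Finset.sum_congr rfl fun a _ => ?_
    congr 1
    rw [sum_mul_swap (E k) (E i)]
    refine Finset.sum_congr rfl fun b _ => ?_
    congr 1
    rw [sum_mul_swap (E k) (E j)]
  have e3 := e2 j i
  have e4 : Fr2 E (fun a b => ∑ c, ∑ e, gi c e * X e a b c) j i =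
      Fr2 E (fun a b => ∑ c, ∑ e, gi c e * X e b a c) i j := by
    unfold Fr2 Fr1; rw [sum_mul_swap]
  simp only [mul_add, Finset.sum_add_distrib]
  rw [Fr2_add, e1, e2 i j, e3, e4]

end Frame

/-! ### The Schwarzschild connection in coordinates and in a null frame -/

/-- The Christoffel symbols. -/
def chrC : Fin 4 → Fin 4 → Fin 4 → Sm M :=
  ![![![0, (1 / 2 : ℂ) • ((1 - nC ^ 2) * riC * niC ^ 2), 0, 0], ![(1 / 2 : ℂ) • ((1 - nC ^ 2) * riC * niC ^ 2), 0, 0, 0], ![0, 0, 0, 0], ![0, 0, 0, 0]],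
    ![![(1 / 2 : ℂ) • ((1 - nC ^ 2) * riC * nC ^ 2), 0, 0, 0], ![0, -((1 / 2 : ℂ) • ((1 - nC ^ 2) * riC * niC ^ 2)), 0, 0], ![0, 0, -(rC * nC ^ 2), 0], ![0, 0, 0, -(rC * nC ^ 2 * snC ^ 2)]],
    ![![0, 0, 0, 0], ![0, 0, riC, 0], ![0, riC, 0, 0], ![0, 0, 0, -(snC ^ 2 * ctC)]],
    ![![0, 0, 0, 0], ![0, 0, 0, riC], ![0, 0, 0, ctC], ![0, riC, ctC, 0]]]

/-- The connection coefficients of the frame `∂_t + N² ∂_r`, `∂_t - N² ∂_r`,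
`∂_θ ± (i / sin θ) ∂_φ`. -/
def frC : Fin 4 → Fin 4 → Fin 4 → Sm M :=
  ![![![(1 - nC ^ 2) * riC, 0, 0, 0], ![0, 0, 0, 0], ![0, 0, 0, -rC], ![0, 0, -rC, 0]],
    ![![0, 0, 0, 0], ![0, -((1 - nC ^ 2) * riC), 0, 0], ![0, 0, 0, rC], ![0, 0, rC, 0]],
    ![![0, 0, nC ^ 2 * riC, 0], ![0, 0, -(nC ^ 2 * riC), 0], ![nC ^ 2 * riC, -(nC ^ 2 * riC), ctC, 0], ![0, 0, -ctC, 0]],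
    ![![0, 0, 0, nC ^ 2 * riC], ![0, 0, 0, -(nC ^ 2 * riC)], ![0, 0, 0, -ctC], ![nC ^ 2 * riC, -(nC ^ 2 * riC), 0, ctC]]]

def gC (a b : Fin 4) : Sm M :=
  if a = b then (![nC ^ 2, -niC ^ 2, -rC ^ 2, -(rC ^ 2 * snC ^ 2)] : Fin 4 → Sm M) a else 0

def giC (a b : Fin 4) : Sm M :=
  if a = b then (![niC ^ 2, -nC ^ 2, -riC ^ 2, -(riC ^ 2 * siC ^ 2)] : Fin 4 → Sm M) a else 0

/-- The rows are `√2 N l`, `√2 N n`, `√2 r m`, `√2 r m̄`. This rescaling of the Carter frame removes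
`√2` and makes the four directional derivatives commute, apart from the pair of angular ones. -/
def EC : Fin 4 → Fin 4 → Sm M :=
  ![![1, nC ^ 2, 0, 0], ![1, -nC ^ 2, 0, 0], ![0, 0, 1, Complex.I • siC],
    ![0, 0, 1, -(Complex.I • siC)]]

def dL : Derivation ℂ (Sm M) (Sm M) := D 0 + (nC ^ 2 : Sm M) • D 1
def dK : Derivation ℂ (Sm M) (Sm M) := D 0 - (nC ^ 2 : Sm M) • D 1
def dm : Derivation ℂ (Sm M) (Sm M) := D 2 + (Complex.I • siC : Sm M) • D 3
def dmb : Derivation ℂ (Sm M) (Sm M) := D 2 - (Complex.I • siC : Sm M) • D 3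

def dF : Fin 4 → Derivation ℂ (Sm M) (Sm M) := ![dL, dK, dm, dmb]

def HC : Fin 4 → Fin 4 → Sm M :=
  ![![0, (1 / 2 : ℂ) • niC ^ 2, 0, 0], ![(1 / 2 : ℂ) • niC ^ 2, 0, 0, 0],
    ![0, 0, 0, -((1 / 2 : ℂ) • riC ^ 2)], ![0, 0, -((1 / 2 : ℂ) • riC ^ 2), 0]]

lemma giC_eq (a b : Fin 4) :
    (giC a b : Sm M) = ∑ k, ∑ l, HC k l * (EC k a * EC l b) := by
  refine Sm.ext_ev fun x => ?_
  have h1 := nv_ne x; have h2 := rv_ne x; have h3 := sv_ne x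
  fin_cases a <;> fin_cases b <;>
  simp [giC, HC, EC, Fin.sum_univ_four] <;> field_simp <;> ring_nf <;> simp

set_option maxHeartbeats 1000000 in
lemma isFrame : IsFrame (A := Sm M) EC D dF chrC frC where
  der k x := by
    fin_cases k <;> simp [dF, EC, Fin.sum_univ_four, dL, dK, dm, dmb] <;> ring
  conn k i a := by
    refine Sm.ext_ev fun x => ?_
    have h1 := nv_ne x; have h2 := rv_ne x; have h3 := sv_ne x
    fin_cases k <;> fin_cases i <;> fin_cases a <;>
    simp [dF, EC, Fin.sum_univ_four, dL, dK, dm, dmb, chrC, frC] <;> (try field_simp) <;> ring_nf <;>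
    (try simp)

/-! ### The coordinate expressions as elements of the ring -/

lemma sqrtDel_eq (x : exterior M) : (sqrtDel M x : ℂ) = rv x * nv x := by
  have h := r_pos x.2
  have : Del M x = (x.1 1) ^ 2 * (1 - 2 * M / x.1 1) := by
    unfold Del; field_simp
  unfold sqrtDel rv nv
  rw [this, Real.sqrt_mul (by positivity), Real.sqrt_sq h.le]
  push_cast; rfl

lemma Del_eq (x : exterior M) : (Del M x : ℂ) = rv x ^ 2 * nv x ^ 2 := by
  have h := rv_ne x
  rw [nv_sq]; unfold Del; push_cast; change rv x * (rv x - 2 * M) = _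
  field_simp

lemma lapse_eq (x : exterior M) : (lapse M x : ℂ) = nv x := by
  have h := rv_ne x
  unfold lapse; push_cast; rw [sqrtDel_eq]; change rv x * nv x / rv x = _
  field_simp

lemma gDiag_eq (x : exterior M) (a : Fin 4) : (gDiag M x a : ℂ) =
    (![nv x ^ 2, -(nv x ^ 2)⁻¹, -rv x ^ 2, -(rv x ^ 2 * sv x ^ 2)] : Fin 4 → ℂ) a := by
  have h1 := nv_ne x; have h2 := rv_ne x
  fin_cases a
  · simp only [gDiag, Fin.zero_eta, Matrix.cons_val_zero]; push_cast
    rw [Del_eq]; change _ / rv x ^ 2 = _; field_simp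
  · simp only [gDiag, Fin.mk_one, Matrix.cons_val_one, Matrix.cons_val_zero]; push_cast
    rw [Del_eq]; change -(rv x ^ 2 / _) = _; field_simp
  · simp [gDiag, rv]
  · simp [gDiag, rv, sv]

lemma rep_g (a b : Fin 4) : Rep (g M a b) (gC a b : Sm M) := fun x => by
  unfold g gC
  split_ifs with h
  · rw [gDiag_eq]; fin_cases a <;> simp
  · simp

lemma rep_gInv (a b : Fin 4) : Rep (gInv M a b) (giC a b : Sm M) := fun x => by
  unfold gInv giC
  split_ifs with h
  · rw [gDiag_eq]; fin_cases a <;> simp [inv_neg, mul_comm]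
  · simp

lemma rep_chr_aux (c a b : Fin 4) : Rep (chr M c a b) ((1 / 2 : ℂ) • ∑ d, giC c d *
    (D a (gC b d) + D b (gC a d) - D d (gC a b)) : Sm M) :=
  (Rep.sum fun d => (rep_gInv c d).mul
    ((((rep_g b d).pd a).add ((rep_g a d).pd b)).sub ((rep_g a b).pd d))).smul _

set_option maxHeartbeats 1000000 in
lemma rep_chr (c a b : Fin 4) : Rep (chr M c a b) (chrC c a b : Sm M) := by
  refine (rep_chr_aux c a b).of_eq (Sm.ext_ev fun x => ?_)
  have h1 := nv_ne x; have h2 := rv_ne x; have h3 := sv_ne x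
  fin_cases c <;> fin_cases a <;> fin_cases b <;>
  simp [giC, gC, chrC] <;> (try field_simp)

/-! ### Covariant derivatives, linearised field equations and linearised curvature in the ring. -/

section Tensors

variable {w : Fin 4 → Pt → ℂ} {w' : Fin 4 → Sm M}
  {T : Fin 4 → Fin 4 → Pt → ℂ} {T' : Fin 4 → Fin 4 → Sm M}
  {S : Fin 4 → Fin 4 → Fin 4 → Pt → ℂ} {S' : Fin 4 → Fin 4 → Fin 4 → Sm M}

lemma rep_cov1 (h : ∀ a, Rep (w a) (w' a)) (a b : Fin 4) :
    Rep (cov1 M w a b) (Cov1 D chrC w' a b) :=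
  ((h b).pd a).sub (Rep.sum fun d => (rep_chr d a b).mul (h d))

lemma rep_cov2 (h : ∀ a b, Rep (T a b) (T' a b)) (c a b : Fin 4) :
    Rep (cov2 M T c a b) (Cov2 D chrC T' c a b) :=
  ((h a b).pd c).sub (Rep.sum fun d => ((rep_chr d c a).mul (h d b)).add
    ((rep_chr d c b).mul (h a d)))

lemma rep_cov3 (h : ∀ a b c, Rep (S a b c) (S' a b c)) (e a b c : Fin 4) :
    Rep (cov3 M S e a b c) (Cov3 D chrC S' e a b c) :=
  ((h a b c).pd e).sub (Rep.sum fun d => (((rep_chr d e a).mul (h d b c)).add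
    ((rep_chr d e b).mul (h a d c))).add ((rep_chr d e c).mul (h a b d)))

lemma rep_tr (h : ∀ a b, Rep (T a b) (T' a b)) :
    Rep (tr M T) (∑ a, ∑ b, giC a b * T' a b) :=
  Rep.sum fun a => Rep.sum fun b => (rep_gInv a b).mul (h a b)

/-- The multiple of the metric may stay unspecified: only components along `nn`, `n m̄` and `m̄ m̄`
are used, on which `g_ab` vanishes. -/
lemma rep_linEinstein (h : ∀ a b, Rep (T a b) (T' a b)) :
    ∃ X : Sm M, ∀ a b, Rep (linEinstein M T a b) (LinRic D chrC giC T' a b + gC a b * X) := by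
  have ht : ∀ e, Rep (pd e (tr M T)) (D e (∑ c, ∑ f, giC c f * T' c f)) := fun e =>
    (rep_tr h).pd e
  have h3 := rep_cov3 (rep_cov2 h)
  refine ⟨(∑ c, ∑ d, giC c d * Cov1 D chrC (fun e => D e (∑ c, ∑ f, giC c f * T' c f)) c d)
    - ∑ c, ∑ d, ∑ e, ∑ f, giC c e * giC d f * Cov3 D chrC (Cov2 D chrC T') e f c d,
    fun a b => ?_⟩
  refine Rep.add (Rep.add (Rep.sub (Rep.neg ?_) ?_) ?_) (Rep.mul (rep_g a b) (Rep.sub ?_ ?_))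
  · exact Rep.sum fun c => Rep.sum fun d => (rep_gInv c d).mul (h3 c d a b)
  · exact rep_cov1 ht a b
  · exact Rep.sum fun c => Rep.sum fun d => (rep_gInv c d).mul ((h3 d a b c).add (h3 d b a c))
  · exact Rep.sum fun c => Rep.sum fun d => (rep_gInv c d).mul (rep_cov1 ht c d)
  · exact Rep.sum fun c => Rep.sum fun d => Rep.sum fun e => Rep.sum fun f =>
      ((rep_gInv c e).mul (rep_gInv d f)).mul (h3 e f c d)

/-- The perturbed connection coefficients. -/
def LinChr (d : Fin 4 → Derivation ℂ (Sm M) (Sm M)) (w : Fin 4 → Fin 4 → Fin 4 → Sm M)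
    (T : Fin 4 → Fin 4 → Sm M) (e b c : Fin 4) : Sm M :=
  (1 / 2 : ℂ) • (Cov2 d w T b e c + Cov2 d w T c b e - Cov2 d w T e b c)

def riemC (a b c d : Fin 4) : Sm M :=
  D b (chrC d a c) - D a (chrC d b c) +
    ∑ e, (chrC e a c * chrC d e b - chrC e b c * chrC d e a)

def LinRiem (T : Fin 4 → Fin 4 → Sm M) (a b c d : Fin 4) : Sm M :=
  Cov3 D chrC (LinChr D chrC T) b d a c - Cov3 D chrC (LinChr D chrC T) a d b c
    + ∑ e, riemC a b c e * T e d

lemma rep_linChr (h : ∀ a b, Rep (T a b) (T' a b)) (d b c : Fin 4) :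
    Rep (linChr M T d b c) (LinChr D chrC T' d b c) :=
  (((rep_cov2 h b d c).add (rep_cov2 h c b d)).sub (rep_cov2 h d b c)).smul _

lemma rep_riem (a b c d : Fin 4) : Rep (riem M a b c d) (riemC a b c d : Sm M) :=
  (((rep_chr d a c).pd b).sub ((rep_chr d b c).pd a)).add (Rep.sum fun e =>
    ((rep_chr e a c).mul (rep_chr d e b)).sub ((rep_chr e b c).mul (rep_chr d e a)))

lemma rep_linRiem (h : ∀ a b, Rep (T a b) (T' a b)) (a b c d : Fin 4) :
    Rep (linRiem M T a b c d) (LinRiem T' a b c d) :=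
  ((rep_cov3 (rep_linChr h) b d a c).sub (rep_cov3 (rep_linChr h) a d b c)).add
    (Rep.sum fun e => (rep_riem a b c e).mul (h e d))

lemma x1_eq (x : exterior M) : ((x : Pt) 1 : ℂ) = rv x := rfl

lemma lUp_eq (x : exterior M) (a : Fin 4) : lUp M x a =
    ((Real.sqrt 2 : ℂ) * nv x)⁻¹ * (![1, nv x ^ 2, 0, 0] : Fin 4 → ℂ) a := by
  have h1 := nv_ne x; have h2 := rv_ne x
  have h3 : (Real.sqrt 2 : ℂ) ≠ 0 := by simp
  fin_cases a <;> simp [lUp, sqrtDel_eq, x1_eq] <;> field_simp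

lemma nUp_eq (x : exterior M) (a : Fin 4) : nUp M x a =
    ((Real.sqrt 2 : ℂ) * nv x)⁻¹ * (![1, -nv x ^ 2, 0, 0] : Fin 4 → ℂ) a := by
  have h1 := nv_ne x; have h2 := rv_ne x
  have h3 : (Real.sqrt 2 : ℂ) ≠ 0 := by simp
  fin_cases a <;> simp [nUp, sqrtDel_eq, x1_eq] <;> field_simp

lemma mUp_eq (x : exterior M) (a : Fin 4) : mUp x a =
    ((Real.sqrt 2 : ℂ) * rv x)⁻¹ * (![0, 0, 1, Complex.I * (sv x)⁻¹] : Fin 4 → ℂ) a := by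
  have h1 := sv_ne x; have h2 := rv_ne x
  have h3 : (Real.sqrt 2 : ℂ) ≠ 0 := by simp
  fin_cases a <;> simp [mUp, rv, sv] <;> ring

lemma mbUp_eq (x : exterior M) (a : Fin 4) : mbUp x a =
    ((Real.sqrt 2 : ℂ) * rv x)⁻¹ * (![0, 0, 1, -(Complex.I * (sv x)⁻¹)] : Fin 4 → ℂ) a := by
  unfold mbUp; rw [mUp_eq]
  fin_cases a <;> simp

lemma sum_fr4 (x : exterior M) (X : Fin 4 → Fin 4 → Fin 4 → Fin 4 → Sm M) :
    ∑ a, ∑ b, ∑ c, ∑ d, ev x (X a b c d) * nUp M x a * mbUp x b * nUp M x c * mbUp x d =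
      ev x ((1 / 4 : ℂ) • (niC ^ 2 * riC ^ 2 * Fr4 EC X 1 3 1 3)) := by
  have h1 := nv_ne x; have h2 := rv_ne x
  have h3 : (Real.sqrt 2 : ℂ) ^ 2 = 2 := by
    rw [← Complex.ofReal_pow, Real.sq_sqrt (by norm_num)]; norm_num
  have h4 : (Real.sqrt 2 : ℂ) ≠ 0 := by simp
  have e1 : ∀ a, nUp M x a = ((Real.sqrt 2 : ℂ) * nv x)⁻¹ * ev x (EC 1 a) := fun a => by
    rw [nUp_eq]; fin_cases a <;> simp [EC]
  have e2 : ∀ a, mbUp x a = ((Real.sqrt 2 : ℂ) * rv x)⁻¹ * ev x (EC 3 a) := fun a => by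
    rw [mbUp_eq]; fin_cases a <;> simp [EC]
  have e3 : ((Real.sqrt 2 : ℂ) * nv x)⁻¹ ^ 2 * ((Real.sqrt 2 : ℂ) * rv x)⁻¹ ^ 2 =
      1 / 4 * ((nv x)⁻¹ ^ 2 * (rv x)⁻¹ ^ 2) := by
    simp only [mul_inv, mul_pow, inv_pow, h3]; ring
  simp only [map_smul, map_mul, map_pow, ev_niC, ev_riC, smul_eq_mul, ← mul_assoc]
  rw [mul_assoc (1 / 4 : ℂ), ← e3]
  simp only [Fr4, Fr3, Fr2, Fr1, map_sum, map_mul, Finset.mul_sum, e1, e2]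
  refine Finset.sum_congr rfl fun a _ => Finset.sum_congr rfl fun b _ =>
    Finset.sum_congr rfl fun c _ => Finset.sum_congr rfl fun d _ => by ring

lemma rep_psi4 (h : ∀ a b, Rep (T a b) (T' a b)) :
    Rep (psi4 M T) (-((1 / 4 : ℂ) • (niC ^ 2 * riC ^ 2 * Fr4 EC (LinRiem T') 1 3 1 3))) := fun x => by
  rw [map_neg, ← sum_fr4]
  unfold psi4
  simp only [rep_linRiem h _ _ _ _ x]

-- The index `b` is effectively angular here. By spherical symmetry the curvature with `a`, `c` in
-- the `(t, r)` plane is then proportional to `g_ac`, and `n` is null. This removes the term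
-- `R_abc^e γ_ed` from the perturbed Weyl scalar.
set_option maxHeartbeats 1000000 in
lemma riemC_contract (e b : Fin 4) : ∑ a, EC 1 a * ∑ c, EC 1 c * (EC 3 b * riemC a b c e) =
    (0 : Sm M) := by
  refine Sm.ext_ev fun x => ?_
  have h1 := nv_ne x; have h2 := rv_ne x; have h3 := sv_ne x
  fin_cases e <;> fin_cases b <;>
  simp [riemC, EC, Fin.sum_univ_four, chrC] <;> (try field_simp) <;> (try ring_nf)

end Tensors

@[simp] lemma der_two (d : Derivation ℂ (Sm M) (Sm M)) : d 2 = 0 := d.map_natCast 2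
@[simp] lemma der_three (d : Derivation ℂ (Sm M) (Sm M)) : d 3 = 0 := d.map_natCast 3
@[simp] lemma der_four (d : Derivation ℂ (Sm M) (Sm M)) : d 4 = 0 := d.map_natCast 4

/-! ### The operators `ð`, `ð'` and the null derivatives -/

@[simp] lemma dL_rC : dL (rC : Sm M) = nC ^ 2 := by simp [dL]
@[simp] lemma dL_riC : dL (riC : Sm M) = -(nC ^ 2 * riC ^ 2) := by simp [dL]
@[simp] lemma dL_nC : dL (nC : Sm M) = (1 / 2 : ℂ) • ((1 - nC ^ 2) * riC * nC) :=
  Sm.ext_ev fun x => by have := nv_ne x; simp [dL]; field_simp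
@[simp] lemma dL_niC : dL (niC : Sm M) = -((1 / 2 : ℂ) • ((1 - nC ^ 2) * riC * niC)) :=
  Sm.ext_ev fun x => by have := nv_ne x; simp [dL]; field_simp
@[simp] lemma dL_ctC : dL (ctC : Sm M) = 0 := by simp [dL]
@[simp] lemma dK_rC : dK (rC : Sm M) = -nC ^ 2 := by simp [dK]
@[simp] lemma dK_riC : dK (riC : Sm M) = nC ^ 2 * riC ^ 2 := by simp [dK]
@[simp] lemma dK_nC : dK (nC : Sm M) = -((1 / 2 : ℂ) • ((1 - nC ^ 2) * riC * nC)) :=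
  Sm.ext_ev fun x => by have := nv_ne x; simp [dK]; field_simp
@[simp] lemma dK_niC : dK (niC : Sm M) = (1 / 2 : ℂ) • ((1 - nC ^ 2) * riC * niC) :=
  Sm.ext_ev fun x => by have := nv_ne x; simp [dK]; field_simp
@[simp] lemma dK_ctC : dK (ctC : Sm M) = 0 := by simp [dK]
@[simp] lemma dm_rC : dm (rC : Sm M) = 0 := by simp [dm]
@[simp] lemma dm_riC : dm (riC : Sm M) = 0 := by simp [dm]
@[simp] lemma dm_nC : dm (nC : Sm M) = 0 := by simp [dm]
@[simp] lemma dm_niC : dm (niC : Sm M) = 0 := by simp [dm]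
@[simp] lemma dm_ctC : dm (ctC : Sm M) = -1 - ctC ^ 2 := by simp [dm]
@[simp] lemma dmb_rC : dmb (rC : Sm M) = 0 := by simp [dmb]
@[simp] lemma dmb_riC : dmb (riC : Sm M) = 0 := by simp [dmb]
@[simp] lemma dmb_nC : dmb (nC : Sm M) = 0 := by simp [dmb]
@[simp] lemma dmb_niC : dmb (niC : Sm M) = 0 := by simp [dmb]
@[simp] lemma dmb_ctC : dmb (ctC : Sm M) = -1 - ctC ^ 2 := by simp [dmb]

lemma dK_dL (a : Sm M) : dK (dL a) = dL (dK a) := by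
  simp [dL, dK, D_comm 1 0]; ring
lemma dm_dL (a : Sm M) : dm (dL a) = dL (dm a) := by
  simp [dL, dm, D_comm 2 0, D_comm 2 1, D_comm 3 0, D_comm 3 1, Algebra.smul_def]; ring
lemma dm_dK (a : Sm M) : dm (dK a) = dK (dm a) := by
  simp [dK, dm, D_comm 2 0, D_comm 2 1, D_comm 3 0, D_comm 3 1, Algebra.smul_def]; ring
lemma dmb_dL (a : Sm M) : dmb (dL a) = dL (dmb a) := by
  simp [dL, dmb, D_comm 2 0, D_comm 2 1, D_comm 3 0, D_comm 3 1, Algebra.smul_def]; ring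
lemma dmb_dK (a : Sm M) : dmb (dK a) = dK (dmb a) := by
  simp [dK, dmb, D_comm 2 0, D_comm 2 1, D_comm 3 0, D_comm 3 1, Algebra.smul_def]; ring
lemma dmb_dm (a : Sm M) : dmb (dm a) = dm (dmb a) - ctC * (dm a - dmb a) := by
  simp [dm, dmb, D_comm 3 2, Algebra.smul_def]; ring

/-- `ð` on scalars of spin weight `s`, without the factor `1 / (√2 r)`. -/
def ed (s : ℤ) (a : Sm M) : Sm M := dm a - (s : ℂ) • (ctC * a)

/-- `ð'` on scalars of spin weight `s`, without the factor `1 / (√2 r)`. -/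
def ed' (s : ℤ) (a : Sm M) : Sm M := dmb a + (s : ℂ) • (ctC * a)

/-! ### The field equations and the Weyl scalar in null frame components. -/

set_option maxHeartbeats 1000000 in
-- Here and in the next two lemmas the connection terms `cot θ` are absorbed in `ed` and `ed'`,
-- since each frame component has a definite spin weight; the derivatives are then put in a fixed
-- order by the commutators.
lemma linRic_mbmb (h : Fin 4 → Fin 4 → Sm M) (hs : ∀ i j, h i j = h j i) :
    LinRic dF frC HC h 3 3 = -niC ^ 2 * ed' (-1) (ed' 0 (h 0 1))
      + niC ^ 2 * dK (ed' (-1) (h 0 3)) + niC ^ 2 * dL (ed' (-1) (h 1 3))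
      + (4 * nC ^ 2 - 2) * riC ^ 2 * h 3 3 + riC * dK (h 3 3) - riC * dL (h 3 3)
      - niC ^ 2 * dL (dK (h 3 3)) := by
  refine Sm.ext_ev fun x => ?_
  have h1 := nv_ne x; have h2 := rv_ne x; have h3 := sv_ne x
  simp [LinRic, Cov1, Cov2, Cov3, Fin.sum_univ_four, HC, frC, dF, hs 1 0, hs 2 0, hs 3 0, hs 2 1,
    hs 3 1, hs 3 2, ed', dK_dL, dm_dL, dm_dK, dmb_dL, dmb_dK, dmb_dm]
  field_simp
  ring

set_option maxHeartbeats 1000000 in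
lemma linRic_nn (h : Fin 4 → Fin 4 → Sm M) (hs : ∀ i j, h i j = h j i) :
    LinRic dF frC HC h 1 1 = 2 * (nC ^ 2 - 1) * riC ^ 2 * h 0 1 - 2 * riC * dK (h 0 1)
      + riC * dK (h 1 1) + riC * dL (h 1 1) + riC ^ 2 * ed (-1) (ed' 0 (h 1 1))
      + (nC ^ 2 - 1) * riC ^ 3 * ed' 1 (h 1 2) - riC ^ 2 * dK (ed' 1 (h 1 2))
      + (nC ^ 2 - 1) * riC ^ 3 * ed (-1) (h 1 3) - riC ^ 2 * dK (ed (-1) (h 1 3))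
      + 2 * nC ^ 4 * riC ^ 4 * h 2 3 + (nC ^ 2 + 1) * riC ^ 3 * dK (h 2 3)
      + riC ^ 2 * dK (dK (h 2 3)) := by
  refine Sm.ext_ev fun x => ?_
  have h1 := nv_ne x; have h2 := rv_ne x; have h3 := sv_ne x
  simp [LinRic, Cov1, Cov2, Cov3, Fin.sum_univ_four, HC, frC, dF, hs 1 0, hs 2 0, hs 3 0, hs 2 1,
    hs 3 1, hs 3 2, ed, ed', dK_dL, dm_dL, dm_dK, dmb_dL, dmb_dK, dmb_dm]
  field_simp
  ring

set_option maxHeartbeats 1000000 in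
lemma linRic_nmb (h : Fin 4 → Fin 4 → Sm M) (hs : ∀ i j, h i j = h j i) :
    (2 : ℂ) • LinRic dF frC HC h 1 3 = -(niC ^ 2 + 1) * riC * ed' 0 (h 0 1)
      - niC ^ 2 * dK (ed' 0 (h 0 1))
      - 2 * nC ^ 2 * riC ^ 2 * h 0 3 + (niC ^ 2 - 1) * riC * dK (h 0 3) + niC ^ 2 * dK (dK (h 0 3))
      + niC ^ 2 * dL (ed' 0 (h 1 1)) - riC ^ 2 * ed' 0 (ed' 1 (h 1 2))
      + 2 * (1 - nC ^ 2) * riC ^ 2 * h 1 3 + 2 * riC * dK (h 1 3)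
      + (3 - niC ^ 2) * riC * dL (h 1 3) - niC ^ 2 * dL (dK (h 1 3))
      + riC ^ 2 * ed (-2) (ed' (-1) (h 1 3))
      + 2 * nC ^ 2 * riC ^ 3 * ed' 0 (h 2 3) + riC ^ 2 * dK (ed' 0 (h 2 3))
      - 2 * nC ^ 2 * riC ^ 3 * ed (-2) (h 3 3) - riC ^ 2 * dK (ed (-2) (h 3 3)) := by
  refine Sm.ext_ev fun x => ?_
  have h1 := nv_ne x; have h2 := rv_ne x; have h3 := sv_ne x
  simp [LinRic, Cov1, Cov2, Cov3, Fin.sum_univ_four, HC, frC, dF, hs 1 0, hs 2 0, hs 3 0, hs 2 1,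
    hs 3 1, hs 3 2, ed, ed', dK_dL, dm_dL, dm_dK, dmb_dL, dmb_dK, dmb_dm]
  field_simp
  ring

lemma fr3_linChr (T : Fin 4 → Fin 4 → Sm M) :
    Fr3 EC (LinChr D chrC T) = LinChr dF frC (Fr2 EC T) := by
  have h := (isFrame (M := M)).cov2 T
  generalize hX : Cov2 D chrC T = X at h
  have hp : ∀ i j k, Fr3 EC (fun e b c => X b e c) i j k = Fr3 EC X j i k := by
    intro i j k; unfold Fr3 Fr2; rw [sum_mul_swap]
  have hq : ∀ i j k, Fr3 EC (fun e b c => X c b e) i j k = Fr3 EC X k j i := by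
    intro i j k
    unfold Fr3 Fr2 Fr1
    rw [sum_mul_swap]
    rw [Finset.sum_congr rfl fun b _ => by rw [sum_mul_swap (EC i) (EC k)]]
    rw [sum_mul_swap (EC j) (EC k)]
  funext i j k
  unfold LinChr
  rw [h, h, h, hX]
  simp only [Algebra.smul_def]
  rw [Fr3_mul, Fr3_sub, Fr3_add, hp, hq]

/-- The frame component `P` with `ψ₄ = P / (4 N² r²)`. -/
def weylP (h : Fin 4 → Fin 4 → Sm M) : Sm M :=
  Cov3 dF frC (LinChr dF frC h) 1 3 3 1 - Cov3 dF frC (LinChr dF frC h) 3 3 1 1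

/-- Only the two derivatives of the perturbed connection survive the contraction with `n m̄ n m̄`,
by `riemC_contract`; the rest is a permutation of the slots to match the covariance lemma
`IsFrame.cov3`. -/
lemma fr4_linRiem (T : Fin 4 → Fin 4 → Sm M) :
    -Fr4 EC (LinRiem T) 1 3 1 3 = weylP (Fr2 EC T) := by
  unfold weylP
  rw [← fr3_linChr, isFrame.cov3, isFrame.cov3]
  generalize hX : Cov3 D chrC (LinChr D chrC T) = X
  have h1 : ∀ i j k l, Fr4 EC (fun a b c d => X b d a c) i j k l = Fr4 EC X j l i k := by
    intro i j k l
    unfold Fr4 Fr3 Fr2 Fr1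
    rw [sum_mul_swap]
    refine Finset.sum_congr rfl fun a _ => ?_
    rw [Finset.sum_congr rfl fun b _ => by rw [sum_mul_swap (EC k) (EC l)]]
    rw [sum_mul_swap (EC i) (EC l)]
  have h2 : ∀ i j k l, Fr4 EC (fun a b c d => X a d b c) i j k l = Fr4 EC X i l j k := by
    intro i j k l
    unfold Fr4 Fr3 Fr2 Fr1
    refine Finset.sum_congr rfl fun a _ => ?_
    rw [Finset.sum_congr rfl fun b _ => by rw [sum_mul_swap (EC k) (EC l)]]
    rw [sum_mul_swap (EC j) (EC l)]
  have h3 : Fr4 EC (fun a b c d => ∑ e, riemC a b c e * T e d) 1 3 1 3 = (0 : Sm M) := by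
    have hz : ∀ e d, ∑ a, EC 1 a * ∑ b, EC 3 b * ∑ c, EC 1 c * (riemC a b c e * T e d) =
        (0 : Sm M) := by
      intro e d
      have : ∑ a, EC 1 a * ∑ b, EC 3 b * ∑ c, EC 1 c * (riemC a b c e * T e d) =
          ∑ b, (∑ a, EC 1 a * ∑ c, EC 1 c * (EC 3 b * riemC a b c e)) * T e d := by
        simp only [Finset.mul_sum, Finset.sum_mul]
        rw [Finset.sum_comm]
        exact Finset.sum_congr rfl fun b _ => Finset.sum_congr rfl fun a _ =>
          Finset.sum_congr rfl fun c _ => by ring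
      simp only [this, riemC_contract, zero_mul, Finset.sum_const_zero]
    have : Fr4 EC (fun a b c d => ∑ e, riemC a b c e * T e d) 1 3 1 3 =
        ∑ d, EC 3 d * ∑ e, 1 * ∑ a, EC 1 a * ∑ b, EC 3 b * ∑ c, EC 1 c *
          (riemC a b c e * T e d) := by
      have h1 : ∀ a b c d, ∑ e, riemC a b c e * T e d = ∑ e, 1 * (riemC a b c e * T e d) := by
        simp only [one_mul, implies_true]
      unfold Fr4 Fr3 Fr2 Fr1
      simp only [h1, sum_mul_swap (EC 1) (EC 3), sum_mul_swap (EC 1) (fun _ => (1 : Sm M)),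
        sum_mul_swap (EC 3) (fun _ => (1 : Sm M))]
      refine Finset.sum_congr rfl fun e _ => ?_
      rw [sum_mul_swap (EC 3) (EC 3)]
    rw [this]
    simp only [hz, Finset.sum_const_zero, mul_zero]
  have h4 : Fr4 EC (LinRiem T) 1 3 1 3 = Fr4 EC (fun a b c d => X b d a c) 1 3 1 3
      - Fr4 EC (fun a b c d => X a d b c) 1 3 1 3
      + Fr4 EC (fun a b c d => ∑ e, riemC a b c e * T e d) 1 3 1 3 := by
    have : LinRiem T = fun a b c d => (X b d a c - X a d b c) + ∑ e, riemC a b c e * T e d := by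
      funext a b c d; unfold LinRiem; rw [hX]
    rw [this]
    unfold Fr4
    simp only [Fr3_add, Fr3_sub, mul_add, mul_sub, Finset.sum_add_distrib, Finset.sum_sub_distrib]
  rw [h4, h1, h2, h3]
  ring

set_option maxHeartbeats 1000000 in
lemma weylP_eq (h : Fin 4 → Fin 4 → Sm M) (hs : ∀ i j, h i j = h j i) :
    (2 : ℂ) • weylP h = ed' (-1) (ed' 0 (h 1 1))
      + 2 * (nC ^ 2 - 1) * riC * ed' (-1) (h 1 3) - 2 * dK (ed' (-1) (h 1 3))
      + 2 * nC ^ 4 * riC ^ 2 * h 3 3 + (nC ^ 2 + 1) * riC * dK (h 3 3) + dK (dK (h 3 3)) := by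
  refine Sm.ext_ev fun x => ?_
  have h1 := nv_ne x; have h2 := rv_ne x; have h3 := sv_ne x
  simp [weylP, LinChr, Cov2, Cov3, Fin.sum_univ_four, frC, dF, hs 1 0, hs 3 0, hs 2 1,
    hs 3 1, hs 3 2, ed', dmb_dK]
  field_simp
  ring

/-! ### Calculus of `ð` and the Teukolsky equation -/

@[simp] lemma ed_zero (s : ℤ) : ed s (0 : Sm M) = 0 := by simp [ed]
@[simp] lemma ed'_zero (s : ℤ) : ed' s (0 : Sm M) = 0 := by simp [ed']
@[simp] lemma ed_add (s : ℤ) (a b : Sm M) : ed s (a + b) = ed s a + ed s b := by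
  simp only [ed, map_add, mul_add, smul_add]; ring
@[simp] lemma ed'_add (s : ℤ) (a b : Sm M) : ed' s (a + b) = ed' s a + ed' s b := by
  simp only [ed', map_add, mul_add, smul_add]; ring
@[simp] lemma ed_neg (s : ℤ) (a : Sm M) : ed s (-a) = -ed s a := by
  simp only [ed, map_neg, mul_neg, smul_neg]; ring
@[simp] lemma ed'_neg (s : ℤ) (a : Sm M) : ed' s (-a) = -ed' s a := by
  simp only [ed', map_neg, mul_neg, smul_neg]; ring
@[simp] lemma ed_sub (s : ℤ) (a b : Sm M) : ed s (a - b) = ed s a - ed s b := by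
  rw [sub_eq_add_neg, ed_add, ed_neg, ← sub_eq_add_neg]
@[simp] lemma ed'_sub (s : ℤ) (a b : Sm M) : ed' s (a - b) = ed' s a - ed' s b := by
  rw [sub_eq_add_neg, ed'_add, ed'_neg, ← sub_eq_add_neg]
@[simp] lemma ed_smul (s : ℤ) (c : ℂ) (a : Sm M) : ed s (c • a) = c • ed s a := by
  simp only [ed, Derivation.map_smul, mul_smul_comm, smul_sub, smul_comm c]
@[simp] lemma ed'_smul (s : ℤ) (c : ℂ) (a : Sm M) : ed' s (c • a) = c • ed' s a := by
  simp only [ed', Derivation.map_smul, mul_smul_comm, smul_add, smul_comm c]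
lemma ed_mul_left (s : ℤ) {z : Sm M} (hz : dm z = 0) (a : Sm M) : ed s (z * a) = z * ed s a := by
  simp only [ed, Derivation.leibniz, hz, smul_eq_mul, Algebra.smul_def]; ring
lemma ed'_mul_left (s : ℤ) {z : Sm M} (hz : dmb z = 0) (a : Sm M) :
    ed' s (z * a) = z * ed' s a := by
  simp only [ed', Derivation.leibniz, hz, smul_eq_mul, Algebra.smul_def]; ring
lemma ed'_mul_right (s : ℤ) {z : Sm M} (hz : dmb z = 0) (a : Sm M) :
    ed' s (a * z) = z * ed' s a := by
  rw [mul_comm, ed'_mul_left s hz]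
lemma dL_ed (s : ℤ) (a : Sm M) : dL (ed s a) = ed s (dL a) := by
  simp [ed, dm_dL, Algebra.smul_def]
lemma dK_ed (s : ℤ) (a : Sm M) : dK (ed s a) = ed s (dK a) := by
  simp [ed, dm_dK, Algebra.smul_def]
lemma dL_ed' (s : ℤ) (a : Sm M) : dL (ed' s a) = ed' s (dL a) := by
  simp [ed', dmb_dL, Algebra.smul_def]
lemma dK_ed' (s : ℤ) (a : Sm M) : dK (ed' s a) = ed' s (dK a) := by
  simp [ed', dmb_dK, Algebra.smul_def]
/-- The commutator of `ð` and `ð'`. -/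
lemma ed'_ed {s t : ℤ} (ht : t = s + 1) (a : Sm M) :
    ed' t (ed s a) = ed (s - 1) (ed' s a) + (2 * s : ℂ) • a := by
  subst ht
  refine Sm.ext_ev fun x => ?_
  simp [ed, ed', dmb_dm]
  ring

set_option maxHeartbeats 4000000 in
/-- The combination of linearised field equations that yields the Teukolsky equation. -/
lemma teukolsky_identity (h01 h03 h11 h12 h13 h23 h33 Enn Enb Ebb P ψ h : Sm M)
    (hnn : Enn = 2 * (nC ^ 2 - 1) * riC ^ 2 * h01 - 2 * riC * dK h01
      + riC * dK h11 + riC * dL h11 + riC ^ 2 * ed (-1) (ed' 0 h11)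
      + (nC ^ 2 - 1) * riC ^ 3 * ed' 1 h12 - riC ^ 2 * dK (ed' 1 h12)
      + (nC ^ 2 - 1) * riC ^ 3 * ed (-1) h13 - riC ^ 2 * dK (ed (-1) h13)
      + 2 * nC ^ 4 * riC ^ 4 * h23 + (nC ^ 2 + 1) * riC ^ 3 * dK h23
      + riC ^ 2 * dK (dK h23))
    (hnb : Enb = -(niC ^ 2 + 1) * riC * ed' 0 h01
      - niC ^ 2 * dK (ed' 0 h01)
      - 2 * nC ^ 2 * riC ^ 2 * h03 + (niC ^ 2 - 1) * riC * dK h03 + niC ^ 2 * dK (dK h03)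
      + niC ^ 2 * dL (ed' 0 h11) - riC ^ 2 * ed' 0 (ed' 1 h12)
      + 2 * (1 - nC ^ 2) * riC ^ 2 * h13 + 2 * riC * dK h13
      + (3 - niC ^ 2) * riC * dL h13 - niC ^ 2 * dL (dK h13)
      + riC ^ 2 * ed (-2) (ed' (-1) h13)
      + 2 * nC ^ 2 * riC ^ 3 * ed' 0 h23 + riC ^ 2 * dK (ed' 0 h23)
      - 2 * nC ^ 2 * riC ^ 3 * ed (-2) h33 - riC ^ 2 * dK (ed (-2) h33))
    (hbb : Ebb = -niC ^ 2 * ed' (-1) (ed' 0 h01)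
      + niC ^ 2 * dK (ed' (-1) h03) + niC ^ 2 * dL (ed' (-1) h13)
      + (4 * nC ^ 2 - 2) * riC ^ 2 * h33 + riC * dK h33 - riC * dL h33
      - niC ^ 2 * dL (dK h33))
    (hP : P = ed' (-1) (ed' 0 h11)
      + 2 * (nC ^ 2 - 1) * riC * ed' (-1) h13 - 2 * dK (ed' (-1) h13)
      + 2 * nC ^ 4 * riC ^ 2 * h33 + (nC ^ 2 + 1) * riC * dK h33 + dK (dK h33))
    (hψ : ψ = rC ^ 2 * niC ^ 2 * P) (hh : h = dL ψ + (1 - 4 * nC ^ 2) * riC * ψ) :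
    rC * dK (rC * niC ^ 2 * h) - (ed' (-1) (ed (-2) ψ) - 3 * (1 - nC ^ 2) * ψ) =
      -(rC ^ 4 * niC ^ 2) * ed' (-1) (ed' 0 Enn)
        + ed' (-1) (rC ^ 4 * niC ^ 2 * dK Enb + (niC ^ 2 - 3) * rC ^ 3 * Enb)
        - rC ^ 4 * niC ^ 2 * dK (dK Ebb) + (3 - niC ^ 2) * rC ^ 3 * dK Ebb
        + 2 * rC ^ 2 * nC ^ 2 * Ebb := by
  subst hnn hnb hbb hP hψ hh
  refine Sm.ext_ev fun x => ?_
  have h1 := nv_ne x; have h2 := rv_ne x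
  simp [ed_mul_left, ed'_mul_left, ed'_mul_right, dK_ed, dL_ed', dK_ed', dK_dL,
    ed'_ed]
  field_simp
  ring

/-! ### The components of the perturbation in spherical coordinates -/

lemma toCart_contDiff : ContDiff ℝ ∞ toCart := by
  rw [contDiff_pi]
  intro i
  have h : ∀ j : Fin 4, ContDiff ℝ ∞ fun x : Pt => x j := fun j => contDiff_apply ℝ ℝ j
  fin_cases i
  · exact h 0
  · exact ((h 1).mul (Real.contDiff_sin.comp (h 2))).mul (Real.contDiff_cos.comp (h 3))
  · exact ((h 1).mul (Real.contDiff_sin.comp (h 2))).mul (Real.contDiff_sin.comp (h 3))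
  · exact (h 1).mul (Real.contDiff_cos.comp (h 2))

lemma toCart_turn (x : Pt) : toCart (turn x) = toCart x := by
  ext i
  fin_cases i <;> simp [toCart, turn]

lemma toCart_mem {x : Pt} (hx : x ∈ exterior M) : toCart x ∈ cartExterior M := by
  have h : (toCart x 1) ^ 2 + (toCart x 2) ^ 2 + (toCart x 3) ^ 2 = x 1 ^ 2 := by
    simp only [toCart, Matrix.cons_val]
    have h1 := Real.sin_sq_add_cos_sq (x 2)
    have h2 := Real.sin_sq_add_cos_sq (x 3)
    linear_combination x 1 ^ 2 * h1 + x 1 ^ 2 * Real.sin (x 2) ^ 2 * h2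
  unfold cartExterior
  rw [Set.mem_ofPred_eq, h, Real.sqrt_sq (r_pos hx).le]
  exact hx.1

def cartC (i : Fin 4) : Sm M :=
  Sm.mk (fun y => (toCart y i : ℂ))
    (Complex.ofRealCLM.contDiff.comp ((contDiff_pi.1 toCart_contDiff) i)).contDiffOn
    fun x _ => by rw [toCart_turn]

/-- The spherical components are products of derivatives of `toCart` with components of `H` pulled
back along `toCart`. Periodicity in `φ` is inherited from `toCart`. -/
lemma exists_rep_toSpherical {H : Pt → Fin 4 → Fin 4 → ℝ}
    (hs : ContDiffOn ℝ ∞ H (cartExterior M))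
    (hsymm : ∀ X ∈ cartExterior M, ∀ i j, H X i j = H X j i) :
    ∃ T : Fin 4 → Fin 4 → Sm M, (∀ a b, Rep (toSpherical H a b) (T a b)) ∧
      ∀ a b, T a b = T b a := by
  have hsm : ∀ i j, ContDiffOn ℝ ∞ (fun x => (H (toCart x) i j : ℂ)) (exterior M) := by
    intro i j
    have h1 : ContDiffOn ℝ ∞ (fun x => H (toCart x)) (exterior M) :=
      hs.comp toCart_contDiff.contDiffOn fun x hx => toCart_mem hx
    exact Complex.ofRealCLM.contDiff.comp_contDiffOn
      ((contDiffOn_pi.1 ((contDiffOn_pi.1 h1) i)) j)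
  let Hc : Fin 4 → Fin 4 → Sm M := fun i j => Sm.mk (fun x => (H (toCart x) i j : ℂ)) (hsm i j)
    fun x _ => by rw [toCart_turn]
  have hc : ∀ i, Rep (fun y => (toCart y i : ℂ)) (cartC i : Sm M) := fun i => rep_mk _ _ _
  have hH : ∀ i j, Rep (fun x => (H (toCart x) i j : ℂ)) (Hc i j) := fun i j => rep_mk _ _ _
  have hr : ∀ a b, Rep (toSpherical H a b)
      (∑ i, ∑ j, D a (cartC i) * D b (cartC j) * Hc i j : Sm M) := fun a b =>
    Rep.sum fun i => Rep.sum fun j => (((hc i).pd a).mul ((hc j).pd b)).mul (hH i j)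
  refine ⟨_, hr, fun a b => (Finset.sum_comm).trans ?_⟩
  refine Finset.sum_congr rfl fun i _ => Finset.sum_congr rfl fun j _ => ?_
  have : Hc j i = Hc i j := Sm.ext_ev fun x => by
    rw [← hH i j x, ← hH j i x]
    exact congrArg _ (hsymm _ (toCart_mem x.2) _ _)
  rw [this]; ring

/-- The Teukolsky equation for an element of spin weight `-2`. -/
def Teukolsky (ψ : Sm M) : Prop :=
  rC * dK (rC * niC ^ 2 * (dL ψ + (1 - 4 * nC ^ 2) * riC * ψ)) =
    ed' (-1) (ed (-2) ψ) - 3 * (1 - nC ^ 2) * ψ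

lemma exists_teukolsky {T : Fin 4 → Fin 4 → Pt → ℂ} {T' : Fin 4 → Fin 4 → Sm M}
    (hT : ∀ a b, Rep (T a b) (T' a b)) (hsymm : ∀ a b, T' a b = T' b a)
    (hE : ∀ x ∈ exterior M, ∀ a b, linEinstein M T a b x = 0) :
    ∃ ψ : Sm M, Rep (teukolskyVar M T) ψ ∧ Teukolsky ψ := by
  obtain ⟨X, hX⟩ := rep_linEinstein hT
  have hz : ∀ a b, LinRic D chrC giC T' a b = -(gC a b * X) := fun a b =>
    eq_neg_of_add_eq_zero_left (Sm.ext_ev fun x => by rw [← hX a b x, hE x x.2, map_zero])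
  have hF : ∀ i j, Fr2 EC (gC : Fin 4 → Fin 4 → Sm M) i j = 0 →
      LinRic dF frC HC (Fr2 EC T') i j = 0 := by
    intro i j hij
    rw [isFrame.linRic giC_eq]
    have : LinRic D chrC giC T' = fun a b => (-X) * gC a b := by
      funext a b; rw [hz]; ring
    rw [this, Fr2_mul, hij, mul_zero]
  have hg : Fr2 EC (gC : Fin 4 → Fin 4 → Sm M) 1 1 = 0 ∧
      Fr2 EC (gC : Fin 4 → Fin 4 → Sm M) 1 3 = 0 ∧
      Fr2 EC (gC : Fin 4 → Fin 4 → Sm M) 3 3 = 0 := by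
    refine ⟨?_, ?_, ?_⟩ <;>
    · refine Sm.ext_ev fun x => ?_
      have h1 := nv_ne x; have h2 := rv_ne x; have h3 := sv_ne x
      simp [Fr2, Fr1, Fin.sum_univ_four, EC, gC]
      try field_simp
      try ring_nf
      try simp
  have hs : ∀ i j, Fr2 EC T' i j = Fr2 EC T' j i := Fr2_symm EC hsymm
  have e1 := linRic_nn _ hs
  have e2 := linRic_nmb _ hs
  have e3 := linRic_mbmb _ hs
  have e4 := weylP_eq _ hs
  rw [hF 1 1 hg.1] at e1
  rw [hF 1 3 hg.2.1, smul_zero] at e2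
  rw [hF 3 3 hg.2.2] at e3
  -- The three zeros are the vanishing field equations. They annihilate the source side of the
  -- identity, leaving the homogeneous equation.
  have key := teukolsky_identity _ _ _ _ _ _ _ 0 0 0 _ _ _ e1 e2 e3 e4 rfl rfl
  simp only [map_zero, mul_zero, ed'_zero, add_zero, sub_zero] at key
  -- The Weyl scalar is `weylP / (4 N² r²)`, while the identity is stated for `2 weylP`; with the
  -- factor `r⁴` in `ψ` this gives `1/8` and `r²`.
  refine ⟨(1 / 8 : ℂ) • (rC ^ 2 * niC ^ 2 * ((2 : ℂ) • weylP (Fr2 EC T'))), ?_, ?_⟩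
  · have hr : Rep (fun x : Pt => (x 1 : ℂ)) (rC : Sm M) := fun x => rfl
    refine ((hr.pow 4).mul (rep_psi4 hT)).of_eq ?_
    have : Fr4 EC (LinRiem T') 1 3 1 3 = -weylP (Fr2 EC T') := by rw [← fr4_linRiem]; ring
    rw [this]
    refine Sm.ext_ev fun x => ?_
    have h1 := nv_ne x; have h2 := rv_ne x
    simp
    field_simp
    ring
  · unfold Teukolsky
    generalize rC ^ 2 * niC ^ 2 * ((2 : ℂ) • weylP (Fr2 EC T')) = ψ at key ⊢
    have h2 : rC * niC ^ 2 * (dL ((1 / 8 : ℂ) • ψ) + (1 - 4 * nC ^ 2) * riC * ((1 / 8 : ℂ) • ψ)) =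
        (1 / 8 : ℂ) • (rC * niC ^ 2 * (dL ψ + (1 - 4 * nC ^ 2) * riC * ψ)) := by
      rw [Derivation.map_smul]; simp only [Algebra.smul_def]; ring
    rw [h2, Derivation.map_smul, ed_smul, ed'_smul, mul_smul_comm, mul_smul_comm, ← smul_sub]
    congr 1
    have h3 : rC * dK (rC * niC ^ 2 * (dL ψ + (1 - 4 * nC ^ 2) * riC * ψ)) -
      (ed' (-1) (ed (-2) ψ) - 3 * (1 - nC ^ 2) * ψ) = 0 := by simpa using key
    exact sub_eq_zero.1 h3

/-! ### The GHP scalars -/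

/-- `1 / √2`. -/
def k2 : ℂ := ((Real.sqrt 2)⁻¹ : ℝ)

@[simp] lemma conj_k2 : starRingEnd ℂ k2 = k2 := Complex.conj_ofReal _

lemma k2_mul_k2 : k2 * k2 = 1 / 2 := by
  unfold k2; rw [← Complex.ofReal_mul, ← mul_inv, Real.mul_self_sqrt (by norm_num)]; norm_num

lemma k2_sq : k2 ^ 2 = 1 / 2 := by rw [sq, k2_mul_k2]

lemma k2_ne : k2 ≠ 0 := fun h => by have := k2_mul_k2; simp [h] at this

@[simp] lemma cj_rC : cj (rC : Sm M) = rC := Sm.ext_ev fun x => by simp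
@[simp] lemma cj_riC : cj (riC : Sm M) = riC := Sm.ext_ev fun x => by simp
@[simp] lemma cj_nC : cj (nC : Sm M) = nC := Sm.ext_ev fun x => by simp
@[simp] lemma cj_niC : cj (niC : Sm M) = niC := Sm.ext_ev fun x => by simp
@[simp] lemma cj_snC : cj (snC : Sm M) = snC := Sm.ext_ev fun x => by simp
@[simp] lemma cj_siC : cj (siC : Sm M) = siC := Sm.ext_ev fun x => by simp
@[simp] lemma cj_ctC : cj (ctC : Sm M) = ctC := Sm.ext_ev fun x => by simp
@[simp] lemma dm_cj (a : Sm M) : dm (cj a) = cj (dmb a) := by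
  simp [dm, dmb, Algebra.smul_def]
  refine Sm.ext_ev fun x => ?_
  simp
@[simp] lemma dmb_cj (a : Sm M) : dmb (cj a) = cj (dm a) := by
  rw [← cj_cj (dmb (cj a)), ← dm_cj, cj_cj]
lemma ed_cj (s : ℤ) (a : Sm M) : ed s (cj a) = cj (ed' (-s) a) := by
  simp [ed, ed']; ring
lemma ed'_cj (s : ℤ) (a : Sm M) : ed' s (cj a) = cj (ed (-s) a) := by
  simp [ed, ed']

section Scalars

variable {F : Pt → ℂ} {a : Sm M}

lemma rep_rho : Rep (fun x => (rho M x : ℂ)) (-(k2 • (nC * riC)) : Sm M) := fun x => by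
  have h1 := rv_ne x
  unfold rho k2; push_cast; rw [sqrtDel_eq, x1_eq]
  simp; field_simp

lemma rep_eps : Rep (fun x => (eps M x : ℂ))
    ((1 / 4 : ℂ) • k2 • ((1 - nC ^ 2) * riC * niC) : Sm M) := fun x => by
  have h1 := rv_ne x
  have h2 := nv_ne x
  unfold eps k2; push_cast; rw [sqrtDel_eq, x1_eq, M_eq x]
  simp; field_simp; norm_num

lemma rep_beta : Rep (fun x => (beta x : ℂ)) ((1 / 2 : ℂ) • k2 • (ctC * riC) : Sm M) := fun x => by
  have h1 := rv_ne x
  have h2 := sv_ne x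
  unfold beta k2; simp only [Real.cot_eq_cos_div_sin]; push_cast
  simp [sv, cv, rv] at h1 h2 ⊢; field_simp

lemma rep_dirL (h : Rep F a) : Rep (dir (lUp M) F) (k2 • (niC * dL a)) := fun x => by
  have h2 := nv_ne x
  unfold dir
  simp only [Fin.sum_univ_four, lUp_eq, h.pd _ x]
  simp [dL, k2]; field_simp

lemma rep_dirK (h : Rep F a) : Rep (dir (nUp M) F) (k2 • (niC * dK a)) := fun x => by
  have h2 := nv_ne x
  unfold dir
  simp only [Fin.sum_univ_four, nUp_eq, h.pd _ x]
  simp [dK, k2]; field_simp; ring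

lemma rep_dirm (h : Rep F a) : Rep (dir mUp F) (k2 • (riC * dm a)) := fun x => by
  have h2 := rv_ne x
  unfold dir
  simp only [Fin.sum_univ_four, mUp_eq, h.pd _ x]
  simp [dm, k2]; ring

lemma rep_dirmb (h : Rep F a) : Rep (dir mbUp F) (k2 • (riC * dmb a)) := fun x => by
  have h2 := rv_ne x
  unfold dir
  simp only [Fin.sum_univ_four, mbUp_eq, h.pd _ x]
  simp [dmb, k2]; ring

lemma rep_thorn (h : Rep F a) (p q : ℤ) : Rep (thorn M p q F)
    (k2 • (niC * (dL a - ((p + q) / 4 : ℂ) • ((1 - nC ^ 2) * riC * a)))) := fun x => by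
  unfold thorn
  rw [rep_dirL h x, show (eps M x : ℂ) = _ from rep_eps x, h x]
  simp; ring

lemma rep_eth (h : Rep F a) {p q s : ℤ} (hs : p - q = 2 * s) :
    Rep (eth p q F) (k2 • (riC * ed s a)) := fun x => by
  unfold eth
  have : (p : ℂ) = q + 2 * s := by rw [← sub_eq_iff_eq_add']; exact_mod_cast hs
  rw [rep_dirm h x, show (beta x : ℂ) = _ from rep_beta x, h x, this]
  simp [ed]; ring

lemma rep_eth' (h : Rep F a) {p q s : ℤ} (hs : p - q = 2 * s) :
    Rep (eth' p q F) (k2 • (riC * ed' s a)) := fun x => by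
  unfold eth'
  have : (p : ℂ) = q + 2 * s := by rw [← sub_eq_iff_eq_add']; exact_mod_cast hs
  rw [rep_dirmb h x, show (beta x : ℂ) = _ from rep_beta x, h x, this]
  simp [ed']; ring

/-- `√2 (þ + 3ρ) ψ`. -/
def gOf (ψ : Sm M) : Sm M := niC * (dL ψ + (1 - 4 * nC ^ 2) * riC * ψ)

/-- `(þ + ρ) (þ + 3ρ) ψ` in terms of `g = √2 (þ + 3ρ) ψ`. -/
def scalarOf (g : Sm M) : Sm M :=
  (1 / 2 : ℂ) • (niC * (dL g + (1 / 2 : ℂ) • ((1 - 3 * nC ^ 2) * riC * g)))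

lemma rep_etaOf (h : Rep F a) : Rep (etaOf M F) (k2 • gOf a) := fun x => by
  have h2 := nv_ne x
  unfold etaOf
  rw [rep_thorn h _ _ x, show (rho M x : ℂ) = _ from rep_rho x, h x]
  simp [gOf]; field_simp; ring

lemma rep_dhrScalar (h : Rep F a) : Rep (dhrScalar M F) (scalarOf (gOf a)) := fun x => by
  have h2 := nv_ne x
  unfold dhrScalar
  rw [rep_thorn (rep_etaOf h) _ _ x, show (rho M x : ℂ) = _ from rep_rho x, rep_etaOf h x]
  simp [scalarOf]; field_simp; rw [k2_sq]; ring

end Scalars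

/-! ### The tensor `m_a m_b f + c.c.` -/

/-- Normalised by `m_a = -(r / √2) em_a`, which is the origin of the factor `r² / 2` in `mC`. -/
def em : Fin 4 → Sm M := ![0, 0, 1, Complex.I • snC]

lemma rep_lower_m (a : Fin 4) : Rep (lower M mUp a) (-(k2 • (rC * em a)) : Sm M) := fun x => by
  have h1 := rv_ne x; have h2 := sv_ne x
  unfold lower
  simp only [rep_g _ _ x, mUp_eq]
  fin_cases a <;> simp [gC, em, k2, Fin.sum_univ_four] <;> field_simp

def mC (F : Sm M) (a b : Fin 4) : Sm M :=
  (1 / 2 : ℂ) • (rC ^ 2 * (em a * em b * F + cj (em a * em b * F)))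

lemma rep_mmTensor {F : Pt → ℂ} {F' : Sm M} (h : Rep F F') (a b : Fin 4) :
    Rep (mmTensor M F a b) (mC F' a b) := by
  have h1 := ((rep_lower_m (M := M) a).mul (rep_lower_m b)).mul h
  refine (h1.add h1.conj).of_eq (Sm.ext_ev fun x => ?_)
  simp [mC]
  linear_combination (rv x ^ 2 * (ev x (em a) * ev x (em b) * ev x F' +
    starRingEnd ℂ (ev x (em a)) * starRingEnd ℂ (ev x (em b)) * starRingEnd ℂ (ev x F'))) * k2_sq

lemma mC_mul {z : Sm M} (hz : cj z = z) (F : Sm M) (a b : Fin 4) :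
    mC (z * F) a b = z * mC F a b := by
  simp only [mC, map_mul, hz, Algebra.smul_def]; ring

lemma mC_smul {c : ℂ} (hc : starRingEnd ℂ c = c) (F : Sm M) (a b : Fin 4) :
    mC (c • F) a b = c • mC F a b := by
  refine Sm.ext_ev fun x => ?_
  simp [mC, hc]; ring

lemma mC_add (F G : Sm M) (a b : Fin 4) : mC (F + G) a b = mC F a b + mC G a b := by
  simp only [mC, map_mul, map_add, Algebra.smul_def]; ring

lemma mC_sub (F G : Sm M) (a b : Fin 4) : mC (F - G) a b = mC F a b - mC G a b := by
  simp only [mC, map_mul, map_sub, Algebra.smul_def]; ring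

@[simp] lemma em_zero : (em 0 : Sm M) = 0 := rfl
@[simp] lemma em_one : (em 1 : Sm M) = 0 := rfl
@[simp] lemma em_two : (em 2 : Sm M) = 1 := rfl
@[simp] lemma em_three : (em 3 : Sm M) = Complex.I • snC := rfl

/-- The covectors `m_a` and `m̄_a` are parallel along `∂_t` and, by `cov_mC_one`, along `∂_r`.
Derivatives along `l` and `n` of `m_a m_b F + c.c.` therefore act on the scalar only. -/
lemma cov_mC_zero (F : Sm M) (a b : Fin 4) :
    Cov2 D chrC (mC F) 0 a b = mC (D 0 F) a b := by
  refine Sm.ext_ev fun x => ?_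
  fin_cases a <;> fin_cases b <;>
  simp [Cov2, Fin.sum_univ_four, chrC, mC]

lemma cov_mC_one (F : Sm M) (a b : Fin 4) :
    Cov2 D chrC (mC F) 1 a b = mC (D 1 F) a b := by
  refine Sm.ext_ev fun x => ?_
  have h1 := rv_ne x
  fin_cases a <;> fin_cases b <;>
  simp [Cov2, Fin.sum_univ_four, chrC, mC] <;> field_simp <;> ring

section DirCov

variable {T : Fin 4 → Fin 4 → Pt → ℂ} {F : Sm M}

lemma rep_dirCovL (h : ∀ a b, Rep (T a b) (mC F a b)) (a b : Fin 4) :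
    Rep (dirCov M (lUp M) T a b) (mC (k2 • (niC * dL F)) a b) := fun x => by
  have h2 := nv_ne x
  unfold dirCov
  simp only [Fin.sum_univ_four, lUp_eq, rep_cov2 h _ _ _ x, cov_mC_zero, cov_mC_one]
  have e : niC * dL F = niC * D 0 F + nC * D 1 F := Sm.ext_ev fun x => by
    have h2 := nv_ne x
    simp [dL]; field_simp
  rw [e, mC_smul conj_k2, mC_add, mC_mul cj_niC, mC_mul cj_nC]
  simp [k2]; field_simp

lemma rep_dirCovK (h : ∀ a b, Rep (T a b) (mC F a b)) (a b : Fin 4) :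
    Rep (dirCov M (nUp M) T a b) (mC (k2 • (niC * dK F)) a b) := fun x => by
  have h2 := nv_ne x
  unfold dirCov
  simp only [Fin.sum_univ_four, nUp_eq, rep_cov2 h _ _ _ x, cov_mC_zero, cov_mC_one]
  have e : niC * dK F = niC * D 0 F - nC * D 1 F := Sm.ext_ev fun x => by
    have h2 := nv_ne x
    simp [dK]; field_simp
  rw [e, mC_smul conj_k2, mC_sub, mC_mul cj_niC, mC_mul cj_nC]
  simp [k2]; field_simp; ring

end DirCov

/-- The Dafermos-Holzegel-Rodnianski tensor is `-(r / 4) (m_a m_b Ψ + c.c.)`. -/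
lemma rep_dhrTensor {γ : Fin 4 → Fin 4 → Pt → ℂ} {ψ : Sm M} (h : Rep (teukolskyVar M γ) ψ)
    (a b : Fin 4) :
    Rep (dhrTensor M γ a b) (mC (-(1 / 4 : ℂ) • (rC * scalarOf (gOf ψ))) a b) := by
  have h4 : Rep (psi4 M γ) (riC ^ 4 * ψ) := fun x => by
    have h1 := rv_ne x
    rw [map_mul, ← h x]
    unfold teukolskyVar
    rw [x1_eq]; simp; field_simp
  have hD : Rep (fun z => ((Del M z / z 1 : ℝ) : ℂ)) (rC * nC ^ 2 : Sm M) := fun x => by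
    have h1 := rv_ne x
    push_cast; rw [Del_eq, x1_eq]; simp; field_simp
  have hS : Rep (fun y => ((y 1 ^ 3 / sqrtDel M y : ℝ) : ℂ)) (rC ^ 2 * niC : Sm M) := fun x => by
    have h1 := rv_ne x; have h2 := nv_ne x
    push_cast; rw [sqrtDel_eq, x1_eq]; simp; field_simp
  have hQ : Rep (fun x => -((x 1 ^ 3 / (4 * sqrtDel M x) : ℝ) : ℂ))
      (-((1 / 4 : ℂ) • (rC ^ 2 * niC)) : Sm M) := fun x => by
    have h1 := rv_ne x; have h2 := nv_ne x
    push_cast; rw [sqrtDel_eq, x1_eq]; simp; field_simp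
  have s1 : ∀ a b, Rep (fun z => ((Del M z / z 1 : ℝ) : ℂ) * mmTensor M (psi4 M γ) a b z)
      (mC (rC * nC ^ 2 * (riC ^ 4 * ψ)) a b) := fun a b =>
    (hD.mul (rep_mmTensor h4 a b)).of_eq (mC_mul (by simp) _ a b).symm
  have s2 := fun a b => (hS.mul (rep_dirCovL s1 a b)).of_eq (mC_mul (by simp) _ a b).symm
  refine (hQ.mul (rep_dirCovL s2 a b)).of_eq ?_
  rw [neg_mul, smul_mul_assoc, ← mC_mul (by simp), ← mC_smul (by simp), ← neg_one_smul ℂ,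
    ← mC_smul (by simp)]
  -- A scalar identity remains. On weight `(-4, 0)`, `D` conjugated by `N² r⁻³` is `þ + 3ρ`, and on
  -- weight `(-3, 1)`, `D` conjugated by `N r⁻¹` is `þ + ρ`; the powers of `r` and `√Δ` in the
  -- tensor supply these factors.
  congr 1
  refine Sm.ext_ev fun x => ?_
  have h1 := rv_ne x; have h2 := nv_ne x
  simp [scalarOf, gOf]
  field_simp
  rw [k2_sq]
  ring

/-! ### The Regge-Wheeler energy densities -/

/-- The density of the scalar Regge-Wheeler energy. -/
def dhrQ (P : Sm M) : Sm M :=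
  nC * (niC ^ 2 * (D 0 P * cj (D 0 P)) + nC ^ 2 * ((D 1 P + riC * P) * cj (D 1 P + riC * P))
    + (1 / 2 : ℂ) • (riC ^ 2 * (ed (-2) P * cj (ed (-2) P) + ed' (-2) P * cj (ed' (-2) P)))
    + riC ^ 2 * (1 + 3 * nC ^ 2) * (P * cj P))

lemma rep_dhrPotential :
    Rep (fun x => (dhrPotential M x : ℂ)) (riC ^ 2 * (1 + 3 * nC ^ 2) : Sm M) := fun x => by
  have h1 := rv_ne x
  unfold dhrPotential
  push_cast
  rw [M_eq x, x1_eq]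
  simp
  field_simp
  ring

lemma rep_Dt {F : Pt → ℂ} {P : Sm M} (h : Rep F P) :
    Rep (Dt M F) ((2 * k2) • (niC * D 0 P)) := fun x => by
  have h2 := nv_ne x
  unfold Dt
  rw [rep_dirL h x, rep_dirK h x]
  simp [dL, dK]; ring

lemma rep_Dr {F : Pt → ℂ} {P : Sm M} (h : Rep F P) :
    Rep (Dr M F) ((2 * k2) • (nC * D 1 P)) := fun x => by
  have h2 := nv_ne x
  unfold Dr
  rw [rep_dirL h x, rep_dirK h x]
  simp [dL, dK]; field_simp; ring

lemma rep_dhrScalarDensity {F : Pt → ℂ} {P : Sm M} (h : Rep F P) :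
    Rep (dhrScalarDensity M F) (dhrQ P) := fun x => by
  have h2 := nv_ne x
  unfold dhrScalarDensity
  push_cast
  simp only [← Complex.mul_conj']
  rw [lapse_eq, rep_Dt h x, rep_Dr h x, show (rho M x : ℂ) = _ from rep_rho x,
    rep_eth h (s := -2) (by norm_num) x, rep_eth' h (s := -2) (by norm_num) x, h x,
    show (dhrPotential M x : ℂ) = _ from rep_dhrPotential x]
  simp only [dhrQ, map_add, map_mul, map_smul, map_pow, map_neg, ev_cj, ev_riC, ev_nC, ev_niC,
    conj_k2, conj_rv, conj_nv, smul_eq_mul, map_inv₀, map_ofNat,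
    map_sub, map_one]
  field_simp
  simp only [k2_sq]
  ring

lemma contract2_eq (S T : Fin 4 → Fin 4 → Pt → ℂ) (x : Pt) :
    contract2 M S T x = ∑ a, ∑ b, gInv M a a x * gInv M b b x * S a b x * T a b x := by
  simp [contract2, gInv]

lemma sq3_eq (T : Fin 4 → Fin 4 → Fin 4 → Pt → ℂ) (x : Pt) :
    sq3 M T x = ∑ c, ∑ a, ∑ b,
      gInv M c c x * gInv M a a x * gInv M b b x * T c a b x ^ 2 := by
  simp [sq3, gInv, sq, mul_assoc]

lemma rep_sq2_mC {T : Fin 4 → Fin 4 → Pt → ℂ} {F : Sm M} (h : ∀ a b, Rep (T a b) (mC F a b)) :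
    Rep (sq2 M T) (2 * (F * cj F)) := fun x => by
  have h1 := rv_ne x
  have h3 := sv_ne x
  unfold sq2
  simp only [contract2_eq, h _ _ x, rep_gInv _ _ x]
  simp [Fin.sum_univ_four, giC, mC]
  field_simp
  ring_nf
  simp only [Complex.I_sq, Complex.I_pow_four]
  ring

lemma sProj_eq (x : exterior M) (a b : Fin 4) :
    sProj M a b x = if a = b ∧ 2 ≤ a then 1 else 0 := by
  have h1 := rv_ne x
  have h3 := sv_ne x
  have e : ∀ a, lower M mbUp a x = starRingEnd ℂ (lower M mUp a x) := fun a => by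
    unfold lower mbUp g
    simp
  have hk : ∀ a, mUp x a = k2 * (rv x)⁻¹ * (![0, 0, 1, Complex.I * (sv x)⁻¹] : Fin 4 → ℂ) a :=
    fun a => by rw [mUp_eq]; simp [k2, mul_comm]
  unfold sProj
  rw [e, rep_lower_m a x, mbUp, hk]
  fin_cases a <;> fin_cases b <;> simp [em] <;> field_simp <;>
    (try simp only [k2_sq, Complex.I_sq]) <;> norm_num

/-- The covariant derivative on the spheres of `m_a m_b F + c.c.`. -/
def smC (F : Sm M) (c a b : Fin 4) : Sm M :=
  (1 / 4 : ℂ) • (rC ^ 2 * (em a * em b * (em c * ed' (-2) F + cj (em c) * ed (-2) F)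
    + cj (em a * em b * (em c * ed' (-2) F + cj (em c) * ed (-2) F))))

set_option maxHeartbeats 1000000 in
lemma cov2_mC_sphere (F : Sm M) {a b c : Fin 4} (ha : 2 ≤ a) (hb : 2 ≤ b) (hc : 2 ≤ c) :
    Cov2 D chrC (mC F) c a b = smC F c a b := by
  refine Sm.ext_ev fun x => ?_
  have h3 := sv_ne x
  have h1 := rv_ne x
  have h4 := cv_sq x
  fin_cases a <;> first | (exfalso; revert ha; decide) | skip
  all_goals fin_cases b <;> first | (exfalso; revert hb; decide) | skip
  all_goals fin_cases c <;> first | (exfalso; revert hc; decide) | skip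
  all_goals
    simp [Cov2, mC, smC, chrC, Fin.sum_univ_four, ed, ed', dm, dmb]
    field_simp
    ring_nf
    try simp only [Complex.I_sq, Complex.I_pow_three]
    try ring

lemma rep_sphereCov2 {T : Fin 4 → Fin 4 → Pt → ℂ} {F : Sm M}
    (h : ∀ a b, Rep (T a b) (mC F a b)) (c a b : Fin 4) :
    Rep (sphereCov2 M T c a b) (smC F c a b) := fun x => by
  unfold sphereCov2
  simp only [sProj_eq, rep_cov2 h _ _ _ x]
  by_cases hh : 2 ≤ a ∧ 2 ≤ b ∧ 2 ≤ c
  · obtain ⟨ha, hb, hc⟩ := hh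
    simp [ha, hb, hc, cov2_mC_sphere F ha hb hc]
  · have : smC F c a b = 0 := by
      revert hh
      fin_cases a <;> fin_cases b <;> fin_cases c <;> simp [smC]
    rw [this, map_zero]
    simp only [not_and_or] at hh
    rcases hh with hh | hh | hh <;> simp [hh]

lemma rep_sq3_mC {T : Fin 4 → Fin 4 → Pt → ℂ} {F : Sm M} (h : ∀ a b, Rep (T a b) (mC F a b)) :
    Rep (sq3 M (sphereCov2 M T)) (-(riC ^ 2 * (ed (-2) F * cj (ed (-2) F)
      + ed' (-2) F * cj (ed' (-2) F)))) := fun x => by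
  have h1 := rv_ne x
  have h3 := sv_ne x
  simp only [sq3_eq, rep_sphereCov2 h _ _ _ x, rep_gInv _ _ x]
  simp [Fin.sum_univ_four, giC, smC]
  field_simp
  ring_nf
  simp only [Complex.I_sq, Complex.I_pow_four, show Complex.I ^ 6 = -1 by
    rw [show 6 = 4 + 2 from rfl, pow_add]; simp]
  ring

/-- The square of `m_a m_b F + c.c.` is `2 |F|²`, so `F = -(r / 4) P` gives the factor `2 / 16`, and
`r²` cancels the weight `r⁻²`. The shift in `(D_r - 2ρ) P` arises from `D_r r = -2ρ r`. -/
lemma rep_dhrDensity {T : Fin 4 → Fin 4 → Pt → ℂ} {P : Sm M}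
    (h : ∀ a b, Rep (T a b) (mC (-(1 / 4 : ℂ) • (rC * P)) a b)) :
    Rep (dhrDensity M T) ((1 / 8 : ℂ) • dhrQ P) := fun x => by
  have h1 := rv_ne x
  have h2 := nv_ne x
  unfold dhrDensity
  have hp := fun a b => ((rep_dirCovL h a b).add (rep_dirCovK h a b)).of_eq (mC_add _ _ a b).symm
  have hm := fun a b => ((rep_dirCovL h a b).sub (rep_dirCovK h a b)).of_eq (mC_sub _ _ a b).symm
  rw [rep_sq2_mC hp x, rep_sq2_mC hm x, rep_sq2_mC h x, rep_sq3_mC h x,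
    show (dhrPotential M x : ℂ) = _ from rep_dhrPotential x]
  push_cast
  rw [lapse_eq, x1_eq, ed_smul, ed'_smul, ed_mul_left _ (by simp), ed'_mul_left _ (by simp)]
  simp [dhrQ, dL, dK]
  field_simp
  simp only [k2_sq]
  ring

/-! ### The canonical energy density -/

/-- The components of `-l_a l_b U + l_(a m_b) V - m_a m_b W`, where `v = N r V / 4`. -/
def gamC (U v W : Sm M) (a b : Fin 4) : Sm M :=
  (![![-((1 / 2 : ℂ) • (nC ^ 2 * U)), (1 / 2 : ℂ) • U, -v * em b, -v * em b],
    ![(1 / 2 : ℂ) • U, -((1 / 2 : ℂ) • (niC ^ 2 * U)), niC ^ 2 * v * em b, niC ^ 2 * v * em b],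
    ![-v * em a, niC ^ 2 * v * em a, -((1 / 2 : ℂ) • (rC ^ 2 * W * em a * em b)),
      -((1 / 2 : ℂ) • (rC ^ 2 * W * em a * em b))],
    ![-v * em a, niC ^ 2 * v * em a, -((1 / 2 : ℂ) • (rC ^ 2 * W * em a * em b)),
      -((1 / 2 : ℂ) • (rC ^ 2 * W * em a * em b))]] : Fin 4 → Fin 4 → Sm M) a b

lemma rep_lower_l (a : Fin 4) :
    Rep (lower M (lUp M) a) (k2 • ((![nC, -niC, 0, 0] : Fin 4 → Sm M) a)) := fun x => by
  have h1 := nv_ne x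
  unfold lower
  simp only [rep_g _ _ x, lUp_eq]
  fin_cases a <;> simp [gC, k2, Fin.sum_univ_four] <;> field_simp

lemma rep_hertzMetric {F : Pt → ℂ} {U v W : Sm M} (hU : Rep (hertzU F) U)
    (hV : Rep (hertzV M F) ((4 : ℂ) • (riC * niC * v))) (hW : Rep (hertzW M F) W) (a b : Fin 4) :
    Rep (hertzMetric M F a b) (gamC U v W a b) := fun x => by
  have h1 := nv_ne x; have h2 := rv_ne x
  unfold hertzMetric
  rw [rep_lower_l _ x, rep_lower_l _ x, rep_lower_m _ x, rep_lower_m _ x, hU x, hV x, hW x]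
  fin_cases a <;> fin_cases b <;> simp [gamC] <;> (try field_simp) <;>
    (try simp only [k2_sq]) <;> (try ring_nf) <;> (try simp)

def qC (U v W : Sm M) (a b : Fin 4) : Sm M := if a ≠ 0 ∧ b ≠ 0 then gamC U v W a b else 0

def hC (a b : Fin 4) : Sm M := if a ≠ 0 ∧ b ≠ 0 then gC a b else 0

/-- The coefficients of `2 N k_ab` by type: `pi0C` multiplies the sphere metric, `k1C` the mixed
radial component along `em`, `k2C` the product `em_a em_b`, and `xC` is the `rr` component. The
metric of the unit sphere is `omC`. -/
def pi0C (U v : Sm M) : Sm M := riC ^ 2 * ed (-1) v - nC ^ 2 * riC * U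

def k1C (U v : Sm M) : Sm M :=
  niC ^ 2 * D 0 v + D 1 v - 2 * riC * v - (1 / 4 : ℂ) • ed' 0 U

def k2C (v W : Sm M) : Sm M := ed' (-1) v - (1 / 2 : ℂ) • (rC ^ 2 * D 0 W)

def xC (U : Sm M) : Sm M :=
  -((1 / 2 : ℂ) • (niC ^ 2 * D 0 U) + D 1 U + (1 / 2 : ℂ) • ((1 - nC ^ 2) * riC * niC ^ 2 * U))

def omC : Fin 4 → Fin 4 → Sm M := ![0, 0, ![0, 0, 1, 0], ![0, 0, 0, snC ^ 2]]

/-- `2 N k_ab`. -/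
def kC (U v W : Sm M) (a b : Fin 4) : Sm M :=
  (![![0, 0, 0, 0],
    ![0, xC U, k1C U v * em b - (1 / 4 : ℂ) • (cj (em b) * ed 0 U),
      k1C U v * em b - (1 / 4 : ℂ) • (cj (em b) * ed 0 U)],
    ![0, k1C U v * em a - (1 / 4 : ℂ) • (cj (em a) * ed 0 U),
      k2C v W * em a * em b + rC ^ 2 * pi0C U v * omC a b,
      k2C v W * em a * em b + rC ^ 2 * pi0C U v * omC a b],
    ![0, k1C U v * em a - (1 / 4 : ℂ) • (cj (em a) * ed 0 U),
      k2C v W * em a * em b + rC ^ 2 * pi0C U v * omC a b,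
      k2C v W * em a * em b + rC ^ 2 * pi0C U v * omC a b]] : Fin 4 → Fin 4 → Sm M) a b

/-- `2 N p_ab`. -/
def pC (U v W : Sm M) (a b : Fin 4) : Sm M :=
  kC U v W a b + (nC ^ 2 * xC U + 2 * pi0C U v) * hC a b

lemma sum_hProj (a : Fin 4) (f : Fin 4 → ℂ) : ∑ c, hProj a c * f c = if a ≠ 0 then f a else 0 := by
  simp [hProj, ite_and]

lemma sum_hProj₂ (a b : Fin 4) (f : Fin 4 → Fin 4 → ℂ) :
    ∑ c, ∑ d, hProj a c * hProj b d * f c d = if a ≠ 0 ∧ b ≠ 0 then f a b else 0 := by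
  simp only [mul_assoc, ← Finset.mul_sum, sum_hProj]
  split_ifs <;> simp_all

section Data

variable {γ : Fin 4 → Fin 4 → Pt → ℂ} {U v W : Sm M}

lemma rep_qData (h : ∀ a b, Rep (γ a b) (gamC U v W a b)) (a b : Fin 4) :
    Rep (qData γ a b) (qC U v W a b) := fun x => by
  unfold qData qC
  rw [sum_hProj₂, h a b x]
  split_ifs <;> simp

lemma rep_hMet (a b : Fin 4) : Rep (hMet M a b) (hC a b : Sm M) := fun x => by
  unfold hMet hC
  rw [sum_hProj₂ a b (fun c d => g M c d x), rep_g a b x]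
  split_ifs <;> simp

lemma rep_shift (h : ∀ a b, Rep (γ a b) (gamC U v W a b)) (a : Fin 4) :
    Rep (shift γ a) ((![0, (1 / 2 : ℂ) • U, -v, -(v * em 3)] : Fin 4 → Sm M) a) := fun x => by
  unfold shift
  rw [sum_hProj a (fun c => γ c 0 x), h a 0 x]
  fin_cases a <;> simp [gamC]

set_option maxHeartbeats 1000000 in
lemma rep_kData (h : ∀ a b, Rep (γ a b) (gamC U v W a b)) (a b : Fin 4) :
    Rep (kData M γ a b) ((1 / 2 : ℂ) • (niC * kC U v W a b)) := fun x => by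
  have h1 := nv_ne x; have h2 := rv_ne x; have h3 := sv_ne x
  unfold kData spatialCov1
  simp only [sum_hProj₂, rep_cov1 (rep_shift h) _ _ x, (rep_qData h a b).pd 0 x]
  rw [lapse_eq]
  fin_cases a <;> fin_cases b <;>
  simp [qC, gamC, kC, Cov1, Fin.sum_univ_four, chrC, k1C, k2C, xC, pi0C, omC, ed, ed', dm, dmb] <;>
  field_simp <;> ring_nf <;> (try simp only [Complex.I_sq, Complex.I_pow_three]) <;> (try ring_nf)

lemma rep_tr_kData (h : ∀ a b, Rep (γ a b) (gamC U v W a b)) :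
    Rep (tr M (kData M γ)) (-((1 / 2 : ℂ) • (niC * (nC ^ 2 * xC U + 2 * pi0C U v)))) := fun x => by
  have h1 := nv_ne x; have h2 := rv_ne x; have h3 := sv_ne x
  rw [rep_tr (rep_kData h) x]
  simp [Fin.sum_univ_four, giC, kC, omC]
  field_simp
  ring_nf
  simp only [Complex.I_sq]
  ring

lemma rep_pData (h : ∀ a b, Rep (γ a b) (gamC U v W a b)) (a b : Fin 4) :
    Rep (pData M γ a b) ((1 / 2 : ℂ) • (niC * pC U v W a b)) := fun x => by
  unfold pData
  rw [rep_kData h a b x, rep_tr_kData h x, rep_hMet a b x]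
  simp [pC]; ring

lemma cj_chrC (a b c : Fin 4) : cj (chrC a b c) = (chrC a b c : Sm M) := by
  fin_cases a <;> fin_cases b <;> fin_cases c <;> simp [chrC]

lemma cj_giC (a b : Fin 4) : cj (giC a b) = (giC a b : Sm M) := by
  unfold giC; split_ifs
  · fin_cases a <;> simp
  · simp

lemma cj_hC (a b : Fin 4) : cj (hC a b) = (hC a b : Sm M) := by
  unfold hC gC; split_ifs
  · fin_cases a <;> simp
  all_goals simp

lemma rep_qData_conj (h : ∀ a b, Rep (γ a b) (gamC U v W a b)) (a b : Fin 4) :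
    Rep (qData (conjT γ) a b) (cj (qC U v W a b)) := fun x => by
  unfold qData qC conjT
  rw [sum_hProj₂ a b fun c d => starRingEnd ℂ (γ c d x), h a b x]
  split_ifs <;> simp

lemma rep_kData_conj (h : ∀ a b, Rep (γ a b) (gamC U v W a b)) (a b : Fin 4) :
    Rep (kData M (conjT γ) a b) (cj ((1 / 2 : ℂ) • (niC * kC U v W a b))) := fun x => by
  have hs : ∀ a, Rep (shift (conjT γ) a)
      (cj ((![0, (1 / 2 : ℂ) • U, -v, -(v * em 3)] : Fin 4 → Sm M) a)) := fun a x => by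
    rw [ev_cj, ← rep_shift h a x]
    unfold shift conjT
    rw [sum_hProj a (fun c => starRingEnd ℂ (γ c 0 x)), sum_hProj a (fun c => γ c 0 x)]
    split_ifs <;> simp
  have hc : ∀ w : Fin 4 → Sm M, ∀ a b,
      Cov1 D chrC (fun c => cj (w c)) a b = cj (Cov1 D chrC w a b) := fun w a b => by
    simp [Cov1, cj_chrC]
  rw [ev_cj, ← rep_kData h a b x]
  unfold kData spatialCov1
  simp only [sum_hProj₂, rep_cov1 (rep_shift h) _ _ x, (rep_qData h a b).pd 0 x,
    rep_cov1 hs _ _ x, hc, (rep_qData_conj h a b).pd 0 x, D_cj, ev_cj]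
  split_ifs <;> simp

lemma rep_pData_conj (h : ∀ a b, Rep (γ a b) (gamC U v W a b)) (a b : Fin 4) :
    Rep (pData M (conjT γ) a b) (cj ((1 / 2 : ℂ) • (niC * pC U v W a b))) := fun x => by
  unfold pData
  rw [rep_kData_conj h a b x, rep_tr (rep_kData_conj h) x, rep_hMet a b x,
    ← cj_hC, ev_cj, ev_cj, ev_cj, ← rep_pData h a b x]
  unfold pData
  rw [rep_kData h a b x, rep_tr (rep_kData h) x, rep_hMet a b x, map_sub, map_mul]
  simp only [← ev_cj, map_sum, map_mul, cj_giC]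

lemma rep_lieT (h : ∀ a b, Rep (γ a b) (gamC U v W a b)) (a b : Fin 4) :
    Rep (lieT γ a b) (gamC (D 0 U) (D 0 v) (D 0 W) a b) := by
  refine ((h a b).pd 0).of_eq ?_
  fin_cases a <;> fin_cases b <;> simp [gamC] <;> ring

/-- `2 N` times the density of the canonical energy. -/
def canQ (U v W : Sm M) : Sm M :=
  cj (pi0C U v) * D 0 U - cj U * pi0C (D 0 U) (D 0 v)
    + 4 * riC ^ 2 * (cj (k1C U v) * D 0 v - cj v * k1C (D 0 U) (D 0 v))
    - 2 * riC ^ 2 * (cj (k2C v W) * D 0 W - cj W * k2C (D 0 v) (D 0 W))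

/-- Since `m_a m^a = 0`, `q_ab` has no trace on the spheres, so the tangential trace of `p_ab` drops
out. In `p_rr` the component `xC` cancels against its own trace correction, leaving `-2 N⁻² pi0C`.
The part of `k_ab` along `m̄` is orthogonal, after conjugation, to the `m` in `q_ab`. Only `pi0C`,
`k1C` and `k2C` are left. -/
lemma contract_pC_qC (U v W U' v' W' : Sm M) :
    ∑ a, ∑ b, giC a a * giC b b * cj (pC U v W a b) * qC U' v' W' a b =
      cj (pi0C U v) * U' + 4 * riC ^ 2 * cj (k1C U v) * v' - 2 * riC ^ 2 * cj (k2C v W) * W' := by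
  refine Sm.ext_ev fun x => ?_
  have h1 := nv_ne x; have h2 := rv_ne x; have h3 := sv_ne x
  simp [Fin.sum_univ_four, giC, pC, qC, kC, hC, gC, omC, gamC]
  field_simp
  ring_nf
  simp only [Complex.I_sq, Complex.I_pow_four]
  ring

lemma rep_canonicalDensity (h : ∀ a b, Rep (γ a b) (gamC U v W a b)) :
    Rep (canonicalDensity M γ) ((1 / 2 : ℂ) • (niC * canQ U v W)) := fun x => by
  have e1 := congrArg (ev x) (contract_pC_qC U v W (D 0 U) (D 0 v) (D 0 W))
  have e2 := congrArg (fun z => ev x (cj z)) (contract_pC_qC (D 0 U) (D 0 v) (D 0 W) U v W)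
  unfold canonicalDensity symplecticDensity
  simp only [contract2_eq, rep_pData_conj h _ _ x, rep_qData (rep_lieT h) _ _ x,
    rep_qData_conj h _ _ x, rep_pData (rep_lieT h) _ _ x, rep_gInv _ _ x]
  simp only [map_sum, map_mul, map_add, map_sub, map_smul, cj_smul, cj_cj, cj_giC, smul_eq_mul,
    cj_niC, cj_riC, map_pow, map_ofNat] at e1 e2 ⊢
  have e3 : ∀ a b, ev x (giC a a : Sm M) * ev x (giC b b : Sm M) *
      (starRingEnd ℂ (1 / 2) * (ev x (niC : Sm M) * ev x (cj (pC U v W a b)))) *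
        ev x (qC (D 0 U) (D 0 v) (D 0 W) a b) = (1 / 2 * ev x (niC : Sm M)) *
      (ev x (giC a a : Sm M) * ev x (giC b b : Sm M) * ev x (cj (pC U v W a b)) *
        ev x (qC (D 0 U) (D 0 v) (D 0 W) a b)) := fun a b => by
    simp; ring
  have e4 : ∀ a b, ev x (giC a a : Sm M) * ev x (giC b b : Sm M) * ev x (cj (qC U v W a b)) *
      (1 / 2 * (ev x (niC : Sm M) * ev x (pC (D 0 U) (D 0 v) (D 0 W) a b))) =
        (1 / 2 * ev x (niC : Sm M)) *
      (ev x (giC a a : Sm M) * ev x (giC b b : Sm M) * ev x (pC (D 0 U) (D 0 v) (D 0 W) a b) *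
        ev x (cj (qC U v W a b))) := fun a b => by
    ring
  simp only [e3, e4, ← Finset.mul_sum, e1, e2, canQ, map_add, map_sub, map_mul, map_pow, map_ofNat]
  ring

end Data

/-! ### Decay classes -/

/-- `r N ∂_r`. -/
def th : Derivation ℂ (Sm M) (Sm M) := (rC * nC : Sm M) • D 1

@[simp] lemma th_rC : th (rC : Sm M) = nC * rC := by simp [th]; ring
@[simp] lemma th_riC : th (riC : Sm M) = -(nC * riC) := by
  simp [th]; linear_combination (nC * riC) * rC_mul_riC (M := M)
@[simp] lemma th_nC : th (nC : Sm M) = (1 / 2 : ℂ) • (1 - nC * nC) := Sm.ext_ev fun x => by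
  have h1 := rv_ne x; have h2 := nv_ne x
  simp [th]; field_simp
@[simp] lemma th_cj (a : Sm M) : th (cj a) = cj (th a) := by simp [th]

lemma th_ed (s : ℤ) (a : Sm M) : th (ed s a) = ed s (th a) := by
  simp [th, ed, dm, D_comm 2 1, D_comm 3 1]
  refine Sm.ext_ev fun x => ?_
  simp; ring

lemma th_ed' (s : ℤ) (a : Sm M) : th (ed' s a) = ed' s (th a) := by
  simp [th, ed', dmb, D_comm 2 1, D_comm 3 1]
  refine Sm.ext_ev fun x => ?_
  simp; ring

lemma ed_mul (s t : ℤ) (a b : Sm M) : ed (s + t) (a * b) = ed s a * b + a * ed t b := by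
  simp [ed, Algebra.smul_def]; ring

lemma ed'_mul (s t : ℤ) (a b : Sm M) : ed' (s + t) (a * b) = ed' s a * b + a * ed' t b := by
  simp [ed', Algebra.smul_def]; ring

def Bnd (k : ℝ) (a : Sm M) : Prop :=
  ∃ C : ℝ, ∀ x : exterior M, x.1 0 = 0 → ‖ev x a‖ ≤ C * x.1 1 ^ k

/-- On `Σ`, all derivatives `r N ∂_r`, `ð`, `ð'` of order at most `n` of the scalar `a` of spin
weight `s` are `O(r^k)`. -/
def DecN (n : ℕ) : ℤ → ℝ → Sm M → Prop :=
  n.rec (fun _ k a => Bnd k a)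
    fun _ P s k a => Bnd k a ∧ P s k (th a) ∧ P (s + 1) k (ed s a) ∧ P (s - 1) k (ed' s a)

lemma DecN.mk {n : ℕ} {s : ℤ} {k : ℝ} {a : Sm M} (h : Bnd k a) (h₁ : DecN n s k (th a))
    (h₂ : DecN n (s + 1) k (ed s a)) (h₃ : DecN n (s - 1) k (ed' s a)) : DecN (n + 1) s k a :=
  ⟨h, h₁, h₂, h₃⟩

lemma DecN.pred {n : ℕ} : ∀ {s : ℤ} {k : ℝ} {a : Sm M}, DecN (n + 1) s k a → DecN n s k a := by
  induction n with
  | zero => exact fun h => h.1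
  | succ n ih => exact fun h => ⟨h.1, ih h.2.1, ih h.2.2.1, ih h.2.2.2⟩

lemma DecN.bound {n : ℕ} {s : ℤ} {k : ℝ} {a : Sm M} (h : DecN n s k a) : Bnd k a := by
  cases n with
  | zero => exact h
  | succ n => exact h.1

lemma Bnd.nonneg {k : ℝ} {a : Sm M} (h : Bnd k a) :
    ∃ C : ℝ, 0 ≤ C ∧ ∀ x : exterior M, x.1 0 = 0 → ‖ev x a‖ ≤ C * x.1 1 ^ k := by
  obtain ⟨C, hC⟩ := h
  exact ⟨max C 0, le_max_right _ _, fun x hx => (hC x hx).trans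
    (mul_le_mul_of_nonneg_right (le_max_left _ _) (Real.rpow_nonneg (r_pos x.2).le _))⟩

lemma DecN.add {n : ℕ} : ∀ {s : ℤ} {k : ℝ} {a b : Sm M}, DecN n s k a → DecN n s k b →
    DecN n s k (a + b) := by
  induction n with
  | zero =>
    rintro s k a b ⟨C, hC⟩ ⟨C', hC'⟩
    refine ⟨C + C', fun x hx => ?_⟩
    rw [map_add, add_mul]
    exact (norm_add_le _ _).trans (add_le_add (hC x hx) (hC' x hx))
  | succ n ih =>
    intro s k a b h h'
    refine DecN.mk ?_ ?_ ?_ ?_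
    · obtain ⟨⟨C, hC⟩, -⟩ := h
      obtain ⟨⟨C', hC'⟩, -⟩ := h'
      refine ⟨C + C', fun x hx => ?_⟩
      rw [map_add, add_mul]
      exact (norm_add_le _ _).trans (add_le_add (hC x hx) (hC' x hx))
    · rw [map_add]; exact ih h.2.1 h'.2.1
    · rw [ed_add]; exact ih h.2.2.1 h'.2.2.1
    · rw [ed'_add]; exact ih h.2.2.2 h'.2.2.2

lemma DecN.smul {n : ℕ} (c : ℂ) : ∀ {s : ℤ} {k : ℝ} {a : Sm M}, DecN n s k a →
    DecN n s k (c • a) := by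
  have h0 : ∀ {k : ℝ} {a : Sm M}, Bnd k a → Bnd k (c • a) := by
    rintro k a ⟨C, hC⟩
    refine ⟨‖c‖ * C, fun x hx => ?_⟩
    rw [map_smul, norm_smul, mul_assoc]
    exact mul_le_mul_of_nonneg_left (hC x hx) (norm_nonneg _)
  induction n with
  | zero => exact h0
  | succ n ih =>
    intro s k a h
    refine DecN.mk (h0 h.1) ?_ ?_ ?_
    · rw [Derivation.map_smul]; exact ih h.2.1
    · rw [ed_smul]; exact ih h.2.2.1
    · rw [ed'_smul]; exact ih h.2.2.2

lemma DecN.mul {n : ℕ} : ∀ {s t : ℤ} {k l : ℝ} {a b : Sm M}, DecN n s k a → DecN n t l b →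
    DecN n (s + t) (k + l) (a * b) := by
  have h0 : ∀ {k l : ℝ} {a b : Sm M}, Bnd k a → Bnd l b → Bnd (k + l) (a * b) := by
    intro k l a b h h'
    obtain ⟨C, h1, hC⟩ := h.nonneg
    obtain ⟨C', -, hC'⟩ := h'.nonneg
    refine ⟨C * C', fun x hx => ?_⟩
    have hr := r_pos x.2
    rw [map_mul, norm_mul, Real.rpow_add hr, mul_mul_mul_comm]
    exact mul_le_mul (hC x hx) (hC' x hx) (norm_nonneg _)
      (mul_nonneg h1 (Real.rpow_nonneg hr.le _))
  induction n with
  | zero => exact h0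
  | succ n ih =>
    intro s t k l a b h h'
    refine DecN.mk (h0 h.1 h'.1) ?_ ?_ ?_
    · rw [Derivation.leibniz, smul_eq_mul, smul_eq_mul, mul_comm b]
      exact (ih h.pred h'.2.1).add (ih h.2.1 h'.pred)
    · rw [ed_mul]
      refine DecN.add ?_ ?_
      · convert ih h.2.2.1 h'.pred using 1; ring
      · convert ih h.pred h'.2.2.1 using 1; ring
    · rw [ed'_mul]
      refine DecN.add ?_ ?_
      · convert ih h.2.2.2 h'.pred using 1; ring
      · convert ih h.pred h'.2.2.2 using 1; ring

lemma DecN.cj {n : ℕ} : ∀ {s t : ℤ} {k : ℝ} {a : Sm M}, DecN n s k a → t = -s →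
    DecN n t k (cj a) := by
  have h0 : ∀ {k : ℝ} {a : Sm M}, Bnd k a → Bnd k (SchwarzschildHertz.cj a) := by
    rintro k a ⟨C, hC⟩
    exact ⟨C, fun x hx => by simpa using hC x hx⟩
  induction n with
  | zero => exact fun h _ => h0 h
  | succ n ih =>
    rintro s t k a h rfl
    refine DecN.mk (h0 h.1) ?_ ?_ ?_
    · rw [th_cj]; exact ih h.2.1 rfl
    · rw [ed_cj, neg_neg]; exact ih h.2.2.2 (by ring)
    · rw [ed'_cj, neg_neg]; exact ih h.2.2.1 (by ring)

/-- On the exterior `r` is bounded below by `2M > 0`, so a larger exponent is a weaker condition up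
to a constant. -/
lemma DecN.mono {n : ℕ} : ∀ {s : ℤ} {k l : ℝ} {a : Sm M}, DecN n s k a → k ≤ l →
    DecN n s l a := by
  have h0 : ∀ {k l : ℝ} {a : Sm M}, Bnd k a → k ≤ l → Bnd l a := by
    intro k l a h hkl
    obtain ⟨C, h1, hC⟩ := h.nonneg
    have hm : 0 < 2 * M := by have := hM.out; positivity
    refine ⟨C * (2 * M) ^ (k - l), fun x hx => (hC x hx).trans ?_⟩
    have hr : 2 * M < x.1 1 := x.2.1
    rw [mul_assoc]
    refine mul_le_mul_of_nonneg_left ?_ h1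
    calc x.1 1 ^ k = x.1 1 ^ (k - l) * x.1 1 ^ l := by
          rw [← Real.rpow_add (hm.trans hr)]; ring_nf
      _ ≤ _ := mul_le_mul_of_nonneg_right
          (Real.rpow_le_rpow_of_nonpos hm hr.le (by linarith))
          (Real.rpow_nonneg (hm.trans hr).le _)
  induction n with
  | zero => exact h0
  | succ n ih => exact fun h hkl =>
      ⟨h0 h.1 hkl, ih h.2.1 hkl, ih h.2.2.1 hkl, ih h.2.2.2 hkl⟩

lemma DecN.zero {n : ℕ} : ∀ {s : ℤ} {k : ℝ}, DecN n s k (0 : Sm M) := by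
  have h0 : ∀ {k : ℝ}, Bnd k (0 : Sm M) := fun {k} => ⟨0, fun x _ => by simp⟩
  induction n with
  | zero => exact h0
  | succ n ih => exact fun {s k} => ⟨h0, by rw [map_zero]; exact ih, by rw [ed_zero]; exact ih,
      by rw [ed'_zero]; exact ih⟩

/-- All derivatives `r N ∂_r`, `ð`, `ð'` of the scalar `a` of spin weight `s` are `O(r^k)` on
`Σ`. -/
def Dec (s : ℤ) (k : ℝ) (a : Sm M) : Prop := ∀ n, DecN n s k a

namespace Dec

variable {s t : ℤ} {k l : ℝ} {a b : Sm M}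

lemma add (h : Dec s k a) (h' : Dec s k b) : Dec s k (a + b) := fun n => (h n).add (h' n)
lemma smul (c : ℂ) (h : Dec s k a) : Dec s k (c • a) := fun n => (h n).smul c
lemma neg (h : Dec s k a) : Dec s k (-a) := by simpa using h.smul (-1)
lemma sub (h : Dec s k a) (h' : Dec s k b) : Dec s k (a - b) := by
  simpa [sub_eq_add_neg] using h.add h'.neg
lemma mul (h : Dec s k a) (h' : Dec t l b) : Dec (s + t) (k + l) (a * b) :=
  fun n => (h n).mul (h' n)
lemma cj (h : Dec s k a) : Dec (-s) k (cj a) := fun n => (h n).cj rfl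
lemma th (h : Dec s k a) : Dec s k (th a) := fun n => (h (n + 1)).2.1
lemma ed (h : Dec s k a) : Dec (s + 1) k (ed s a) := fun n => (h (n + 1)).2.2.1
lemma ed' (h : Dec s k a) : Dec (s - 1) k (ed' s a) := fun n => (h (n + 1)).2.2.2

lemma of_eq (h : Dec s k a) (hs : s = t) (hk : k = l) : Dec t l a := by subst hs hk; exact h

lemma one : Dec 0 0 (1 : Sm M) := by
  have h0 : Bnd 0 (1 : Sm M) := ⟨1, fun x _ => by simp⟩
  rintro (_ | n)
  · exact h0
  · refine DecN.mk h0 ?_ ?_ ?_ <;> simp [SchwarzschildHertz.ed, SchwarzschildHertz.ed', DecN.zero]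

/-- Because `r N ∂_r N = (1 - N²) / 2` is again a polynomial in `N`, all its iterates stay bounded
up to the horizon. This is why `th` is the radial derivative of the calculus. The inverse `N⁻¹` is
unbounded there and must cancel before decay is invoked. -/
lemma nC : Dec 0 0 (nC : Sm M) := by
  have h0 : Bnd 0 (SchwarzschildHertz.nC : Sm M) := ⟨1, fun x _ => by
    have h := one_sub_pos x.2
    have hm := hM.out
    have hr := r_pos x.2
    simp only [ev_nC, nv, Complex.norm_real, Real.norm_eq_abs, Real.rpow_zero, mul_one]
    rw [abs_of_nonneg (Real.sqrt_nonneg _)]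
    have : 0 < 2 * M / x.1 1 := by positivity
    exact Real.sqrt_le_one.2 (by linarith)⟩
  intro n
  induction n with
  | zero => exact h0
  | succ n ih =>
    refine DecN.mk h0 ?_ ?_ ?_
    · rw [th_nC]
      have h := (ih.mul ih).smul (-1)
      simp only [add_zero] at h
      have := ((one (M := M) n).add h).smul (1 / 2)
      simpa [sub_eq_add_neg] using this
    · simp [SchwarzschildHertz.ed, DecN.zero]
    · simp [SchwarzschildHertz.ed', DecN.zero]

lemma riC : Dec 0 (-1) (riC : Sm M) := by
  have h0 : Bnd (-1) (SchwarzschildHertz.riC : Sm M) := ⟨1, fun x _ => by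
    have hr := r_pos x.2
    simp only [ev_riC, rv, norm_inv, Complex.norm_real, Real.norm_eq_abs, abs_of_pos hr,
      Real.rpow_neg_one, one_mul, le_refl]⟩
  intro n
  induction n with
  | zero => exact h0
  | succ n ih =>
    refine DecN.mk h0 ?_ ?_ ?_
    · rw [th_riC]
      simpa using ((nC n).mul ih).smul (-1)
    · simp [SchwarzschildHertz.ed, DecN.zero]
    · simp [SchwarzschildHertz.ed', DecN.zero]

lemma rC : Dec 0 1 (rC : Sm M) := by
  have h0 : Bnd 1 (SchwarzschildHertz.rC : Sm M) := ⟨1, fun x _ => by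
    have hr := r_pos x.2
    simp only [ev_rC, rv, Complex.norm_real, Real.norm_eq_abs, abs_of_pos hr,
      Real.rpow_one, one_mul, le_refl]⟩
  intro n
  induction n with
  | zero => exact h0
  | succ n ih =>
    refine DecN.mk h0 ?_ ?_ ?_
    · rw [th_rC]
      simpa using (nC n).mul ih
    · simp [SchwarzschildHertz.ed, DecN.zero]
    · simp [SchwarzschildHertz.ed', DecN.zero]

lemma nC_mul (h : Dec s k a) : Dec s k (SchwarzschildHertz.nC * a) := by
  simpa using nC.mul h

lemma riC_mul (h : Dec s k a) : Dec s (k - 1) (SchwarzschildHertz.riC * a) :=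
  (riC.mul h).of_eq (by ring) (by ring)

end Dec

/-- Each Carter-frame derivative costs one power of `r`; `th`, `ed` and `ed'` are these derivatives
multiplied by `r` up to a constant, so they preserve the exponent. -/
lemma SpatialBound.decN {n : ℕ} : ∀ {p q s : ℤ} {k : ℝ} {F : Pt → ℂ} {a : Sm M}, Rep F a →
    p - q = 2 * s → SpatialBound M p q k F → DecN n s k a := by
  have h0 : ∀ {p q : ℤ} {k : ℝ} {F : Pt → ℂ} {a : Sm M}, Rep F a →
      SpatialBound M p q k F → Bnd k a := by
    intro p q k F a h hb
    obtain ⟨C, hC⟩ := hb []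
    refine ⟨C, fun x hx => ?_⟩
    rw [← h x]
    simpa [spatialDers] using hC x x.2 hx
  have hc : ∀ {p q p' q' : ℤ} {k : ℝ} {F F' : Pt → ℂ}, SpatialBound M p q k F → ∀ d : SpatialDer,
      (∀ w, spatialDers M p q (d :: w) F = spatialDers M p' q' w F') →
      SpatialBound M p' q' (k - 1) F' := by
    intro p q p' q' k F F' hb d hd w
    obtain ⟨C, hC⟩ := hb (d :: w)
    refine ⟨C, fun x hx h => ?_⟩
    have := hC x hx h
    rw [hd] at this
    convert this using 3
    push_cast [List.length_cons]; ring
  have hk := k2_ne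
  induction n with
  | zero => exact fun h _ hb => h0 h hb
  | succ n ih =>
    intro p q s k F a h hs hb
    refine DecN.mk (h0 h hb) ?_ ?_ ?_
    · have h1 := ih (rep_Dr h) hs (hc hb .rad fun _ => rfl)
      have h2 := ((Dec.rC n).mul h1).smul (2 * k2)⁻¹
      have e : th a = (2 * k2)⁻¹ • (rC * (2 * k2) • (nC * D 1 a)) := Sm.ext_ev fun x => by
        simp [th]; field_simp
      rw [e]; convert h2 using 1 <;> ring
    · have h1 := ih (s := s + 1) (rep_eth h hs) (by linarith) (hc hb .eth fun _ => rfl)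
      have h2 := ((Dec.rC n).mul h1).smul k2⁻¹
      have e : ed s a = k2⁻¹ • (rC * k2 • (riC * ed s a)) := Sm.ext_ev fun x => by
        have := rv_ne x
        simp; field_simp
      rw [e]; convert h2 using 1 <;> ring
    · have h1 := ih (s := s - 1) (rep_eth' h hs) (by linarith) (hc hb .eth' fun _ => rfl)
      have h2 := ((Dec.rC n).mul h1).smul k2⁻¹
      have e : ed' s a = k2⁻¹ • (rC * k2 • (riC * ed' s a)) := Sm.ext_ev fun x => by
        have := rv_ne x
        simp; field_simp
      rw [e]; convert h2 using 1 <;> ring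

/-- The decay of `ψ` and of `r g`, where `g = √2 (þ + 3ρ) ψ`. -/
lemma HertzData.dec {F : Pt → ℂ} {ψ : Sm M} (h : Rep F ψ) (hd : HertzData M F) :
    ∃ k : ℝ, k < 3 / 2 ∧ Dec (-2) k ψ ∧ Dec (-2) k (rC * gOf ψ) := by
  obtain ⟨ε, h0, h1, hψ, hη⟩ := hd
  refine ⟨1 / 2 + ε, by linarith, fun n => hψ.decN h (by norm_num), fun n => ?_⟩
  have h2 := (hη.decN (n := n) (s := -2) (rep_etaOf h) (by norm_num)).smul k2⁻¹
  rw [smul_smul, inv_mul_cancel₀ k2_ne, one_smul] at h2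
  have h3 := (Dec.rC n).mul h2
  -- Multiplication by `r` makes the second datum `O(r^(1/2 - ε))`, and the weaker exponent of `ψ`
  -- suffices for both. It lies below `3/2` because `ε < 1`.
  refine DecN.mono ?_ (show 1 + -(1 / 2 + ε) ≤ 1 / 2 + ε by linarith)
  convert h3 using 1; norm_num

/-! ### Integrals over `Σ` -/

open MeasureTheory Filter Topology Set

section Fubini

variable {H : ℝ × ℝ × ℝ → ℂ}

lemma sigma_restrict (M : ℝ) : (volume : Measure (ℝ × ℝ × ℝ)).restrict (sigmaDom M) =
    ((volume : Measure ℝ).restrict (Ioi (2 * M))).prod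
      (((volume : Measure ℝ).restrict (Ioo 0 Real.pi)).prod
        ((volume : Measure ℝ).restrict (Ioo 0 (2 * Real.pi)))) := by
  rw [Measure.prod_restrict, Measure.prod_restrict]; rfl

/-- Fubini with the radial integral innermost. Integrability along the line may be assumed in `h0`,
since it holds for almost every line. The two lemmas that follow do the same for the other
coordinates. -/
lemma integral_eq_zero_of_radial (h : IntegrableOn H (sigmaDom M))
    (h0 : ∀ t ∈ Ioo 0 Real.pi, ∀ p ∈ Ioo 0 (2 * Real.pi),
      IntegrableOn (fun r => H (r, t, p)) (Ioi (2 * M)) → ∫ r in Ioi (2 * M), H (r, t, p) = 0) :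
    ∫ y in sigmaDom M, H y = 0 := by
  unfold IntegrableOn at h
  rw [sigma_restrict] at h ⊢
  rw [integral_prod_symm _ h]
  refine integral_eq_zero_of_ae ?_
  have hm : ∀ᵐ z ∂((volume : Measure ℝ).restrict (Ioo 0 Real.pi)).prod
      ((volume : Measure ℝ).restrict (Ioo 0 (2 * Real.pi))),
      z ∈ Ioo 0 Real.pi ×ˢ Ioo 0 (2 * Real.pi) := by
    rw [Measure.prod_restrict]
    exact ae_restrict_mem (measurableSet_Ioo.prod measurableSet_Ioo)
  filter_upwards [h.prod_left_ae, hm] with z hz hz'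
  exact h0 z.1 hz'.1 z.2 hz'.2 hz

lemma integral_eq_zero_of_polar (h : IntegrableOn H (sigmaDom M))
    (h0 : ∀ r ∈ Ioi (2 * M), ∀ p ∈ Ioo 0 (2 * Real.pi),
      IntegrableOn (fun t => H (r, t, p)) (Ioo 0 Real.pi) → ∫ t in Ioo 0 Real.pi, H (r, t, p) = 0) :
    ∫ y in sigmaDom M, H y = 0 := by
  unfold IntegrableOn at h
  rw [sigma_restrict] at h ⊢
  rw [integral_prod _ h]
  refine integral_eq_zero_of_ae ?_
  filter_upwards [h.prod_right_ae, ae_restrict_mem measurableSet_Ioi] with r hr hr'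
  rw [integral_prod_symm _ hr]
  refine integral_eq_zero_of_ae ?_
  filter_upwards [hr.prod_left_ae, ae_restrict_mem measurableSet_Ioo] with p hp hp'
  exact h0 r hr' p hp' hp

lemma integral_eq_zero_of_azimuthal (h : IntegrableOn H (sigmaDom M))
    (h0 : ∀ r ∈ Ioi (2 * M), ∀ t ∈ Ioo 0 Real.pi,
      IntegrableOn (fun p => H (r, t, p)) (Ioo 0 (2 * Real.pi)) →
        ∫ p in Ioo 0 (2 * Real.pi), H (r, t, p) = 0) :
    ∫ y in sigmaDom M, H y = 0 := by
  unfold IntegrableOn at h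
  rw [sigma_restrict] at h ⊢
  rw [integral_prod _ h]
  refine integral_eq_zero_of_ae ?_
  filter_upwards [h.prod_right_ae, ae_restrict_mem measurableSet_Ioi] with r hr hr'
  rw [integral_prod _ hr]
  refine integral_eq_zero_of_ae ?_
  filter_upwards [hr.prod_right_ae, ae_restrict_mem measurableSet_Ioo] with t ht ht'
  exact h0 r hr' t ht' ht

end Fubini

lemma sigmaPt_mem {y : ℝ × ℝ × ℝ} (hy : y ∈ sigmaDom M) : sigmaPt y ∈ exterior M :=
  ⟨hy.1, hy.2.1.1, hy.2.1.2⟩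

lemma sigmaPt_mem' {r t p : ℝ} (hr : 2 * M < r) (ht : t ∈ Ioo 0 Real.pi) :
    sigmaPt (r, t, p) ∈ exterior M := ⟨hr, ht.1, ht.2⟩

lemma measurableSet_sigmaDom (M : ℝ) : MeasurableSet (sigmaDom M) :=
  measurableSet_Ioi.prod (measurableSet_Ioo.prod measurableSet_Ioo)

lemma continuous_sigmaPt : Continuous sigmaPt := by
  refine continuous_pi fun i => ?_
  fin_cases i <;> simp [sigmaPt] <;> fun_prop

/-- The restriction to `Σ`. -/
def onS (a : Sm M) (y : ℝ × ℝ × ℝ) : ℂ := a.fn (sigmaPt y)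

lemma onS_eq (a : Sm M) {y : ℝ × ℝ × ℝ} (hy : sigmaPt y ∈ exterior M) :
    onS a y = ev ⟨sigmaPt y, hy⟩ a := a.fn_eq ⟨_, hy⟩

lemma continuousOn_onS (a : Sm M) : ContinuousOn (onS a) (sigmaDom M) :=
  a.smooth.continuousOn.comp continuous_sigmaPt.continuousOn fun _ hy => sigmaPt_mem hy

lemma hasDerivAt_pd (a : Sm M) (i : Fin 4) {c : ℝ → Pt} {s : ℝ} (hx : c s ∈ exterior M)
    (hc : HasDerivAt c (Pi.single i 1) s) :
    HasDerivAt (fun s => a.fn (c s)) ((D i a).fn (c s)) s := by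
  have := (a.differentiableAt hx).hasFDerivAt.comp_hasDerivAt s hc
  rwa [show (D i a).fn (c s) = _ from (D i a).fn_eq ⟨_, hx⟩]

lemma hasDerivAt_radial (a : Sm M) {r t p : ℝ} (hx : sigmaPt (r, t, p) ∈ exterior M) :
    HasDerivAt (fun r => onS a (r, t, p)) (onS (D 1 a) (r, t, p)) r := by
  refine hasDerivAt_pd a 1 (c := fun r => sigmaPt (r, t, p)) hx ?_
  refine hasDerivAt_pi.2 fun i => ?_
  fin_cases i
  · exact hasDerivAt_const _ _
  · exact hasDerivAt_id' _
  · exact hasDerivAt_const _ _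
  · exact hasDerivAt_const _ _

lemma hasDerivAt_polar (a : Sm M) {r t p : ℝ} (hx : sigmaPt (r, t, p) ∈ exterior M) :
    HasDerivAt (fun t => onS a (r, t, p)) (onS (D 2 a) (r, t, p)) t := by
  refine hasDerivAt_pd a 2 (c := fun t => sigmaPt (r, t, p)) hx ?_
  refine hasDerivAt_pi.2 fun i => ?_
  fin_cases i
  · exact hasDerivAt_const _ _
  · exact hasDerivAt_const _ _
  · exact hasDerivAt_id' _
  · exact hasDerivAt_const _ _

lemma hasDerivAt_azimuthal (a : Sm M) {r t p : ℝ} (hx : sigmaPt (r, t, p) ∈ exterior M) :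
    HasDerivAt (fun p => onS a (r, t, p)) (onS (D 3 a) (r, t, p)) p := by
  refine hasDerivAt_pd a 3 (c := fun p => sigmaPt (r, t, p)) hx ?_
  refine hasDerivAt_pi.2 fun i => ?_
  fin_cases i
  · exact hasDerivAt_const _ _
  · exact hasDerivAt_const _ _
  · exact hasDerivAt_const _ _
  · exact hasDerivAt_id' _

/-! ### The three integrations by parts -/

/-- The bound contains `N`, which vanishes at `r = 2M`, and `r^k`, which vanishes at infinity, so
neither end contributes to the fundamental theorem of calculus. -/
lemma integral_radial {b : Sm M} {C k : ℝ} (hk : k < 0)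
    (hb : ∀ x : exterior M, x.1 0 = 0 → ‖ev x b‖ ≤ C * (x.1 1 ^ k * Real.sqrt (1 - 2 * M / x.1 1)))
    (h : IntegrableOn (onS (D 1 b)) (sigmaDom M)) : ∫ y in sigmaDom M, onS (D 1 b) y = 0 := by
  have hm := hM.out
  refine integral_eq_zero_of_radial h fun t ht p hp hi => ?_
  have hbd : ∀ r ∈ Ioi (2 * M), ‖onS b (r, t, p)‖ ≤ C * (r ^ k * Real.sqrt (1 - 2 * M / r)) :=
    fun r hr => by
      rw [onS_eq b (sigmaPt_mem' hr ht)]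
      exact hb ⟨_, sigmaPt_mem' hr ht⟩ rfl
  -- The point `r = 2M` is outside the exterior, where the extension by zero applies. This value
  -- agrees with the limit from outside, so the radial profile is continuous up to the endpoint.
  have h0 : onS b (2 * M, t, p) = 0 := by
    unfold onS Sm.fn ext0
    rw [dif_neg]
    exact fun h => lt_irrefl _ h.1
  rw [integral_Ioi_of_hasDerivAt_of_tendsto (f := fun r => onS b (r, t, p)) (m := 0) ?_
    (fun r hr => hasDerivAt_radial b (sigmaPt_mem' hr ht)) hi ?_, h0, sub_zero]
  · rw [← continuousWithinAt_Ioi_iff_Ici, ContinuousWithinAt, h0]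
    refine squeeze_zero_norm' (a := fun r => C * (r ^ k * Real.sqrt (1 - 2 * M / r)))
      (eventually_mem_nhdsWithin.mono hbd) ?_
    have hc : ContinuousAt (fun r : ℝ => C * (r ^ k * Real.sqrt (1 - 2 * M / r))) (2 * M) := by
      have h2 : 2 * M ≠ 0 := by positivity
      refine continuousAt_const.mul ((Real.continuousAt_rpow_const _ _ (Or.inl h2)).mul
        (ContinuousAt.sqrt (continuousAt_const.sub (continuousAt_const.div continuousAt_id h2))))
    have := hc.tendsto
    rw [div_self (by positivity), sub_self, Real.sqrt_zero, mul_zero, mul_zero] at this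
    exact this.mono_left nhdsWithin_le_nhds
  · refine squeeze_zero_norm' (a := fun r => |C| * r ^ k) ?_ ?_
    · filter_upwards [eventually_gt_atTop (2 * M)] with r hr
      refine (hbd r hr).trans ?_
      have hr0 : 0 < r := by linarith
      have h1 : Real.sqrt (1 - 2 * M / r) ≤ 1 := Real.sqrt_le_one.2 (by
        have : 0 < 2 * M / r := by positivity
        linarith)
      have h2 := Real.rpow_nonneg hr0.le k
      refine mul_le_mul (le_abs_self _) (mul_le_of_le_one_right h2 h1) (by positivity)
        (abs_nonneg _)
    · have := (tendsto_rpow_neg_atTop (neg_pos.2 hk)).const_mul |C|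
      simpa using this

/-- The factor `sin θ` makes `b` vanish at both poles; its coefficient may depend on `r`
arbitrarily, since `r` is fixed in the inner integral. -/
lemma integral_polar {b : Sm M} {c : ℝ → ℝ}
    (hb : ∀ x : exterior M, x.1 0 = 0 → ‖ev x b‖ ≤ c (x.1 1) * Real.sin (x.1 2))
    (h : IntegrableOn (onS (D 2 b)) (sigmaDom M)) : ∫ y in sigmaDom M, onS (D 2 b) y = 0 := by
  refine integral_eq_zero_of_polar h fun r hr p hp hi => ?_
  have hbd : ∀ t ∈ Ioo 0 Real.pi, ‖onS b (r, t, p)‖ ≤ c r * Real.sin t := fun t ht => by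
    rw [onS_eq b (sigmaPt_mem' hr ht)]
    exact hb ⟨_, sigmaPt_mem' hr ht⟩ rfl
  have hc : Continuous fun t : ℝ => c r * Real.sin t := by fun_prop
  rw [← integral_Ioc_eq_integral_Ioo, ← intervalIntegral.integral_of_le Real.pi_pos.le,
    intervalIntegral.integral_eq_sub_of_hasDerivAt_of_tendsto (f := fun t => onS b (r, t, p))
    (fa := 0) (fb := 0) Real.pi_pos (fun t ht => hasDerivAt_polar b (sigmaPt_mem' hr ht))
    ((intervalIntegrable_iff_integrableOn_Ioo_of_le Real.pi_pos.le (by simp) (by simp)).2 hi)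
    ?_ ?_, sub_zero]
  · refine squeeze_zero_norm' (a := fun t => c r * Real.sin t) ?_ ?_
    · filter_upwards [Ioo_mem_nhdsGT Real.pi_pos] with t ht using hbd t ht
    · simpa using (hc.tendsto 0).mono_left nhdsWithin_le_nhds
  · refine squeeze_zero_norm' (a := fun t => c r * Real.sin t) ?_ ?_
    · filter_upwards [Ioo_mem_nhdsLT Real.pi_pos] with t ht using hbd t ht
    · simpa using (hc.tendsto Real.pi).mono_left nhdsWithin_le_nhds

lemma integral_azimuthal {b : Sm M}
    (h : IntegrableOn (onS (D 3 b)) (sigmaDom M)) : ∫ y in sigmaDom M, onS (D 3 b) y = 0 := by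
  refine integral_eq_zero_of_azimuthal h fun r hr t ht hi => ?_
  have h2 : 0 < 2 * Real.pi := by positivity
  rw [← integral_Ioc_eq_integral_Ioo, ← intervalIntegral.integral_of_le h2.le,
    intervalIntegral.integral_eq_sub_of_hasDerivAt (f := fun p => onS b (r, t, p))
    (fun p _ => hasDerivAt_azimuthal b (sigmaPt_mem' hr ht))
    ((intervalIntegrable_iff_integrableOn_Ioo_of_le h2.le (by simp) (by simp)).2 hi), sub_eq_zero]
  -- A full turn carries the endpoint `φ = 0` to `φ = 2π`, so the two boundary values coincide.
  have := b.periodic (sigmaPt_mem' (M := M) (p := 0) hr ht)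
  unfold onS
  rw [← this]
  congr 1
  ext i
  fin_cases i <;> simp [sigmaPt, turn]

/-! ### Integrability -/

/-- The singularity `N⁻¹` at the horizon is integrable because `N⁻¹ = N + 2 r N'`, with `N' = (1 -
N²) / (2 r N)` the nonnegative derivative of the bounded function `N`. At infinity the condition `k
+ 2 < -1` suffices. -/
lemma integrable_weight {k : ℝ} (hk : k < -3) :
    IntegrableOn (fun r : ℝ => r ^ k * (r ^ 2 * (Real.sqrt (1 - 2 * M / r))⁻¹)) (Ioi (2 * M)) := by
  have hm := hM.out
  have h2 : 0 < 2 * M := by positivity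
  have e : ∀ r ∈ Ioi (2 * M), ∃ x : exterior M, x.1 1 = r := fun r hr =>
    ⟨⟨sigmaPt (r, 1, 0), sigmaPt_mem' hr ⟨one_pos, by linarith [Real.pi_gt_three]⟩⟩, rfl⟩
  have hd : IntegrableOn (fun r : ℝ => (1 - (Real.sqrt (1 - 2 * M / r)) ^ 2) /
      (2 * r * Real.sqrt (1 - 2 * M / r))) (Ioi (2 * M)) := by
    refine integrableOn_Ioi_deriv_of_nonneg (g := fun r => Real.sqrt (1 - 2 * M / r)) (l := 1)
      ?_ ?_ ?_ ?_
    · refine ContinuousAt.continuousWithinAt (ContinuousAt.sqrt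
        (continuousAt_const.sub (continuousAt_const.div continuousAt_id h2.ne')))
    · intro r hr
      obtain ⟨x, rfl⟩ := e r hr
      exact hasDerivAt_N x
    · intro r hr
      obtain ⟨x, rfl⟩ := e r hr
      have h3 := r_pos x.2
      rw [Real.sq_sqrt (one_sub_pos x.2).le]
      have : 0 < 2 * M / x.1 1 := by positivity
      exact div_nonneg (by linarith) (by positivity)
    · have h4 : Tendsto (fun r : ℝ => 1 - 2 * M / r) atTop (𝓝 (1 - 0)) :=
        tendsto_const_nhds.sub (tendsto_const_nhds.div_atTop tendsto_id)
      have := (Real.continuous_sqrt.tendsto _).comp h4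
      simpa [Function.comp_def] using this
  have hp := (integrableOn_Ioi_rpow_of_lt (show k + 2 < -1 by linarith) h2).add
    (hd.const_mul (2 * (2 * M) ^ (k + 3)))
  refine hp.mono' ?_ ?_
  · refine ContinuousOn.aestronglyMeasurable (fun r hr => ?_) measurableSet_Ioi
    obtain ⟨x, rfl⟩ := e r hr
    have h3 := (r_pos x.2).ne'
    exact ((Real.continuousAt_rpow_const _ _ (Or.inl h3)).mul ((continuousAt_id.pow 2).mul
      ((ContinuousAt.sqrt (continuousAt_const.sub
        (continuousAt_const.div continuousAt_id h3))).inv₀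
          (sqrt_pos x.2).ne'))).continuousWithinAt
  · filter_upwards [ae_restrict_mem measurableSet_Ioi] with r hr
    obtain ⟨x, rfl⟩ := e r hr
    have h3 := r_pos x.2
    have h4 := sqrt_pos x.2
    have h5 := Real.sq_sqrt (one_sub_pos x.2).le
    set n := Real.sqrt (1 - 2 * M / x.1 1)
    set r := x.1 1
    have hr2 : r ^ (k + 2) = r ^ k * r ^ 2 := by
      rw [Real.rpow_add h3]; norm_num
    have hr3 : r ^ (k + 3) = r ^ (k + 2) * r := by
      rw [show k + 3 = k + 2 + 1 by ring, Real.rpow_add h3, Real.rpow_one]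
    have hn1 : 0 ≤ 1 - n ^ 2 := by
      rw [h5]; have : 0 < 2 * M / r := by positivity
      linarith
    have h6 : r ^ (k + 3) ≤ (2 * M) ^ (k + 3) :=
      Real.rpow_le_rpow_of_nonpos h2 (le_of_lt hr) (by linarith)
    have h7 : 0 ≤ r ^ (k + 2) := Real.rpow_nonneg h3.le _
    have h8 : n ≤ 1 := by nlinarith
    have h9 : 0 ≤ (1 - n ^ 2) / (2 * r * n) := div_nonneg hn1 (by positivity)
    rw [Real.norm_of_nonneg (by positivity)]
    -- The splitting of `N⁻¹` into a bounded part and a multiple of `N'`; as `k + 3 < 0`, the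
    -- coefficient of `N'` is largest at `r = 2M`.
    calc r ^ k * (r ^ 2 * n⁻¹) = r ^ (k + 2) * n + 2 * r ^ (k + 3) * ((1 - n ^ 2) / (2 * r * n)) := by
          rw [hr3, hr2]; field_simp; ring
      _ ≤ r ^ (k + 2) + 2 * (2 * M) ^ (k + 3) * ((1 - n ^ 2) / (2 * r * n)) := by
          refine add_le_add (mul_le_of_le_one_right h7 h8) ?_
          exact mul_le_mul_of_nonneg_right (by linarith) h9

lemma integrableOn_onS {a : Sm M} {C k : ℝ} (hk : k < -3)
    (h : ∀ x : exterior M, x.1 0 = 0 →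
      ‖ev x a‖ ≤ C * (x.1 1 ^ k * (x.1 1 ^ 2 * (Real.sqrt (1 - 2 * M / x.1 1))⁻¹))) :
    IntegrableOn (onS a) (sigmaDom M) := by
  have hw := (integrable_weight (M := M) hk).const_mul C
  have hw' : IntegrableOn (fun y : ℝ × ℝ × ℝ =>
      C * (y.1 ^ k * (y.1 ^ 2 * (Real.sqrt (1 - 2 * M / y.1))⁻¹))) (sigmaDom M) := by
    unfold IntegrableOn
    rw [sigma_restrict]
    exact hw.comp_fst _
  refine hw'.mono' ((continuousOn_onS a).aestronglyMeasurable (measurableSet_sigmaDom M)) ?_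
  filter_upwards [ae_restrict_mem (measurableSet_sigmaDom M)] with y hy
  rw [onS_eq a (sigmaPt_mem hy)]
  exact h ⟨_, sigmaPt_mem hy⟩ rfl

/-- The density of the volume element of `Σ`. -/
def volC : Sm M := rC ^ 2 * niC * snC

lemma sigmaVol_eq (x : exterior M) : (sigmaVol M x : ℂ) = ev x (volC : Sm M) := by
  have h1 := nv_ne x; have h2 := rv_ne x
  unfold sigmaVol
  push_cast
  rw [sqrtDel_eq, x1_eq]
  simp [volC]
  field_simp
  simp [sv]

section Rep

variable {F : Pt → ℂ} {a : Sm M}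

lemma Rep.eqOn (h : Rep F a) : EqOn (fun y => F (sigmaPt y) * (sigmaVol M (sigmaPt y) : ℂ))
    (onS (volC * a)) (sigmaDom M) := fun y hy => by
  have e := sigmaPt_mem hy
  simp only []
  rw [onS_eq _ e, map_mul, ← sigmaVol_eq, ← h ⟨_, e⟩, mul_comm]

lemma Rep.sigmaInt (h : Rep F a) :
    sigmaInt M F = ∫ y in sigmaDom M, onS (volC * a) y :=
  setIntegral_congr_fun (measurableSet_sigmaDom M) h.eqOn

lemma Rep.sigmaIntegrable (h : Rep F a) (hi : IntegrableOn (onS (volC * a)) (sigmaDom M)) :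
    SigmaIntegrable M F :=
  hi.congr_fun h.eqOn.symm (measurableSet_sigmaDom M)

end Rep

lemma Dec.integrable {a : Sm M} {k : ℝ} {s : ℤ} (h : Dec s k a) (hk : k < -3) :
    IntegrableOn (onS (volC * a)) (sigmaDom M) := by
  obtain ⟨C, hC, hb⟩ := (h 0).bound.nonneg
  refine integrableOn_onS (C := C) hk fun x hx => ?_
  have h1 := r_pos x.2
  have h2 := sqrt_pos x.2
  have h3 : ‖ev x (volC : Sm M)‖ ≤ x.1 1 ^ 2 * (Real.sqrt (1 - 2 * M / x.1 1))⁻¹ := by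
    simp only [volC, map_mul, map_pow, ev_rC, ev_niC, ev_snC, rv, nv, sv, norm_mul, norm_pow,
      norm_inv, Complex.norm_real, Real.norm_eq_abs, abs_of_pos h1, abs_of_pos h2]
    exact mul_le_of_le_one_right (by positivity) (Real.abs_sin_le_one _)
  rw [map_mul, norm_mul, mul_comm, ← mul_assoc]
  exact mul_le_mul (hb x hx) h3 (norm_nonneg _) (mul_nonneg hC (Real.rpow_nonneg h1.le _))

/-- The density `a` is integrable over `Σ`, with vanishing integral. -/
def Nul (a : Sm M) : Prop :=
  IntegrableOn (onS (volC * a)) (sigmaDom M) ∧ ∫ y in sigmaDom M, onS (volC * a) y = 0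

lemma onS_add (a b : Sm M) : EqOn (onS (a + b)) (onS a + onS b) (sigmaDom M) := fun y hy => by
  simp only [Pi.add_apply, onS_eq _ (sigmaPt_mem hy), map_add]

lemma onS_smul (c : ℂ) (a : Sm M) : EqOn (onS (c • a)) (c • onS a) (sigmaDom M) := fun y hy => by
  simp only [Pi.smul_apply, onS_eq _ (sigmaPt_mem hy), map_smul]

lemma onS_cj (a : Sm M) : EqOn (onS (cj a)) (fun y => starRingEnd ℂ (onS a y)) (sigmaDom M) :=
  fun y hy => by
  simp only [onS_eq _ (sigmaPt_mem hy), ev_cj]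

lemma cj_volC : cj (volC : Sm M) = volC := by simp [volC]

namespace Nul

variable {a b : Sm M}

lemma add (h : Nul a) (h' : Nul b) : Nul (a + b) := by
  have e := onS_add (volC * a) (volC * b)
  rw [← mul_add] at e
  refine ⟨(h.1.add h'.1).congr_fun e.symm (measurableSet_sigmaDom M), ?_⟩
  rw [setIntegral_congr_fun (measurableSet_sigmaDom M) e]
  simp only [Pi.add_apply]
  rw [integral_add h.1 h'.1, h.2, h'.2, add_zero]

lemma smul (c : ℂ) (h : Nul a) : Nul (c • a) := by
  have e := onS_smul c (volC * a)
  rw [← mul_smul_comm] at e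
  refine ⟨IntegrableOn.congr_fun (h.1.smul c) e.symm (measurableSet_sigmaDom M), ?_⟩
  rw [setIntegral_congr_fun (measurableSet_sigmaDom M) e]
  simp only [Pi.smul_apply]
  rw [integral_smul, h.2, smul_zero]

lemma neg (h : Nul a) : Nul (-a) := by simpa using h.smul (-1)

lemma sub (h : Nul a) (h' : Nul b) : Nul (a - b) := by
  simpa [sub_eq_add_neg] using h.add h'.neg

lemma cj (h : Nul a) : Nul (cj a) := by
  have e := onS_cj (volC * a)
  rw [map_mul, cj_volC] at e
  refine ⟨IntegrableOn.congr_fun (f := fun y => starRingEnd ℂ (onS (volC * a) y)) ?_ e.symm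
    (measurableSet_sigmaDom M), ?_⟩
  · exact Complex.conjLIE.toContinuousLinearEquiv.toContinuousLinearMap.integrable_comp h.1
  · rw [setIntegral_congr_fun (measurableSet_sigmaDom M) e, integral_conj, h.2, map_zero]

end Nul

/-- The volume density turns `r⁻³ th` into `sin θ ∂_r`, so this density is the exact derivative of
`sin θ N b`. The factor `N` kills the contribution of the horizon. -/
lemma nul_radial {b : Sm M} {k : ℝ} (h : Dec 0 k b) (hk : k < 0) :
    Nul (riC ^ 3 * th (nC * b)) := by
  have hd : Dec 0 (k - 3) (riC ^ 3 * th (nC * b)) := by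
    have := h.nC_mul.th.riC_mul.riC_mul.riC_mul
    rw [show riC ^ 3 * th (nC * b) = riC * (riC * (riC * th (nC * b))) by ring]
    exact this.of_eq rfl (by ring)
  have hi := hd.integrable (by linarith)
  have e : volC * (riC ^ 3 * th (nC * b)) = D 1 (snC * (nC * b)) := Sm.ext_ev fun x => by
    have h1 := rv_ne x; have h2 := nv_ne x
    simp [volC, th]; field_simp
  refine ⟨hi, ?_⟩
  rw [e] at hi ⊢
  obtain ⟨C, hC, hb⟩ := (h 0).bound.nonneg
  refine integral_radial (C := C) hk (fun x hx => ?_) hi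
  have h1 := r_pos x.2
  have h2 := sqrt_pos x.2
  rw [map_mul, map_mul, norm_mul, norm_mul]
  simp only [ev_snC, ev_nC, sv, nv, Complex.norm_real, Real.norm_eq_abs, abs_of_pos h2]
  refine (mul_le_of_le_one_left (by positivity) (Real.abs_sin_le_one _)).trans ?_
  rw [mul_comm, ← mul_assoc]
  exact mul_le_mul_of_nonneg_right (hb x hx) h2.le

/-- The divergence theorem on the spheres: on spin weight `1`, `ð'` times the area density is a `θ`
derivative plus a `φ` derivative. The two pieces must be shown integrable separately before Fubini
applies to each. -/
lemma nul_ed' {y : Sm M} {k : ℝ} (h : Dec 1 k y) (hk : k < -3) : Nul (ed' 1 y) := by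
  have h1 : Dec 0 k (ed' 1 y) := h.ed'
  obtain ⟨C, hC, hb⟩ := (h 0).bound.nonneg
  obtain ⟨C₁, hC₁, hb₁⟩ := (h1 0).bound.nonneg
  obtain ⟨C₂, hC₂, hb₂⟩ := (h.ed 0).bound.nonneg
  have hi := h1.integrable hk
  have e : volC * ed' 1 y = D 2 (volC * y) - Complex.I • D 3 (rC ^ 2 * niC * y) :=
    Sm.ext_ev fun x => by
    have h3 := sv_ne x
    simp [volC, ed', dmb]
    field_simp
    ring
  -- The hypotheses bound only `y`, `ð y` and `ð' y`. The `φ` derivative is recovered from them, and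
  -- the singular `cot θ` becomes `cos θ` after multiplication by the `sin θ` in the volume density.
  have e3 : D 3 (rC ^ 2 * niC * y) = (-(Complex.I / 2)) • (volC * (ed 1 y - ed' 1 y + 2 * ctC * y)) :=
    Sm.ext_ev fun x => by
    have h3 := sv_ne x
    simp [volC, ed, ed', dm, dmb]
    field_simp
    ring_nf
    simp
  have hi3 : IntegrableOn (onS (D 3 (rC ^ 2 * niC * y))) (sigmaDom M) := by
    refine integrableOn_onS (C := (C₁ + C₂) / 2 + C) hk fun x hx => ?_
    have h1 := r_pos x.2
    have h2 := sqrt_pos x.2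
    have h3 := sin_pos x.2
    have hn : ‖ev x (snC * (ed 1 y - ed' 1 y + 2 * ctC * y))‖ ≤ 2 * ((C₁ + C₂) / 2 + C) * x.1 1 ^ k := by
      have : ev x (snC * (ed 1 y - ed' 1 y + 2 * ctC * y)) =
          sv x * (ev x (ed 1 y) - ev x (ed' 1 y)) + 2 * cv x * ev x y := by
        have h3 := sv_ne x
        simp; field_simp
      rw [this]
      have hs : ‖sv x‖ ≤ 1 := by
        rw [sv, Complex.norm_real]; exact Real.abs_sin_le_one _
      have hc : ‖cv x‖ ≤ 1 := by
        rw [cv, Complex.norm_real]; exact Real.abs_cos_le_one _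
      calc _ ≤ ‖sv x‖ * (‖ev x (ed 1 y)‖ + ‖ev x (ed' 1 y)‖) + 2 * ‖cv x‖ * ‖ev x y‖ := by
            refine (norm_add_le _ _).trans (add_le_add ?_ ?_)
            · rw [norm_mul]
              exact mul_le_mul_of_nonneg_left (norm_sub_le _ _) (norm_nonneg _)
            · rw [norm_mul, norm_mul]; simp
        _ ≤ 1 * (C₂ * x.1 1 ^ k + C₁ * x.1 1 ^ k) + 2 * 1 * (C * x.1 1 ^ k) := by
            gcongr
            · exact hb₂ x hx
            · exact hb₁ x hx
            · exact hb x hx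
        _ = _ := by ring
    have e4 : ev x (D 3 (rC ^ 2 * niC * y)) = (-(Complex.I / 2)) * (rv x ^ 2 * (nv x)⁻¹) *
        ev x (snC * (ed 1 y - ed' 1 y + 2 * ctC * y)) := by
      rw [e3, volC]; simp only [map_smul, map_mul, smul_eq_mul, map_pow, ev_rC, ev_niC]; ring
    rw [e4, norm_mul, norm_mul, norm_mul]
    simp only [norm_neg, norm_div, Complex.norm_I, norm_pow, norm_inv, rv, nv, Complex.norm_real,
      Real.norm_eq_abs, abs_of_pos h1, abs_of_pos h2, Complex.norm_ofNat]
    calc _ ≤ 1 / 2 * (x.1 1 ^ 2 * (Real.sqrt (1 - 2 * M / x.1 1))⁻¹) *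
          (2 * ((C₁ + C₂) / 2 + C) * x.1 1 ^ k) :=
          mul_le_mul_of_nonneg_left hn (by positivity)
      _ = _ := by ring
  have hi2 : IntegrableOn (onS (D 2 (volC * y))) (sigmaDom M) := by
    refine (hi.add (hi3.smul Complex.I)).congr_fun (fun z hz => ?_) (measurableSet_sigmaDom M)
    simp only [Pi.add_apply, Pi.smul_apply, onS_eq _ (sigmaPt_mem hz), e, map_sub, map_smul]
    abel
  refine ⟨hi, ?_⟩
  have hz2 := integral_polar (c := fun r => r ^ 2 * (Real.sqrt (1 - 2 * M / r))⁻¹ * (C * r ^ k))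
    (fun x hx => ?_) hi2
  · have hz3 := integral_azimuthal hi3
    have hi3' : Integrable (fun z => Complex.I • onS (D 3 (rC ^ 2 * niC * y)) z)
        (volume.restrict (sigmaDom M)) := Integrable.smul Complex.I hi3
    rw [setIntegral_congr_fun (measurableSet_sigmaDom M) (g := fun z =>
      onS (D 2 (volC * y)) z - Complex.I • onS (D 3 (rC ^ 2 * niC * y)) z) fun z hz => by
        simp only [onS_eq _ (sigmaPt_mem hz), e, map_sub, map_smul],
      integral_sub hi2 hi3', integral_smul, hz2, hz3]
    simp
  · have h1 := r_pos x.2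
    have h2 := sqrt_pos x.2
    have h3 := sin_pos x.2
    rw [volC]
    simp only [map_mul, map_pow, norm_mul, norm_pow, norm_inv, ev_rC, ev_niC, ev_snC, rv, nv, sv,
      Complex.norm_real, Real.norm_eq_abs, abs_of_pos h1, abs_of_pos h2, abs_of_pos h3]
    calc _ ≤ x.1 1 ^ 2 * (Real.sqrt (1 - 2 * M / x.1 1))⁻¹ * Real.sin (x.1 2) * (C * x.1 1 ^ k) :=
          mul_le_mul_of_nonneg_left (hb x hx) (by positivity)
      _ = _ := by ring

/-! ### Evolution of the data -/

/-- The spherical operator `-ð' ð` on scalars of spin weight `-2`. -/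
def an (a : Sm M) : Sm M := -ed' (-1) (ed (-2) a)

@[simp] lemma an_add (a b : Sm M) : an (a + b) = an a + an b := by simp [an]; ring
@[simp] lemma an_sub (a b : Sm M) : an (a - b) = an a - an b := by simp [an]; ring
@[simp] lemma an_neg (a : Sm M) : an (-a) = -an a := by simp [an]
@[simp] lemma an_smul (c : ℂ) (a : Sm M) : an (c • a) = c • an a := by simp [an]
lemma an_mul {z : Sm M} (h : dm z = 0) (h' : dmb z = 0) (a : Sm M) : an (z * a) = z * an a := by
  simp [an, ed_mul_left _ h, ed'_mul_left _ h']
@[simp] lemma an_nC_mul (a : Sm M) : an (nC * a) = nC * an a := an_mul (by simp) (by simp) a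
@[simp] lemma th_an (a : Sm M) : th (an a) = an (th a) := by simp [an, th_ed, th_ed']

/-- `r ∂_t`. -/
def dT : Derivation ℂ (Sm M) (Sm M) := (rC : Sm M) • D 0

@[simp] lemma dT_nC : dT (nC : Sm M) = 0 := by simp [dT]
@[simp] lemma dT_niC : dT (niC : Sm M) = 0 := by simp [dT]
@[simp] lemma th_niC : th (niC : Sm M) = -((1 / 2 : ℂ) • ((1 - nC ^ 2) * niC ^ 2)) :=
  Sm.ext_ev fun x => by
    have h1 := rv_ne x; have h2 := nv_ne x
    simp [th]; field_simp
@[simp] lemma dT_riC : dT (riC : Sm M) = 0 := by simp [dT]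
lemma dT_ed (s : ℤ) (a : Sm M) : dT (ed s a) = ed s (dT a) := by
  simp [dT, ed, dm, D_comm 2 0, D_comm 3 0]
  refine Sm.ext_ev fun x => ?_
  simp; ring
lemma dT_ed' (s : ℤ) (a : Sm M) : dT (ed' s a) = ed' s (dT a) := by
  simp [dT, ed', dmb, D_comm 2 0, D_comm 3 0]
  refine Sm.ext_ev fun x => ?_
  simp; ring
@[simp] lemma dT_an (a : Sm M) : dT (an a) = an (dT a) := by simp [an, dT_ed, dT_ed']
@[simp] lemma dT_th (a : Sm M) : dT (th a) = th (dT a) - nC * dT a := by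
  simp [dT, th, D_comm 1 0]; ring

lemma D0_eq (a : Sm M) : D 0 a = riC * dT a := by
  simp only [dT, Derivation.smul_apply, smul_eq_mul]
  linear_combination (-D 0 a) * rC_mul_riC (M := M)

lemma D1_eq (a : Sm M) : D 1 a = riC * niC * th a := by
  simp only [th, Derivation.smul_apply, smul_eq_mul]
  linear_combination (-D 1 a) * rC_mul_riC (M := M) - D 1 a * rC * riC * nC_mul_niC (M := M)

/-- `√2 r (þ + 3ρ) ψ`. -/
def GOf (ψ : Sm M) : Sm M := rC * gOf ψ

/-- This is the definition of `G` solved for the time derivative of `ψ`; it needs no field equation.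
-/
lemma dT_psi (ψ : Sm M) : dT ψ = nC * GOf ψ - nC * th ψ - (ψ - (4 : ℂ) • (nC * (nC * ψ))) := by
  refine Sm.ext_ev fun x => ?_
  have h1 := rv_ne x; have h2 := nv_ne x
  simp [dT, GOf, gOf, th, dL]; field_simp; ring

/-- The Teukolsky equation closes the first-order system: time derivatives of `ψ` and `G` are now
spatial derivatives with coefficients polynomial in `N`. -/
lemma dT_G {ψ : Sm M} (h : Teukolsky ψ) : dT (GOf ψ) = nC * th (GOf ψ)
    - (1 / 2 : ℂ) • (GOf ψ - nC * (nC * GOf ψ))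
    - nC * (an ψ + (3 : ℂ) • (ψ - nC * (nC * ψ))) := by
  have e : rC * niC ^ 2 * (dL ψ + (1 - 4 * nC ^ 2) * riC * ψ) = niC * GOf ψ := by
    simp only [GOf, gOf]; ring
  unfold Teukolsky at h
  rw [e] at h
  have h' : rC * dK (niC * GOf ψ) = -an ψ - 3 * (1 - nC ^ 2) * ψ := by rw [h, an]; ring
  refine Sm.ext_ev fun x => ?_
  have h1 := rv_ne x; have h2 := nv_ne x
  have h3 := congrArg (ev x) h'
  simp [dK, D0_eq, D1_eq] at h3 ⊢
  field_simp at h3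
  linear_combination (1 / 2) * h3

/-! ### The components of the Hertz metric -/

section Components

variable (ψ : Sm M)

/-- These are the metric components, momenta and Regge-Wheeler derivatives stripped of powers of
`r`, outer factors of `N` and outer operators `ð`: `uC`, `w0C`, `WC` belong to `U`, `v`, `W`; `p0C`,
`kapC`, `ktC` to `pi0C`, `k1C`, `k2C`; `PhiC` to the Regge-Wheeler scalar, with `tauC` and `sigC`
its time and radial derivatives. In the pairs `kap0C`, `kt0C`, `Phi0C`, `tau0C`, `sig0C` the zero
marks the part free of `an`, and `tau1C`, `sig1C` are the arguments of `an`. -/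
def w0C : Sm M := (1 / 4 : ℂ) • (GOf ψ + nC * ψ)
def WC : Sm M := th (GOf ψ) - (3 / 2 : ℂ) • (ψ - nC * (nC * ψ)) - an ((1 / 2 : ℂ) • ψ)
def uC : Sm M := (1 / 2 : ℂ) • ψ
def p0C : Sm M := (1 / 4 : ℂ) • (GOf ψ - nC * ψ)
def kap0C : Sm M :=
  (1 / 2 : ℂ) • (th (GOf ψ) - nC * GOf ψ) + (3 / 4 : ℂ) • (nC * (nC * ψ)) - (1 / 2 : ℂ) • ψ
def kapC : Sm M := kap0C ψ - an ((1 / 8 : ℂ) • ψ)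
def omegaC : Sm M :=
  th (th (GOf ψ)) - nC * th (GOf ψ) + (1 / 2 : ℂ) • (nC * (nC * GOf ψ)) - (1 / 2 : ℂ) • GOf ψ
    + (3 / 2 : ℂ) • (nC * ψ) + (3 / 2 : ℂ) • (nC * (nC * th ψ))
    - (3 / 2 : ℂ) • (nC * (nC * (nC * ψ))) - (3 / 2 : ℂ) • th ψ
    - (1 / 2 : ℂ) • an (nC * ψ + GOf ψ + th ψ)
def kt0C : Sm M :=
  (1 / 2 : ℂ) • (nC * th (GOf ψ)) - (3 / 4 : ℂ) • (nC * ψ) - (1 / 4 : ℂ) • (nC * (nC * GOf ψ))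
    - (3 / 4 : ℂ) • (nC * (nC * th ψ)) + (3 / 4 : ℂ) • (nC * (nC * (nC * ψ)))
    + (1 / 4 : ℂ) • GOf ψ - (1 / 2 : ℂ) • th (th (GOf ψ)) + (3 / 4 : ℂ) • th ψ
def ktC : Sm M := kt0C ψ + an ((1 / 4 : ℂ) • th ψ)
def Phi0C : Sm M := th (GOf ψ) - nC * GOf ψ - (3 / 2 : ℂ) • (ψ - nC * (nC * ψ))
def PhiC : Sm M := Phi0C ψ + an (-(1 / 2 : ℂ) • ψ)
def tau0C : Sm M :=
  th (th (GOf ψ)) - (2 : ℂ) • (nC * th (GOf ψ)) + (9 / 2 : ℂ) • (nC * ψ)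
    + (3 / 2 : ℂ) • (nC * (nC * th ψ)) - (9 / 2 : ℂ) • (nC * (nC * (nC * ψ)))
    - (3 / 2 : ℂ) • th ψ
def tau1C : Sm M := (1 / 2 : ℂ) • (nC * ψ - GOf ψ - th ψ)
def tauC : Sm M := tau0C ψ + an (tau1C ψ)
def sig0C : Sm M :=
  th (th (GOf ψ)) - (2 : ℂ) • (nC * th (GOf ψ)) + (3 : ℂ) • (nC * ψ)
    + (3 / 2 : ℂ) • (nC * (nC * GOf ψ)) + (3 / 2 : ℂ) • (nC * (nC * th ψ))
    - (3 : ℂ) • (nC * (nC * (nC * ψ))) - (1 / 2 : ℂ) • GOf ψ - (3 / 2 : ℂ) • th ψ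
def sig1C : Sm M := (1 / 2 : ℂ) • (nC * ψ - th ψ)
def sigC : Sm M := sig0C ψ + an (sig1C ψ)

variable {ψ}

lemma dT_WC (h : Teukolsky ψ) : dT (WC ψ) = nC * omegaC ψ := by
  refine Sm.ext_ev fun x => ?_
  simp [WC, omegaC, dT_psi ψ, dT_G h]
  ring

lemma dT_PhiC (h : Teukolsky ψ) : dT (PhiC ψ) = nC * tauC ψ := by
  refine Sm.ext_ev fun x => ?_
  simp [PhiC, Phi0C, tauC, tau0C, tau1C, dT_psi ψ, dT_G h]
  ring

lemma th_PhiC : th (PhiC ψ) - nC * PhiC ψ = sigC ψ := by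
  refine Sm.ext_ev fun x => ?_
  simp [PhiC, Phi0C, sigC, sig0C, sig1C]
  ring

lemma ktC_eq : ktC ψ = -((1 / 2 : ℂ) • omegaC ψ) - an (w0C ψ) := by
  refine Sm.ext_ev fun x => ?_
  simp [ktC, kt0C, omegaC, w0C]
  ring

/-- The factor `N⁻¹` is only apparent: the evolution equations make `dT w + w / 2`, for `w = w0C ψ`,
divisible by `N`. This is the regularity of the momentum at the bifurcation sphere. -/
lemma kapC_eq (h : Teukolsky ψ) : kapC ψ = niC * dT (w0C ψ) + th (w0C ψ)
    + (1 / 2 : ℂ) • (niC * w0C ψ) - (7 / 2 : ℂ) • (nC * w0C ψ)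
    + (1 / 4 : ℂ) • (an (uC ψ) + (2 : ℂ) • uC ψ) := by
  refine Sm.ext_ev fun x => ?_
  have h2 := nv_ne x
  simp [kapC, kap0C, w0C, uC, dT_psi ψ, dT_G h]
  field_simp
  ring

variable {F : Pt → ℂ}

lemma rep_hertzU (hF : Rep F ψ) :
    Rep (hertzU F) (riC ^ 2 * ed (-1) (ed (-2) (uC ψ))) := fun x => by
  unfold hertzU
  rw [rep_eth (rep_eth hF (s := -2) (by norm_num)) (s := -1) (by norm_num) x]
  simp [ed_mul_left, uC]
  linear_combination (rv x)⁻¹ ^ 2 * ev x (ed (-1) (ed (-2) ψ)) * k2_sq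

lemma rep_hertzV (hF : Rep F ψ) :
    Rep (hertzV M F) ((4 : ℂ) • (riC * niC * (nC * (riC * ed (-2) (w0C ψ))))) := fun x => by
  have h1 := rv_ne x; have h2 := nv_ne x
  unfold hertzV
  rw [rep_thorn (rep_eth hF (s := -2) (by norm_num)) _ _ x,
    rep_eth (rep_etaOf hF) (s := -2) (by norm_num) x]
  have e : dL ψ = nC * gOf ψ - (1 - 4 * nC ^ 2) * riC * ψ := by
    simp only [gOf]
    linear_combination (-(dL ψ + (1 - 4 * nC ^ 2) * riC * ψ)) * nC_mul_niC (M := M)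
  rw [Derivation.map_smul, Derivation.leibniz, dL_ed, e]
  simp [ed_mul_left, w0C, GOf]
  field_simp
  simp only [k2_sq]
  ring

lemma rep_hertzW (hF : Rep F ψ) (h : Teukolsky ψ) :
    Rep (hertzW M F) (riC ^ 2 * WC ψ) := fun x => by
  have h1 := rv_ne x; have h2 := nv_ne x
  have e : gOf ψ = riC * GOf ψ := by
    simp only [GOf]; linear_combination (-gOf ψ) * rC_mul_riC (M := M)
  unfold hertzW
  rw [rep_thorn (rep_etaOf hF) _ _ x, rep_etaOf hF x, show (rho M x : ℂ) = _ from rep_rho x, e]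
  simp [dL, D0_eq, D1_eq, dT_G h, WC]
  field_simp
  simp only [k2_sq]
  ring

lemma scalarOf_eq (h : Teukolsky ψ) : scalarOf (gOf ψ) = riC ^ 2 * PhiC ψ := by
  refine Sm.ext_ev fun x => ?_
  have h1 := rv_ne x; have h2 := nv_ne x
  have e : gOf ψ = riC * GOf ψ := by
    simp only [GOf]; linear_combination (-gOf ψ) * rC_mul_riC (M := M)
  rw [e]
  simp [scalarOf, dL, D0_eq, D1_eq, dT_G h, PhiC, Phi0C]
  field_simp
  ring

end Components

/-! ### The energy densities in terms of `ψ` and `r g` -/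

lemma D0_ed (s : ℤ) (a : Sm M) : D 0 (ed s a) = ed s (D 0 a) := by
  rw [D0_eq, D0_eq, dT_ed, ed_mul_left _ (by simp)]
lemma D0_ed' (s : ℤ) (a : Sm M) : D 0 (ed' s a) = ed' s (D 0 a) := by
  rw [D0_eq, D0_eq, dT_ed', ed'_mul_left _ (by simp)]

lemma pi0C_D0 (U v : Sm M) : pi0C (D 0 U) (D 0 v) = D 0 (pi0C U v) := by
  simp [pi0C, D0_ed]
lemma k1C_D0 (U v : Sm M) : k1C (D 0 U) (D 0 v) = D 0 (k1C U v) := by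
  simp [k1C, D0_ed', D_comm 1 0]
lemma k2C_D0 (v W : Sm M) : k2C (D 0 v) (D 0 W) = D 0 (k2C v W) := by
  simp [k2C, D0_ed']

section Components

variable {ψ : Sm M}

lemma pi0C_eq : pi0C (riC ^ 2 * ed (-1) (ed (-2) (uC ψ))) (nC * (riC * ed (-2) (w0C ψ))) =
    nC * (riC ^ 3 * ed (-1) (ed (-2) (p0C ψ))) := by
  refine Sm.ext_ev fun x => ?_
  simp [pi0C, ed_mul_left, uC, w0C, p0C]
  ring

lemma k1C_eq (h : Teukolsky ψ) :
    k1C (riC ^ 2 * ed (-1) (ed (-2) (uC ψ))) (nC * (riC * ed (-2) (w0C ψ))) =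
    riC ^ 2 * ed (-2) (kapC ψ) := by
  have e : ed' 0 (riC ^ 2 * ed (-1) (ed (-2) (uC ψ))) =
      -(riC ^ 2 * ed (-2) (an (uC ψ) + (2 : ℂ) • uC ψ)) := by
    rw [ed'_mul_left _ (by simp), ed'_ed (s := -1) (by norm_num)]
    refine Sm.ext_ev fun x => ?_
    simp [an]
    ring
  rw [kapC_eq h]
  unfold k1C
  rw [e]
  refine Sm.ext_ev fun x => ?_
  have h1 := rv_ne x; have h2 := nv_ne x
  simp only [D0_eq, D1_eq, Derivation.leibniz, smul_eq_mul, dT_nC, dT_riC, th_riC, th_nC, dT_ed, th_ed,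
    ed_add, ed_sub, ed_smul, ed_mul_left _ (show dm (nC : Sm M) = 0 by simp),
    ed_mul_left _ (show dm (niC : Sm M) = 0 by simp)]
  simp
  field_simp
  ring

lemma k2C_eq (h : Teukolsky ψ) : k2C (nC * (riC * ed (-2) (w0C ψ))) (riC ^ 2 * WC ψ) =
    nC * (riC * ktC ψ) := by
  rw [ktC_eq]
  have e : D 0 (riC ^ 2 * WC ψ) = nC * riC ^ 3 * omegaC ψ := by
    rw [D0_eq, Derivation.leibniz, dT_WC h]; simp; ring
  unfold k2C
  rw [e, ed'_mul_left _ (by simp), ed'_mul_left _ (by simp), an]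
  refine Sm.ext_ev fun x => ?_
  have h1 := rv_ne x
  simp
  field_simp
  ring

/-- Each group of terms of the symplectic density carries exactly one factor `N`, which cancels the
`N⁻¹` in front, and all powers of `r` collect into `r⁻⁶`. -/
lemma canQ_eq (h : Teukolsky ψ) :
    niC * canQ (riC ^ 2 * ed (-1) (ed (-2) (uC ψ))) (nC * (riC * ed (-2) (w0C ψ)))
      (riC ^ 2 * WC ψ) =
    riC ^ 6 * (cj (ed (-1) (ed (-2) (p0C ψ))) * ed (-1) (ed (-2) (dT (uC ψ)))
      - cj (ed (-1) (ed (-2) (uC ψ))) * ed (-1) (ed (-2) (dT (p0C ψ)))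
      + 4 * (cj (ed (-2) (kapC ψ)) * ed (-2) (dT (w0C ψ))
        - cj (ed (-2) (w0C ψ)) * ed (-2) (dT (kapC ψ)))
      - 2 * (nC * (cj (ktC ψ) * omegaC ψ) - cj (WC ψ) * dT (ktC ψ))) := by
  unfold canQ
  rw [pi0C_D0, k1C_D0, k2C_D0, pi0C_eq, k1C_eq h, k2C_eq h]
  simp only [D0_eq, Derivation.leibniz, smul_eq_mul, dT_nC, dT_riC, dT_ed, dT_WC h, map_mul, map_pow,
    cj_nC, cj_riC, Derivation.leibniz_pow, mul_zero, smul_zero, add_zero]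
  linear_combination (riC ^ 6 * (cj (ed (-1) (ed (-2) (p0C ψ))) * ed (-1) (ed (-2) (dT (uC ψ)))
      - cj (ed (-1) (ed (-2) (uC ψ))) * ed (-1) (ed (-2) (dT (p0C ψ)))
      + 4 * (cj (ed (-2) (kapC ψ)) * ed (-2) (dT (w0C ψ))
        - cj (ed (-2) (w0C ψ)) * ed (-2) (dT (kapC ψ)))
      - 2 * (nC * (cj (ktC ψ) * omegaC ψ) - cj (WC ψ) * dT (ktC ψ)))) * nC_mul_niC (M := M)

lemma dhrQ_eq (h : Teukolsky ψ) : dhrQ (riC ^ 2 * PhiC ψ) =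
    riC ^ 6 * (nC * (cj (tauC ψ) * tauC ψ + cj (sigC ψ) * sigC ψ
      + (1 / 2 : ℂ) • (cj (ed (-2) (PhiC ψ)) * ed (-2) (PhiC ψ)
        + cj (ed' (-2) (PhiC ψ)) * ed' (-2) (PhiC ψ))
      + (1 + 3 * nC ^ 2) * (cj (PhiC ψ) * PhiC ψ))) := by
  have e0 : D 0 (riC ^ 2 * PhiC ψ) = nC * riC ^ 3 * tauC ψ := by
    rw [D0_eq, Derivation.leibniz, dT_PhiC h]; simp; ring
  have e1 : D 1 (riC ^ 2 * PhiC ψ) + riC * (riC ^ 2 * PhiC ψ) = niC * riC ^ 3 * sigC ψ := by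
    rw [D1_eq, Derivation.leibniz, ← th_PhiC]
    refine Sm.ext_ev fun x => ?_
    have h2 := nv_ne x
    simp
    field_simp
    ring
  unfold dhrQ
  rw [e0, e1, ed_mul_left _ (by simp), ed'_mul_left _ (by simp)]
  refine Sm.ext_ev fun x => ?_
  have h2 := nv_ne x
  simp
  field_simp

/-- Powers of `N` are written as nested products so that `Dec.nC_mul` applies term by term in
`dec_bC`. -/
def bPC (ψ : Sm M) : Sm M :=
  -((3 / 2 : ℂ) • (nC * an (th (GOf ψ)))) + (21 / 4 : ℂ) • (nC * an ψ)
    + (3 / 4 : ℂ) • (nC * an (an ψ)) - (9 / 2 : ℂ) • (nC * th (GOf ψ)) + (9 : ℂ) • (nC * ψ)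
    + (1 / 2 : ℂ) • (nC * (nC * an (GOf ψ))) + (3 / 2 : ℂ) • (nC * (nC * an (th ψ)))
    + (3 / 2 : ℂ) • (nC * (nC * GOf ψ)) - (3 / 2 : ℂ) • (nC * (nC * th (th (GOf ψ))))
    + (9 / 2 : ℂ) • (nC * (nC * th ψ)) - (21 / 4 : ℂ) • (nC * (nC * (nC * an ψ)))
    + (9 / 2 : ℂ) • (nC * (nC * (nC * th (GOf ψ)))) - (18 : ℂ) • (nC * (nC * (nC * ψ)))
    - (3 / 2 : ℂ) • (nC * (nC * (nC * (nC * GOf ψ))))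
    - (9 / 4 : ℂ) • (nC * (nC * (nC * (nC * th ψ))))
    + (9 : ℂ) • (nC * (nC * (nC * (nC * (nC * ψ)))))
    + (1 / 2 : ℂ) • an (th (th (GOf ψ))) - (3 / 2 : ℂ) • an (th ψ)
    - (1 / 4 : ℂ) • an (an (th ψ)) + (3 / 2 : ℂ) • th (th (GOf ψ)) - (9 / 4 : ℂ) • th ψ

def bGC (ψ : Sm M) : Sm M :=
  (1 / 2 : ℂ) • (nC * an (GOf ψ)) + nC * (nC * an ψ) - nC * (nC * th (GOf ψ))
    + (3 / 2 : ℂ) • (nC * (nC * ψ)) + nC * (nC * (nC * GOf ψ))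
    - (3 / 2 : ℂ) • (nC * (nC * (nC * (nC * ψ))))

def bHC (ψ : Sm M) : Sm M :=
  -((3 / 2 : ℂ) • (nC * an ψ)) + (3 : ℂ) • (nC * th (GOf ψ)) - (6 : ℂ) • (nC * ψ)
    - nC * (nC * GOf ψ) - (3 / 2 : ℂ) • (nC * (nC * th ψ)) + (6 : ℂ) • (nC * (nC * (nC * ψ)))
    + (1 / 2 : ℂ) • an (th ψ) - th (th (GOf ψ)) + (3 / 2 : ℂ) • th ψ

/-- The radial flux between the two energies. -/
def bC (ψ : Sm M) : Sm M :=
  cj ψ * bPC ψ + cj (GOf ψ) * bGC ψ + cj (th (GOf ψ)) * bHC ψ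

set_option maxHeartbeats 8000000 in
set_option maxRecDepth 20000 in
/-- The two energy densities, with all angular derivatives moved to the second factor, differ by
a radial derivative. -/
lemma energy_identity (h : Teukolsky ψ) :
    cj (p0C ψ) * (an (an (dT (uC ψ))) + (2 : ℂ) • an (dT (uC ψ)))
      - cj (uC ψ) * (an (an (dT (p0C ψ))) + (2 : ℂ) • an (dT (p0C ψ)))
      + 4 * (cj (kap0C ψ) * an (dT (w0C ψ)) - cj ((1 / 8 : ℂ) • ψ) * an (an (dT (w0C ψ)))
        - cj (w0C ψ) * an (dT (kapC ψ)))
      - 2 * (nC * (cj (kt0C ψ) * omegaC ψ + cj ((1 / 4 : ℂ) • th ψ) * an (omegaC ψ))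
        - (cj (WC ψ + an ((1 / 2 : ℂ) • ψ)) * dT (ktC ψ)
          - cj ((1 / 2 : ℂ) • ψ) * an (dT (ktC ψ)))) =
    nC * (cj (tau0C ψ) * tauC ψ + cj (tau1C ψ) * an (tauC ψ)
      + cj (sig0C ψ) * sigC ψ + cj (sig1C ψ) * an (sigC ψ)
      + cj (Phi0C ψ) * (an (PhiC ψ) - PhiC ψ + (3 : ℂ) • (nC * (nC * PhiC ψ)))
      + cj (-(1 / 2 : ℂ) • ψ) * (an (an (PhiC ψ)) - an (PhiC ψ)
        + (3 : ℂ) • (nC * (nC * an (PhiC ψ)))))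
      + th (nC * bC ψ) - 3 * nC * nC * bC ψ := by
  have e : th (bC ψ) = cj (th ψ) * bPC ψ + cj ψ * th (bPC ψ) + (cj (th (GOf ψ)) * bGC ψ
      + cj (GOf ψ) * th (bGC ψ)) + (cj (th (th (GOf ψ))) * bHC ψ
      + cj (th (GOf ψ)) * th (bHC ψ)) := by
    simp only [bC, map_add, Derivation.leibniz, th_cj, smul_eq_mul]; ring
  -- These rules push `th` and `dT` inward to `ψ` and `G`, with `an` outside `th`. The values of
  -- these derivatives then serve as independent variables, and the identity is polynomial.
  have e₁ : ∀ a : Sm M, th (nC * a) = nC * th a + (1 / 2 : ℂ) • (a - nC * (nC * a)) := fun a =>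
    Sm.ext_ev fun x => by simp; ring
  have e₂ : ∀ a : Sm M, dT (nC * a) = nC * dT a := fun a => by simp
  rw [e₁, e]
  refine Sm.ext_ev fun x => ?_
  simp [-Derivation.leibniz, e₁, e₂, uC, p0C, kap0C, kapC, w0C, kt0C, omegaC, WC, ktC, tau0C,
    tau1C, tauC, sig0C, sig1C, sigC, Phi0C, PhiC, bC, bPC, bGC, bHC, dT_psi ψ, dT_G h]
  ring

end Components

/-! ### Integration by parts on the spheres -/

section Parts

variable {s : ℤ} {k l : ℝ} {x y : Sm M}

/-- The product of the conjugate of `x` with `y` has spin weight `1`, so `nul_ed'` applies to it;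
the Leibniz rule gives the two terms, conjugation exchanging `ð` and `ð'`. -/
lemma nul_parts (hx : Dec s k x) (hy : Dec (s + 1) l y) (h : k + l < -3) :
    Nul (cj (ed s x) * y + cj x * ed' (s + 1) y) := by
  have h1 : Dec 1 (k + l) (cj x * y) := (hx.cj.mul hy).of_eq (by ring) rfl
  have h2 := nul_ed' h1 h
  rw [show (1 : ℤ) = -s + (s + 1) by ring, ed'_mul, ed'_cj, neg_neg] at h2
  exact h2

lemma nul_parts' (hx : Dec s k x) (hy : Dec (s - 1) l y) (h : k + l < -3) :
    Nul (cj (ed' s x) * y + cj x * ed (s - 1) y) := by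
  have h1 : Dec 1 (k + l) (cj (cj x * y)) := (hx.cj.mul hy).cj.of_eq (by ring) rfl
  have h2 := (nul_ed' h1 h).cj
  rw [ed'_cj, cj_cj, show (-1 : ℤ) = -s + (s - 1) by ring, ed_mul, ed_cj, neg_neg] at h2
  exact h2

lemma Dec.an (h : Dec (-2) k x) : Dec (-2) k (an x) := h.ed.ed'.neg

lemma nul_ed (hx : Dec (-2) k x) (hy : Dec (-2) l y) (h : k + l < -3) :
    Nul (cj (ed (-2) x) * ed (-2) y - cj x * an y) := by
  have := nul_parts hx hy.ed h
  simpa [an] using this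

/-- Commuting the inner `ð'` past `ð` on spin weight `-1` gives `ð' ð' ð ð = an² + 2 an`. -/
lemma nul_ed_ed (hx : Dec (-2) k x) (hy : Dec (-2) l y) (h : k + l < -3) :
    Nul (cj (ed (-1) (ed (-2) x)) * ed (-1) (ed (-2) y) - cj x * (an (an y) + (2 : ℂ) • an y)) := by
  have h1 := nul_parts hx.ed hy.ed.ed h
  have h2 := nul_ed hx (hy.an.add (hy.smul 2)) h
  have e : ed' (-2 + 1 + 1) (ed (-2 + 1) (ed (-2) y)) = -ed (-2) (an y + (2 : ℂ) • y) := by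
    rw [ed'_ed (s := -2 + 1) (by norm_num)]
    refine Sm.ext_ev fun x => ?_
    simp [an]
    ring
  rw [e] at h1
  have h3 := h1.add h2
  rw [mul_neg, ← sub_eq_add_neg, sub_add_sub_cancel, an_add, an_smul] at h3
  exact h3

/-- On spin weight `-2` the commutator turns `-ð ð'` into `an - 4`. -/
lemma nul_ed'_ed' (hx : Dec (-2) k x) (hy : Dec (-2) l y) (h : k + l < -3) :
    Nul (cj (ed' (-2) x) * ed' (-2) y - cj x * (an y - (4 : ℂ) • y)) := by
  have h1 := nul_parts' hx hy.ed' h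
  have e : ed (-2 - 1) (ed' (-2) y) = -(an y - (4 : ℂ) • y) := by
    have := ed'_ed (s := -2) (t := -1) (by norm_num) y
    refine Sm.ext_ev fun x => ?_
    have h3 := congrArg (ev x) this
    simp [an] at h3 ⊢
    rw [h3]
    norm_num
  rw [e, mul_neg, ← sub_eq_add_neg] at h1
  exact h1

lemma nul_an (hx : Dec (-2) k x) (hy : Dec (-2) l y) (h : k + l < -3) :
    Nul (cj (an x) * y - cj x * an y) := by
  have h1 := (nul_ed hx hy h).sub (nul_parts' (s := -2 + 1) hx.ed (hy.of_eq (by norm_num) rfl) h)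
  have e : cj (an x) * y - cj x * an y = cj (ed (-2) x) * ed (-2) y - cj x * an y -
      (cj (ed' (-1) (ed (-2) x)) * y + cj (ed (-2) x) * ed (-1 - 1) y) := by
    simp [an]; ring
  rw [e]
  exact h1

lemma dec_riC_pow_mul (h : Dec s k x) : Dec s (k - 6) (riC ^ 6 * x) := by
  rw [show riC ^ 6 * x = riC * (riC * (riC * (riC * (riC * (riC * x))))) by ring]
  exact h.riC_mul.riC_mul.riC_mul.riC_mul.riC_mul.riC_mul.of_eq rfl (by ring)

lemma an_riC_pow_mul (y : Sm M) : an (riC ^ 6 * y) = riC ^ 6 * an y := an_mul (by simp) (by simp) y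

/-- The weight `r⁻⁶` is constant on the spheres and can be attached to `y` beforehand; it makes the
product decay like `r^(2k - 6)`, which is integrable exactly because `k < 3/2`. -/
lemma nul_ed_r6 (hk : k < 3 / 2) (hx : Dec (-2) k x) (hy : Dec (-2) k y) :
    Nul (riC ^ 6 * (cj (ed (-2) x) * ed (-2) y - cj x * an y)) := by
  have h := nul_ed hx (dec_riC_pow_mul hy) (by linarith)
  rw [an_riC_pow_mul, ed_mul_left _ (by simp)] at h
  rwa [mul_sub, mul_left_comm, mul_left_comm _ (cj x)]

lemma nul_ed_ed_r6 (hk : k < 3 / 2) (hx : Dec (-2) k x) (hy : Dec (-2) k y) :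
    Nul (riC ^ 6 * (cj (ed (-1) (ed (-2) x)) * ed (-1) (ed (-2) y)
      - cj x * (an (an y) + (2 : ℂ) • an y))) := by
  have h := nul_ed_ed hx (dec_riC_pow_mul hy) (by linarith)
  rw [an_riC_pow_mul, an_riC_pow_mul, ed_mul_left _ (by simp), ed_mul_left _ (by simp),
    ← mul_smul_comm, ← mul_add] at h
  rwa [mul_sub, mul_left_comm, mul_left_comm _ (cj x)]

lemma nul_ed'_ed'_r6 (hk : k < 3 / 2) (hx : Dec (-2) k x) (hy : Dec (-2) k y) :
    Nul (riC ^ 6 * (cj (ed' (-2) x) * ed' (-2) y - cj x * (an y - (4 : ℂ) • y))) := by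
  have h := nul_ed'_ed' hx (dec_riC_pow_mul hy) (by linarith)
  rw [an_riC_pow_mul, ed'_mul_left _ (by simp), ← mul_smul_comm, ← mul_sub] at h
  rwa [mul_sub, mul_left_comm, mul_left_comm _ (cj x)]

/-- The symmetry of `an`, in the form needed for components split into a part free of `an` and an
explicit `an` term: afterwards no angular operator acts on a conjugated factor. -/
lemma nul_an_r6 {X x₀ : Sm M} (hk : k < 3 / 2) (e : X = x₀ + an x) (hx : Dec (-2) k x)
    (hy : Dec (-2) k y) : Nul (riC ^ 6 * (cj X * y - (cj x₀ * y + cj x * an y))) := by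
  have h := nul_an hx (dec_riC_pow_mul hy) (by linarith)
  rw [an_riC_pow_mul] at h
  have e' : riC ^ 6 * (cj X * y - (cj x₀ * y + cj x * an y)) =
      cj (an x) * (riC ^ 6 * y) - cj x * (riC ^ 6 * an y) := by
    rw [e, map_add]; ring
  rwa [e']

end Parts

/-! ### Equality of the energies -/

section Energy

variable {ψ : Sm M} {k : ℝ}

lemma dec_components (hψ : Dec (-2) k ψ) (hG : Dec (-2) k (GOf ψ)) :
    Dec (-2) k (w0C ψ) ∧ Dec (-2) k (uC ψ) ∧ Dec (-2) k (p0C ψ) ∧ Dec (-2) k (kapC ψ) ∧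
    Dec (-2) k (omegaC ψ) ∧ Dec (-2) k (ktC ψ) ∧ Dec (-2) k (PhiC ψ) ∧ Dec (-2) k (tauC ψ) ∧
    Dec (-2) k (sigC ψ) ∧ Dec (-2) k (tau1C ψ) ∧ Dec (-2) k (sig1C ψ) := by
  refine ⟨?_, ?_, ?_, ?_, ?_, ?_, ?_, ?_, ?_, ?_, ?_⟩ <;>
  simp only [w0C, uC, p0C, kapC, kap0C, omegaC, ktC, kt0C, PhiC, Phi0C, tauC, tau0C, tau1C, sigC,
    sig0C, sig1C] <;>
  repeat' first
    | exact hψ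
    | exact hG
    | with_reducible apply Dec.sub
    | with_reducible apply Dec.add
    | with_reducible apply Dec.neg
    | with_reducible apply Dec.smul
    | with_reducible apply Dec.nC_mul
    | with_reducible apply Dec.an
    | with_reducible apply Dec.th

/-- Decay is assumed for spatial derivatives only; the evolution equations extend it to time
derivatives. -/
lemma dec_dT_components (h : Teukolsky ψ) (hψ : Dec (-2) k ψ) (hG : Dec (-2) k (GOf ψ)) :
    Dec (-2) k (dT (w0C ψ)) ∧ Dec (-2) k (dT (uC ψ)) ∧ Dec (-2) k (dT (p0C ψ)) ∧
    Dec (-2) k (dT (kapC ψ)) ∧ Dec (-2) k (dT (ktC ψ)) := by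
  have e : ∀ a : Sm M, dT (nC * a) = nC * dT a := fun a => by simp
  refine ⟨?_, ?_, ?_, ?_, ?_⟩ <;>
  simp only [w0C, uC, p0C, kapC, kap0C, ktC, kt0C, map_add, map_sub,
    Derivation.map_smul, e, dT_an, dT_th, dT_psi ψ, dT_G h] <;>
  repeat' first
    | exact hψ
    | exact hG
    | with_reducible apply Dec.sub
    | with_reducible apply Dec.add
    | with_reducible apply Dec.neg
    | with_reducible apply Dec.smul
    | with_reducible apply Dec.nC_mul
    | with_reducible apply Dec.an
    | with_reducible apply Dec.th

lemma dec_bC (hψ : Dec (-2) k ψ) (hG : Dec (-2) k (GOf ψ)) : Dec 0 (k + k) (bC ψ) := by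
  have hb : Dec (-2) k (bPC ψ) ∧ Dec (-2) k (bGC ψ) ∧ Dec (-2) k (bHC ψ) := by
    refine ⟨?_, ?_, ?_⟩ <;>
    simp only [bPC, bGC, bHC] <;>
    repeat' first
      | exact hψ
      | exact hG
      | with_reducible apply Dec.sub
      | with_reducible apply Dec.add
      | with_reducible apply Dec.neg
      | with_reducible apply Dec.smul
      | with_reducible apply Dec.nC_mul
      | with_reducible apply Dec.an
      | with_reducible apply Dec.th
  obtain ⟨h1, h2, h3⟩ := hb
  exact (((hψ.cj.mul h1).add (hG.cj.mul h2)).add (hG.th.cj.mul h3)).of_eq (by norm_num) rfl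

/-- The densities of twice the canonical energy and of the Regge-Wheeler energy. -/
theorem nul_canQ_sub_dhrQ (h : Teukolsky ψ) (hk : k < 3 / 2) (hψ : Dec (-2) k ψ)
    (hG : Dec (-2) k (GOf ψ)) :
    Nul (niC * canQ (riC ^ 2 * ed (-1) (ed (-2) (uC ψ))) (nC * (riC * ed (-2) (w0C ψ)))
      (riC ^ 2 * WC ψ) - dhrQ (riC ^ 2 * PhiC ψ)) := by
  obtain ⟨dw0, du, dp0, dkap, domega, dkt, dPhi, dtau, dsig, dtau1, dsig1⟩ :=
    dec_components hψ hG
  obtain ⟨tw0, tu, tp0, tkap, tkt⟩ := dec_dT_components h hψ hG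
  -- `n1` to `n7` integrate the canonical density by parts on the spheres, `n8` to `n12` the
  -- Regge-Wheeler density, and `n13` is the radial flux.
  have n1 := nul_ed_ed_r6 hk dp0 tu
  have n2 := nul_ed_ed_r6 hk du tp0
  have n3 := nul_ed_r6 hk dkap tw0
  have n4 := nul_an_r6 (X := kapC ψ) (x₀ := kap0C ψ) hk (by simp [kapC]; ring)
    (hψ.smul (1 / 8)).neg tw0.an
  have n5 := nul_ed_r6 hk dw0 tkap
  have n6 := nul_an_r6 (X := ktC ψ) hk rfl (hψ.th.smul (1 / 4)) domega.nC_mul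
  have n7 := nul_an_r6 (X := WC ψ) (x₀ := WC ψ + an ((1 / 2 : ℂ) • ψ)) hk (by simp)
    (hψ.smul (1 / 2)).neg tkt
  have n8 := nul_an_r6 (X := tauC ψ) hk rfl dtau1 dtau.nC_mul
  have n9 := nul_an_r6 (X := sigC ψ) hk rfl dsig1 dsig.nC_mul
  have n10 := nul_ed_r6 hk dPhi dPhi.nC_mul
  have n11 := nul_ed'_ed'_r6 hk dPhi dPhi.nC_mul
  -- After `n10` and `n11` the two angular squares, each with weight `1/2`, give `an - 2`; together
  -- with the potential `1 + 3 N²` the operator acting on `PhiC` is `an - 1 + 3 N²`. The remaining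
  -- `an` in the conjugated factor is moved here.
  have n12 := nul_an_r6 (X := PhiC ψ) hk rfl (hψ.smul (-(1 / 2)))
    ((dPhi.an.sub dPhi).add (dPhi.nC_mul.nC_mul.smul 3)).nC_mul
  have n13 := nul_radial (b := riC ^ 3 * bC ψ) (k := k + k - 3) (by
    rw [show riC ^ 3 * bC ψ = riC * (riC * (riC * bC ψ)) by ring]
    exact (dec_bC hψ hG).riC_mul.riC_mul.riC_mul.of_eq rfl (by ring)) (by linarith)
  have hn := ((((((((((((n1.sub n2).add (n3.smul 4)).add (n4.smul 4)).sub (n5.smul 4)).sub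
    (n6.smul 2)).add (n7.smul 2)).sub n8).sub n9).sub (n10.smul (1 / 2))).sub
    (n11.smul (1 / 2))).sub n12).add n13)
  convert hn using 1
  rw [canQ_eq h, dhrQ_eq h]
  refine Sm.ext_ev fun x => ?_
  have hi := congrArg (ev x) (energy_identity h)
  -- Differentiating `r⁻³` gives `-3 N r⁻³`, which is the undifferentiated flux term in
  -- `energy_identity`.
  have eb : ev x (th (nC * (riC ^ 3 * bC ψ))) =
      (rv x)⁻¹ ^ 3 * (ev x (th (nC * bC ψ)) - 3 * nv x * nv x * ev x (bC ψ)) := by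
    simp only [Derivation.leibniz, Derivation.leibniz_pow, th_nC, th_riC]
    simp
    ring
  simp only [map_add, map_sub, map_mul, map_neg, map_smul, smul_eq_mul, map_pow, ev_cj, ev_nC,
    ev_riC, map_ofNat, an_nC_mul, an_add, an_sub, an_smul, cj_smul, eb, map_one,
    ed_mul_left _ (show dm (nC : Sm M) = 0 by simp),
    ed'_mul_left _ (show dmb (nC : Sm M) = 0 by simp)] at hi ⊢
  linear_combination (rv x)⁻¹ ^ 6 * hi

end Energy

open MeasureTheory in
lemma Nul.integral_eq {a b : Sm M} (h : Nul (a - b))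
    (hb : IntegrableOn (onS (volC * b)) (sigmaDom M)) :
    IntegrableOn (onS (volC * a)) (sigmaDom M) ∧
      ∫ y in sigmaDom M, onS (volC * a) y = ∫ y in sigmaDom M, onS (volC * b) y := by
  have e := onS_add (volC * (a - b)) (volC * b)
  rw [← mul_add, sub_add_cancel] at e
  refine ⟨(h.1.add hb).congr_fun e.symm (measurableSet_sigmaDom M), ?_⟩
  rw [setIntegral_congr_fun (measurableSet_sigmaDom M) e]
  simp only [Pi.add_apply]
  rw [integral_add h.1 hb, h.2, zero_add]

open MeasureTheory in
lemma integral_onS_smul (c : ℂ) (a : Sm M) :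
    ∫ y in sigmaDom M, onS (volC * c • a) y = c * ∫ y in sigmaDom M, onS (volC * a) y := by
  have e := onS_smul c (volC * a)
  rw [← mul_smul_comm] at e
  rw [setIntegral_congr_fun (measurableSet_sigmaDom M) e]
  simp only [Pi.smul_apply]
  rw [integral_smul, smul_eq_mul]

open MeasureTheory in
lemma integrableOn_onS_smul (c : ℂ) {a : Sm M} (h : IntegrableOn (onS (volC * a)) (sigmaDom M)) :
    IntegrableOn (onS (volC * c • a)) (sigmaDom M) := by
  have e := onS_smul c (volC * a)
  rw [← mul_smul_comm] at e
  exact IntegrableOn.congr_fun (h.smul c) e.symm (measurableSet_sigmaDom M)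

open MeasureTheory in
lemma integrableOn_dhrQ {ψ : Sm M} {k : ℝ} (h : Teukolsky ψ) (hk : k < 3 / 2)
    (hψ : Dec (-2) k ψ) (hG : Dec (-2) k (GOf ψ)) :
    IntegrableOn (onS (volC * dhrQ (riC ^ 2 * PhiC ψ))) (sigmaDom M) := by
  obtain ⟨-, -, -, -, -, -, dPhi, dtau, dsig, -, -⟩ := dec_components hψ hG
  have hsq : ∀ {s : ℤ} {a : Sm M}, Dec s k a → Dec 0 (k + k) (cj a * a) := fun ha =>
    (ha.cj.mul ha).of_eq (by ring) rfl
  have hP : Dec 0 (k + k) ((1 + 3 * nC ^ 2) * (cj (PhiC ψ) * PhiC ψ)) := by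
    have e : (1 + 3 * nC ^ 2) * (cj (PhiC ψ) * PhiC ψ) =
        cj (PhiC ψ) * PhiC ψ + (3 : ℂ) • (nC * (nC * (cj (PhiC ψ) * PhiC ψ))) :=
      Sm.ext_ev fun x => by simp; ring
    rw [e]
    exact (hsq dPhi).add ((hsq dPhi).nC_mul.nC_mul.smul 3)
  rw [dhrQ_eq h]
  exact (dec_riC_pow_mul ((((hsq dtau).add (hsq dsig)).add
    (((hsq dPhi.ed).add (hsq dPhi.ed')).smul (1 / 2))).add hP).nC_mul).integrable (by linarith)

end SchwarzschildHertz

end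

/-! ### Assembly of the representations and of the equality of the integrals. -/

theorem mainTheorem4 (M : ℝ) (hM : 0 < M)
    (H : Pt → Fin 4 → Fin 4 → ℝ)
    (hsmooth : ContDiffOn ℝ ∞ H (cartExterior M))
    (hsymm : ∀ X ∈ cartExterior M, ∀ i j, H X i j = H X j i)
    (hEinstein : ∀ x ∈ exterior M, ∀ a b, linEinstein M (toSpherical H) a b x = 0)
    (hdata : HertzData M (teukolskyVar M (toSpherical H))) :
    (∀ x ∈ exterior M, ∀ a b, dhrTensor M (toSpherical H) a b x =
      -(x 1 / 4 : ℂ) * mmTensor M (dhrScalar M (teukolskyVar M (toSpherical H))) a b x) ∧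
    SigmaIntegrable M (dhrDensity M (dhrTensor M (toSpherical H))) ∧
    dhrEnergy M (toSpherical H) = 1 / 8 *
      sigmaInt M (dhrScalarDensity M (dhrScalar M (teukolskyVar M (toSpherical H)))) ∧
    SigmaIntegrable M
      (canonicalDensity M (hertzMetric M (teukolskyVar M (toSpherical H)))) ∧
    dhrEnergy M (toSpherical H) =
      4 * Real.pi * canonicalEnergy M (hertzMetric M (teukolskyVar M (toSpherical H))) := by
  have : Fact (0 < M) := ⟨hM⟩
  obtain ⟨T', hT, hs⟩ := exists_rep_toSpherical hsmooth hsymm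
  obtain ⟨ψ, hψ, ht⟩ := exists_teukolsky hT hs hEinstein
  obtain ⟨k, hk, dψ, dG⟩ := hdata.dec hψ
  have rS := rep_dhrScalar hψ
  have rT := rep_dhrTensor hψ
  have rD := rep_dhrDensity rT
  have rDS := rep_dhrScalarDensity rS
  have rE := rep_canonicalDensity (rep_hertzMetric (rep_hertzU hψ) (rep_hertzV hψ) (rep_hertzW hψ ht))
  have hn := nul_canQ_sub_dhrQ ht hk dψ dG
  have hi := integrableOn_dhrQ ht hk dψ dG
  rw [← scalarOf_eq ht] at hn hi
  have hc := hn.integral_eq hi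
  have eD : dhrEnergy M (toSpherical H) = 1 / 8 *
      sigmaInt M (dhrScalarDensity M (dhrScalar M (teukolskyVar M (toSpherical H)))) := by
    unfold dhrEnergy
    rw [rD.sigmaInt, rDS.sigmaInt, integral_onS_smul]
  refine ⟨fun x hx a b => ?_, rD.sigmaIntegrable (integrableOn_onS_smul _ hi), eD,
    rE.sigmaIntegrable (integrableOn_onS_smul _ hc.1), ?_⟩
  · rw [rT a b ⟨x, hx⟩, rep_mmTensor rS a b ⟨x, hx⟩, mC_smul (by simp), mC_mul (by simp)]
    simp only [map_smul, map_mul, ev_rC, smul_eq_mul, rv]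
    ring
  -- The canonical density is half of `niC * canQ`, whose integral equals that of `dhrQ`; with the
  -- normalisation `1 / 16π` this gives `4π / (16π · 2) = 1/8`, the factor already found for the
  -- Regge-Wheeler energy.
  · rw [eD, rDS.sigmaInt]
    unfold canonicalEnergy
    rw [rE.sigmaInt, integral_onS_smul, hc.2]
    have := Real.pi_ne_zero
    field_simp
    ring
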